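/- Setting. Let $(\Omega,\mathcal F,\mathbf P)$ be a probability space, $T>0$, $r\ge 0$, $W$ a standard $d$-dimensional Brownian motion on $[0,T]$ and $\mathbb F=(\mathcal F(t))_{t\in[0,T]}$ its augmented filtration. Let $\sigma\in\mathbb R^{d\times d}$ with $\Sigma:=\sigma\sigma'$ positive definite, and let $\Lambda\in\mathbb R^{d\times d}$ be diagonal and positive definite. $\mathcal H^2$ is the class of optional $\mathbb R^d$-valued processes $X$ on $[0,T]$ with $\mathbb E\int_0^T\|X(t)\|^2dt<\infty$, and $\mathcal H^\infty$ is the class of essentially bounded optional ones; processes that agree $dt\otimes d\mathbf P$-a.e. are identified in these classes. $\mathcal A$ is the class of continuous $X\in\mathcal H^\infty$ with $dX(t)=a^X(t)\,dt+dM^X(t)$, $X(T)=0$, where $a^X\in\mathcal H^\infty$ and $M^X\in\mathcal H^\infty$ is an $\mathbb F$-martingale. A trading rate $\dot\phi$ has the demand $\phi(t)=\int_0^t\dot\phi(s)\,ds$. There are $N=2$ investors with risk tolerances $\delta_1,\delta_2>0$ (possibly different) and exposures $\zeta_1,\zeta_2\in\mathcal H^\infty$, and noise traders with demand $\psi(t)=\int_0^t\dot\psi(s)\,ds$,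 where $\dot\psi\in\mathcal A$. At returns $\nu$, the objective of investor $m$ with exposure $z$ is $$\mathcal F_{m}(\phi;z,\nu)=\mathbb E\int_0^Te^{-rt}\Big(\phi'\nu-\tfrac1{2\delta_m}(\phi+z)'\Sigma(\phi+z)\Big)dt$$ without transaction costs, and $$\mathcal F_{\Lambda,m}(\dot\phi;z,\nu)=\mathbb E\int_0^Te^{-rt}\Big(\phi'\nu-\tfrac1{2\delta_m}(\phi+z)'\Sigma(\phi+z)-\dot\phi'\Lambda\dot\phi\Big)dt$$ with transaction costs. A price taker maximizes $\mathcal F_m$ over $\phi\in\mathcal H^2$, respectively $\mathcal F_{\Lambda,m}$ over $\dot\phi\in\mathcal H^2$. Best responses. Without transaction costs, a price impact of a demand $\phi\in\mathcal H^2$ of investor $n$, when the other investor $j$ has exposure $z_j$, is a process $\nu_n(\phi)\in\mathcal H^2$ such that the market clears when $j$ uses a price-taking optimal demand $\phi_j$ for exposure $z_j$ and returns $\nu_n(\phi)$, that is, $\phi+\phi_j+\psi=0$. With transaction costs, a price impact of $\dot\phi\in\mathcal A$ is a process $\nu_n(\dot\phi)\in\mathcal H^\infty$ defined in the same way through a price-taking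 optimal rate $\dot\phi_j$ and the clearing conditions $\phi+\phi_j+\psi=0$ and $\dot\phi+\dot\phi_j+\dot\psi=0$ on $[0,T]$. A best response of investor $n$ to $z_j$ is a maximizer of $\phi\mapsto\mathcal F_n(\phi;\zeta_n,\nu_n(\phi))$ over $\mathcal H^2$, respectively of $\dot\phi\mapsto\mathcal F_{\Lambda,n}(\dot\phi;\zeta_n,\nu_n(\dot\phi))$ over $\mathcal A$. Nash equilibrium. At returns $\nu$ and demand $\phi_m$, investor $m$ reveals the exposure $\delta_m\Sigma^{-1}\nu-\phi_m$. A process $\nu$ in $\mathcal H^2$ (without transaction costs), respectively in $\mathcal H^\infty$ (with transaction costs), is called Nash equilibrium returns if there are demands, respectively trading rates, of the two investors that clear the market together with the noise traders and such that each of them is a best response to the exposure that the other investor reveals at $\nu$. Theorem. Put $\delta=\delta_1+\delta_2$, $\lambda_m=\delta_m/\delta$ and $\zeta=\zeta_1+\zeta_2$. The market without transaction costs has, up to $dt\otimes d\mathbf P$-null sets, exactly one process of Nash equilibrium returns, namely $$\breve\mu=\frac{\Sigma}{\delta}\,\frac{(\zeta-\psi)-\sum_{m=1}^2\lambda_m\zeta_m}{1-\sum_{m=1}^2\lambda_m^2}.$$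 The market with transaction costs also has, up to $dt\otimes d\mathbf P$-null sets, exactly one process of Nash equilibrium returns, namely $$\breve\mu_\Lambda=\breve\mu+\Lambda\big(a^{\dot\psi}-r\dot\psi\big)\in\mathcal H^\infty.$$ -/

import Mathlib

open MeasureTheory ProbabilityTheory Filter Topology

noncomputable section

namespace PriceImpact

/-- The time interval `[0,T]`. -/
abbrev Horizon (T : ℝ) : Type := Set.Icc (0 : ℝ) T

/-- Lebesgue measure on `[0,T]`. -/
def leb (T : ℝ) : Measure (Horizon T) := Measure.comap Subtype.val volume

/-- The state space `ℝ^d` with its Euclidean norm and inner product. -/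
abbrev Vec (d : ℕ) : Type := EuclideanSpace ℝ (Fin d)

/-- An `ℝ^d`-valued process on `[0,T] × Ω`. -/
abbrev Proc (T : ℝ) (Ω : Type*) (d : ℕ) : Type _ := Horizon T → Ω → Vec d

/-- The product of a matrix with a vector of `ℝ^d`. -/
abbrev act {d : ℕ} (A : Matrix (Fin d) (Fin d) ℝ) (x : Vec d) : Vec d :=
  Matrix.toEuclideanLin A x

section Stochastics

variable {Ω : Type*} {mΩ : MeasurableSpace Ω} {T : ℝ} {d : ℕ}

/-- The σ-algebra generated by `W u`, `u ≤ t`. -/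
@[reducible]
def pastSigma (W : Proc T Ω d) (t : Horizon T) : MeasurableSpace Ω :=
  MeasurableSpace.generateFrom
    {S | ∃ u : Horizon T, u ≤ t ∧ ∃ B : Set (Vec d), MeasurableSet B ∧ S = W u ⁻¹' B}

/-- `W` is a standard `d`-dimensional Brownian motion on `[0,T]`: it starts at `0`, has continuous
paths, and for `s ≤ t` the increment `W t - W s` is independent of `σ(W u : u ≤ s)` and has the
Gaussian law with mean `0` and covariance `(t - s) I`. -/
structure IsBrownianMotion (P : Measure Ω) (W : Proc T Ω d) : Prop where
  measurable : ∀ t, Measurable (W t)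
  start : ∀ᵐ ω ∂P, ∀ t : Horizon T, (t : ℝ) = 0 → W t ω = 0
  continuous_paths : ∀ᵐ ω ∂P, Continuous fun t => W t ω
  indep_increments : ∀ s t : Horizon T, s ≤ t →
    Indep (pastSigma W s) (MeasurableSpace.comap (fun ω => W t ω - W s ω) inferInstance) P
  gaussian_increments : ∀ s t : Horizon T, s ≤ t →
    P.map (fun ω => W t ω - W s ω) =
      (stdGaussian (Vec d)).map (fun x => Real.sqrt ((t : ℝ) - (s : ℝ)) • x)

/-- The augmented filtration generated by `W`: the σ-algebra at time `t` is generated by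
`W u`, `u ≤ t`, and by all null events of the underlying probability space. -/
def augmentedFiltration (P : Measure Ω) (W : Proc T Ω d) (hW : ∀ t, Measurable (W t)) :
    Filtration (Horizon T) mΩ where
  seq t := pastSigma W t ⊔
    MeasurableSpace.generateFrom {S : Set Ω | MeasurableSet S ∧ P S = 0}
  mono' := by
    intro s t hst
    refine sup_le_sup_right (MeasurableSpace.generateFrom_mono ?_) _
    rintro S ⟨u, hu, B, hB, rfl⟩
    exact ⟨u, hu.trans hst, B, hB, rfl⟩
  le' := by
    intro t
    refine sup_le (MeasurableSpace.generateFrom_le ?_)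
      (MeasurableSpace.generateFrom_le fun _ hS => hS.1)
    rintro S ⟨u, -, B, hB, rfl⟩
    exact hW u hB

/-- Real-valued adapted processes all of whose paths are right-continuous with left limits. -/
def IsCadlagAdapted (F : Filtration (Horizon T) mΩ) (Y : Horizon T → Ω → ℝ) : Prop :=
  Adapted F Y ∧ ∀ ω t, ContinuousWithinAt (fun s => Y s ω) (Set.Ici t) t ∧
    ∃ l : ℝ, Tendsto (fun s => Y s ω) (𝓝[<] t) (𝓝 l)

/-- The optional σ-algebra on `[0,T] × Ω`: the one generated by the càdlàg adapted processes. -/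
@[reducible]
def optionalSigma (F : Filtration (Horizon T) mΩ) : MeasurableSpace (Horizon T × Ω) :=
  MeasurableSpace.generateFrom {S | ∃ Y : Horizon T → Ω → ℝ, IsCadlagAdapted F Y ∧
    ∃ B : Set ℝ, MeasurableSet B ∧ S = {p | Y p.1 p.2 ∈ B}}

def IsOptional (F : Filtration (Horizon T) mΩ) (X : Proc T Ω d) : Prop :=
  @Measurable _ _ (optionalSigma F) _ (fun p : Horizon T × Ω => X p.1 p.2)

/-- The class `H²`: optional processes with `E ∫₀ᵀ ‖X t‖² dt < ∞`. -/
def MemH2 (P : Measure Ω) (F : Filtration (Horizon T) mΩ) (X : Proc T Ω d) : Prop :=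
  IsOptional F X ∧ ∫⁻ ω, ∫⁻ t, ‖X t ω‖ₑ ^ 2 ∂leb T ∂P < ⊤

/-- The class `H^∞`: optional processes that are essentially bounded. -/
def MemHInfty (P : Measure Ω) (F : Filtration (Horizon T) mΩ) (X : Proc T Ω d) : Prop :=
  IsOptional F X ∧ ∃ C : ℝ, ∀ᵐ ω ∂P, ∀ᵐ t ∂leb T, ‖X t ω‖ ≤ C

/-- `X` belongs to the class `𝒜` and has drift `a`: `X` is a continuous process in `H^∞` with
`dX = a dt + dM` and `X T = 0`, where `a ∈ H^∞` and `M` is a martingale in `H^∞`. -/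
structure MemAWithDrift (P : Measure Ω) (F : Filtration (Horizon T) mΩ)
    (X a : Proc T Ω d) : Prop where
  bounded : MemHInfty P F X
  continuous_paths : ∀ ω, Continuous fun t => X t ω
  terminal : ∀ᵐ ω ∂P, ∀ t : Horizon T, (t : ℝ) = T → X t ω = 0
  drift_bounded : MemHInfty P F a
  decomposition : ∃ M : Proc T Ω d, MemHInfty P F M ∧ Martingale M F P ∧
    ∀ᵐ ω ∂P, ∀ s t : Horizon T, s ≤ t →
      X t ω - X s ω = (∫ u in Set.Ioc s t, a u ω ∂leb T) + (M t ω - M s ω)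

def MemA (P : Measure Ω) (F : Filtration (Horizon T) mΩ) (X : Proc T Ω d) : Prop :=
  ∃ a, MemAWithDrift P F X a

/-- The process `t ↦ ∫₀ᵗ X s ds`. The demand that belongs to a trading rate `X` is `cumulative X`;
the class `𝒲_𝒜` consists of the processes `cumulative X` with `X ∈ 𝒜`. -/
def cumulative (X : Proc T Ω d) : Proc T Ω d :=
  fun t ω => ∫ s in Set.Iic t, X s ω ∂leb T

/-- Equality `dt ⊗ dP`-almost everywhere, that is, equality in `H^p`. -/
def EqAE (P : Measure Ω) (X Y : Proc T Ω d) : Prop :=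
  ∀ᵐ ω ∂P, ∀ᵐ t ∂leb T, X t ω = Y t ω

end Stochastics

/-- The exogenous data of a market with `d` risky assets and `N` investors. -/
structure Market (Ω : Type*) [MeasurableSpace Ω] (d N : ℕ) where
  /-- time horizon -/
  T : ℝ
  /-- discount rate -/
  r : ℝ
  /-- the driving Brownian motion -/
  W : Proc T Ω d
  measurable_W : ∀ t, Measurable (W t)
  /-- volatility matrix -/
  σ : Matrix (Fin d) (Fin d) ℝ
  /-- transaction cost matrix -/
  Λ : Matrix (Fin d) (Fin d) ℝ
  /-- risk tolerances -/
  δ : Fin N → ℝ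
  /-- risk exposures of the endowments -/
  ζ : Fin N → Proc T Ω d
  /-- trading rate of the noise traders -/
  ψdot : Proc T Ω d

namespace Market

variable {Ω : Type*} [MeasurableSpace Ω] {d N : ℕ} (K : Market Ω d N) (P : Measure Ω)

def filtration : Filtration (Horizon K.T) ‹MeasurableSpace Ω› :=
  augmentedFiltration P K.W K.measurable_W

/-- The infinitesimal covariance matrix `Σ = σ σ'`. -/
def cov : Matrix (Fin d) (Fin d) ℝ := K.σ * K.σ.transpose

/-- The noise traders' demand. -/
def ψ : Proc K.T Ω d := cumulative K.ψdot

/-- The exposures that the investors reveal by demands `φ` at returns `ν`: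
`ζ_m(φ) = δ_m Σ⁻¹ ν - φ_m`. -/
def revealedExposure (ν : Proc K.T Ω d) (φ : Fin N → Proc K.T Ω d) :
    Fin N → Proc K.T Ω d :=
  fun m t ω => K.δ m • act K.cov⁻¹ (ν t ω) - φ m t ω

/-! ### The market without transaction costs -/

/-- The objective `E ∫₀ᵀ e^{-rt} (φ'ν - (φ + z)'Σ(φ + z) / (2 δ_m)) dt` of investor `m`, with
exposure `z`, for the demand `φ` at returns `ν`. -/
def objective (m : Fin N) (z ν φ : Proc K.T Ω d) : ℝ :=
  ∫ ω, ∫ t : Horizon K.T, Real.exp (-K.r * (t : ℝ)) *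
    (inner ℝ (φ t ω) (ν t ω)
      - 1 / (2 * K.δ m) * inner ℝ (φ t ω + z t ω) (act K.cov (φ t ω + z t ω))) ∂leb K.T ∂P

/-- `φ` is optimal for investor `m`, with exposure `z`, acting as a price taker at returns `ν`. -/
def IsPriceTakerDemand (m : Fin N) (z ν φ : Proc K.T Ω d) : Prop :=
  MemH2 P (K.filtration P) φ ∧
    ∀ η, MemH2 P (K.filtration P) η → K.objective P m z ν η ≤ K.objective P m z ν φ

def Clears (φ : Fin N → Proc K.T Ω d) : Prop :=
  EqAE P (fun t ω => (∑ m, φ m t ω) + K.ψ t ω) 0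

/-- `ν` is the price impact `ν_n(φ)`: the returns at which the market clears when investor `n`
has demand `φ` and every other investor `m` acts as a price taker with exposure `z m`. -/
def IsPriceImpact (n : Fin N) (z : Fin N → Proc K.T Ω d) (φ ν : Proc K.T Ω d) : Prop :=
  MemH2 P (K.filtration P) ν ∧ ∃ Φ : Fin N → Proc K.T Ω d, Φ n = φ ∧
    (∀ m, m ≠ n → K.IsPriceTakerDemand P m (z m) ν (Φ m)) ∧ K.Clears P Φ

/-- `φ` maximizes the objective of investor `n` adjusted for her price impact, `φ ↦ F_n(φ)` at
returns `ν_n(φ)`, when the other investors have exposures `z m`. -/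
def IsBestResponse (n : Fin N) (z : Fin N → Proc K.T Ω d) (φ : Proc K.T Ω d) : Prop :=
  MemH2 P (K.filtration P) φ ∧ ∃ ν, K.IsPriceImpact P n z φ ν ∧
    ∀ φ' ν', MemH2 P (K.filtration P) φ' → K.IsPriceImpact P n z φ' ν' →
      K.objective P n (K.ζ n) ν' φ' ≤ K.objective P n (K.ζ n) ν φ

/-- `ν` are Nash equilibrium returns without transaction costs: the market clears at demands each
of which is a best response to the exposures revealed by the other investors. -/
def IsFrictionlessNashReturns (ν : Proc K.T Ω d) : Prop :=
  MemH2 P (K.filtration P) ν ∧ ∃ φ : Fin N → Proc K.T Ω d,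
    (∀ n, K.IsBestResponse P n (K.revealedExposure ν φ) (φ n)) ∧ K.Clears P φ

/-- Aggregate risk tolerance. -/
def totalTolerance : ℝ := ∑ m, K.δ m

/-- Relative risk tolerance. -/
def relTolerance (m : Fin N) : ℝ := K.δ m / K.totalTolerance

/-- The process `(Σ/δ) ((ζ - ψ) - ∑ λ_m ζ_m) / (1 - ∑ λ_m²)`. -/
def frictionlessReturns : Proc K.T Ω d := fun t ω =>
  (1 / (K.totalTolerance * (1 - ∑ m, K.relTolerance m ^ 2))) •
    act K.cov ((∑ m, K.ζ m t ω) - K.ψ t ω - ∑ m, K.relTolerance m • K.ζ m t ω)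

/-! ### The market with transaction costs

Demands are of the form `cumulative θ`, with `θ` the trading rate. -/

/-- The objective `E ∫₀ᵀ e^{-rt} (φ'ν - (φ + z)'Σ(φ + z) / (2 δ_m) - θ'Λθ) dt` of investor `m`,
with exposure `z`, for the trading rate `θ` and the demand `φ = cumulative θ` at returns `ν`. -/
def costObjective (m : Fin N) (z ν θ : Proc K.T Ω d) : ℝ :=
  ∫ ω, ∫ t : Horizon K.T, Real.exp (-K.r * (t : ℝ)) *
    (inner ℝ (cumulative θ t ω) (ν t ω)
      - 1 / (2 * K.δ m) *
          inner ℝ (cumulative θ t ω + z t ω) (act K.cov (cumulative θ t ω + z t ω))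
      - inner ℝ (θ t ω) (act K.Λ (θ t ω))) ∂leb K.T ∂P

/-- `θ` is an optimal trading rate for investor `m`, with exposure `z`, acting as a price taker at
returns `ν`. -/
def IsCostPriceTakerRate (m : Fin N) (z ν θ : Proc K.T Ω d) : Prop :=
  MemH2 P (K.filtration P) θ ∧
    ∀ η, MemH2 P (K.filtration P) η → K.costObjective P m z ν η ≤ K.costObjective P m z ν θ

/-- Both the demands and the trading rates clear the market at all times. -/
def CostClears (θ : Fin N → Proc K.T Ω d) : Prop :=
  ∀ᵐ ω ∂P, ∀ t,
    (∑ m, cumulative (θ m) t ω) + K.ψ t ω = 0 ∧ (∑ m, θ m t ω) + K.ψdot t ω = 0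

/-- `ν` is the price impact of investor `n` with trading rate `θ`: the returns at which the market
clears when every other investor `m` acts as a price taker with exposure `z m`. -/
def IsCostPriceImpact (n : Fin N) (z : Fin N → Proc K.T Ω d) (θ ν : Proc K.T Ω d) : Prop :=
  MemHInfty P (K.filtration P) ν ∧ ∃ Θ : Fin N → Proc K.T Ω d, Θ n = θ ∧
    (∀ m, m ≠ n → K.IsCostPriceTakerRate P m (z m) ν (Θ m)) ∧ K.CostClears P Θ

/-- `θ ∈ 𝒜` maximizes over `𝒜` the objective of investor `n` adjusted for her price impact, when
the other investors have exposures `z m`. -/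
def IsCostBestResponse (n : Fin N) (z : Fin N → Proc K.T Ω d) (θ : Proc K.T Ω d) : Prop :=
  MemA P (K.filtration P) θ ∧ ∃ ν, K.IsCostPriceImpact P n z θ ν ∧
    ∀ θ' ν', MemA P (K.filtration P) θ' → K.IsCostPriceImpact P n z θ' ν' →
      K.costObjective P n (K.ζ n) ν' θ' ≤ K.costObjective P n (K.ζ n) ν θ

/-- `ν` are Nash equilibrium returns with transaction costs: the market clears at trading rates
each of which is a best response to the exposures revealed by the other investors' demands. -/
def IsCostNashReturns (ν : Proc K.T Ω d) : Prop :=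
  MemHInfty P (K.filtration P) ν ∧ ∃ θ : Fin N → Proc K.T Ω d,
    (∀ n, K.IsCostBestResponse P n (K.revealedExposure ν fun m => cumulative (θ m)) (θ n)) ∧
    K.CostClears P θ

end Market

end PriceImpact

end

/-! Every optimisation here is a concave quadratic problem, so optimality is equivalent to a linear
first-order condition, and the equilibrium returns come out of linear algebra.

Without costs, a price taker j with exposure z_j satisfies ν = δ_j⁻¹ Σ(φ_j + z_j). Clearing forces
φ_j = -φ - ψ, so the price impact of φ is δ_j⁻¹ Σ(z_j - φ - ψ): affine in φ with negative slope. The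
best response therefore solves another concave quadratic problem (`gain_le_iff`). At the exposure
revealed by the other investor the impact of φ_n is ν itself (`act_cov_revealedExposure`), so the
two conditions read ν = (δ₀⁻¹ + δ₁⁻¹) Σφ_n + δ_n⁻¹ Σζ_n. Their sum contains the demands only through
φ₀ + φ₁ = -ψ and determines ν; conversely each condition can be solved for φ_n.

With costs, integration by parts (`discounted_cumulative_drift`) rewrites the variation of θ'Λθ as a
pairing of the change of the demand with Λ(a - rθ), where a is the drift of θ. The condition of a
price taker gains the term 2Λ(a - rθ), so the price impact now contains the drift as well. This adds
a symmetric form to the problem of the strategic investor, and her own cost term becomes 4Λ(a - rθ)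
(`gain_le_iff_of_cost_impact`). In the sum of the two conditions the drifts clear too, a₀ + a₁ =
-a^ψ, and all cost terms collapse to -2Λ(a^ψ - rψ̇); halving gives the correction of the returns.

Two points need stochastic analysis. Best responses can be varied only within 𝒜, and
`eqAE_zero_of_orthogonal` shows that these variations suffice: the test rate is E[∫_t^T v | F_t].
Existence requires rates that solve the first-order conditions, a linear forward-backward system
(`exists_forwardBackward`), which is decoupled by simultaneous diagonalisation and solved by an
explicit scalar formula. Both rest on continuous versions of bounded Brownian martingales
(`exists_continuousVersion`), obtained from the Markov property, Doob's maximal inequality and a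
Dynkin argument, without a representation theorem. -/

noncomputable section

namespace PriceImpact

/-! ### Lebesgue measure on `[0,T]` and primitives of integrable paths. -/

section Time

set_option linter.unusedSectionVars false

variable {T : ℝ} {E : Type*} [NormedAddCommGroup E] [NormedSpace ℝ E]

lemma map_val_leb (T : ℝ) : (leb T).map Subtype.val = volume.restrict (Set.Icc 0 T) :=
  map_comap_subtype_coe measurableSet_Icc volume

instance instIsFiniteMeasureLeb (T : ℝ) : IsFiniteMeasure (leb T) := by
  refine ⟨?_⟩
  have : leb T Set.univ = ((leb T).map Subtype.val) Set.univ := by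
    rw [Measure.map_apply measurable_subtype_coe MeasurableSet.univ, Set.preimage_univ]
  rw [this, map_val_leb]
  exact measure_lt_top _ _

instance instNullSingletonClassLeb (T : ℝ) : NullSingletonClass (leb T) := by
  refine ⟨fun x => ?_⟩
  rw [leb, comap_subtype_coe_apply measurableSet_Icc]
  simp

/-- Upgrades almost-everywhere statements about continuous paths to all times. For `T = 0` it fails,
as the single point is a null set. -/
lemma isOpenPosMeasure_leb (hT : 0 < T) : (leb T).IsOpenPosMeasure := by
  refine ⟨fun U hU ⟨x, hx⟩ => ?_⟩
  rw [leb, comap_subtype_coe_apply measurableSet_Icc]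
  obtain ⟨V, hV, rfl⟩ := isOpen_induced_iff.1 hU
  obtain ⟨ε, hε, hball⟩ := Metric.isOpen_iff.1 hV _ hx
  have hx2 := x.2
  have hsub : Set.Ioo (max 0 (x - ε)) (min T (x + ε)) ⊆
      Subtype.val '' (Subtype.val ⁻¹' V : Set (Horizon T)) := by
    intro y hy
    simp only [Set.mem_Ioo, max_lt_iff, lt_min_iff] at hy
    refine ⟨⟨y, hy.1.1.le, hy.2.1.le⟩, ?_, rfl⟩
    apply hball
    rw [Metric.mem_ball, Real.dist_eq, abs_lt]
    constructor <;> linarith [hy.1.2, hy.2.2]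
  refine (lt_of_lt_of_le ?_ (measure_mono hsub)).ne'
  rw [Real.volume_Ioo, ENNReal.ofReal_pos, sub_pos]
  simp only [max_lt_iff, lt_min_iff]
  exact ⟨⟨hT, by linarith [hx2.2]⟩, by linarith [hx2.1], by linarith⟩

/-- The primitive `t ↦ ∫₀ᵗ f` of a path on `[0,T]`. -/
def primitive (f : Horizon T → E) : Horizon T → E := fun t => ∫ s in Set.Iic t, f s ∂leb T

/-- The right end point of `[0,T]`. -/
def finalTime (hT : 0 < T) : Horizon T := ⟨T, hT.le, le_rfl⟩

/-- The left end point of `[0,T]`. -/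
def initialTime (hT : 0 < T) : Horizon T := ⟨0, le_rfl, hT.le⟩

lemma le_finalTime (hT : 0 < T) (t : Horizon T) : t ≤ finalTime hT := t.2.2

lemma initialTime_le (hT : 0 < T) (t : Horizon T) : initialTime hT ≤ t := t.2.1

lemma primitive_finalTime (hT : 0 < T) (f : Horizon T → E) :
    primitive f (finalTime hT) = ∫ s, f s ∂leb T := by
  have : Set.Iic (finalTime hT) = Set.univ := Set.eq_univ_of_forall (le_finalTime hT)
  rw [primitive, this, setIntegral_univ]

lemma setIntegral_Ioc_eq_primitive_sub {f : Horizon T → E} (hf : Integrable f (leb T))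
    {s t : Horizon T} (hst : s ≤ t) :
    ∫ u in Set.Ioc s t, f u ∂leb T = primitive f t - primitive f s := by
  rw [primitive, primitive, ← Set.Iic_union_Ioc_eq_Iic hst,
    setIntegral_union (Set.Iic_disjoint_Ioc le_rfl) measurableSet_Ioc hf.integrableOn
      hf.integrableOn, add_sub_cancel_left]

/-- The bridge to interval integrals, which supply continuity of primitives and the fundamental
theorem of calculus. -/
lemma primitive_comp_val (F : ℝ → E) (t : Horizon T) :
    primitive (fun s : Horizon T => F s) t = ∫ s in (0 : ℝ)..t, F s := by
  have h0 : (0 : ℝ) ≤ t := t.2.1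
  have hs : Set.Iic t = Subtype.val ⁻¹' (Set.Iic (t : ℝ)) := by ext; rfl
  rw [primitive, intervalIntegral.integral_of_le h0, hs,
    ← (MeasurableEmbedding.subtype_coe measurableSet_Icc).setIntegral_map, map_val_leb,
    Measure.restrict_restrict measurableSet_Iic, ← integral_Icc_eq_integral_Ioc]
  congr 2
  ext x
  simp only [Set.mem_inter_iff, Set.mem_Iic, Set.mem_Icc]
  have := t.2.2
  constructor
  · rintro ⟨h1, h2, h3⟩; exact ⟨h2, h1⟩
  · rintro ⟨h1, h2⟩; exact ⟨h2, h1, by linarith⟩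

lemma integrable_comp_projIcc (hT : 0 < T) {f : Horizon T → E} (hf : Integrable f (leb T)) :
    IntegrableOn (f ∘ Set.projIcc 0 T hT.le) (Set.Icc 0 T) := by
  rw [IntegrableOn, ← map_val_leb,
    (MeasurableEmbedding.subtype_coe measurableSet_Icc).integrable_map_iff]
  refine hf.congr (Eventually.of_forall fun x => ?_)
  simp [Set.projIcc_val]

lemma continuous_primitive (hT : 0 < T) {f : Horizon T → E} (hf : Integrable f (leb T)) :
    Continuous (primitive f) := by
  have h1 := integrable_comp_projIcc hT hf
  have h2 : primitive f = fun t : Horizon T =>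
      ∫ s in (0 : ℝ)..t, (f ∘ Set.projIcc 0 T hT.le) s := by
    ext t
    rw [← primitive_comp_val]
    simp only [Function.comp, Set.projIcc_val]
  rw [h2]
  have h3 := intervalIntegral.continuousOn_primitive_interval (a := 0) (b := T)
    (by rwa [Set.uIcc_of_le hT.le])
  rw [Set.uIcc_of_le hT.le] at h3
  exact continuousOn_iff_continuous_domRestrict.1 h3

lemma primitive_deriv {k k' : ℝ → ℝ} (hk : ∀ x, HasDerivAt k (k' x) x) (hk' : Continuous k')
    (t : Horizon T) : primitive (fun s : Horizon T => k' s) t = k t - k 0 := by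
  rw [primitive_comp_val]
  exact intervalIntegral.integral_eq_sub_of_hasDerivAt (fun x _ => hk x)
    (hk'.intervalIntegrable _ _)

lemma norm_primitive_le {f : Horizon T → E} {C : ℝ} (hC : ∀ s, ‖f s‖ ≤ C) (t : Horizon T) :
    ‖primitive f t‖ ≤ C * (leb T).real Set.univ := by
  have hC0 : 0 ≤ C := (norm_nonneg _).trans (hC t)
  refine (norm_setIntegral_le_of_norm_le_const (measure_lt_top _ _) (fun s _ => hC s)).trans ?_
  exact mul_le_mul_of_nonneg_left (measureReal_mono (Set.subset_univ _)) hC0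

/-- Fubini on the square: the two summands are the integrals of g(s)h(t) over the two triangles cut
off by the diagonal. This is integration by parts for merely integrable densities. -/
lemma integral_mul_primitive_add (g h : Horizon T → ℝ) (hg : Integrable g (leb T))
    (hh : Integrable h (leb T)) :
    (∫ s, (g s * primitive h s + primitive g s * h s) ∂leb T) =
      (∫ s, g s ∂leb T) * ∫ s, h s ∂leb T := by
  set μ := leb T
  have hgh : Integrable (fun p : Horizon T × Horizon T => g p.1 * h p.2) (μ.prod μ) :=
    hg.mul_prod hh
  have hm : MeasurableSet {p : Horizon T × Horizon T | p.2 ≤ p.1} :=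
    measurableSet_le measurable_snd measurable_fst
  have hm' : MeasurableSet {p : Horizon T × Horizon T | p.1 < p.2} :=
    measurableSet_lt measurable_fst measurable_snd
  have h1 : ∫ p in {p : Horizon T × Horizon T | p.2 ≤ p.1}, g p.1 * h p.2 ∂μ.prod μ =
      ∫ s, g s * primitive h s ∂μ := by
    rw [← integral_indicator hm, integral_prod _ (hgh.indicator hm)]
    refine integral_congr_ae (Eventually.of_forall fun s => ?_)
    simp only [primitive]
    rw [← integral_const_mul, ← integral_indicator measurableSet_Iic]
    rfl
  have h2 : ∫ p in {p : Horizon T × Horizon T | p.1 < p.2}, g p.1 * h p.2 ∂μ.prod μ =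
      ∫ s, primitive g s * h s ∂μ := by
    rw [← integral_indicator hm', integral_prod_symm _ (hgh.indicator hm')]
    refine integral_congr_ae (Eventually.of_forall fun s => ?_)
    simp only [primitive]
    -- Points are null, so the strict inequality is harmless; it makes the second triangle the exact
    -- complement of the first.
    rw [← integral_mul_const, setIntegral_congr_set Iio_ae_eq_Iic.symm,
      ← integral_indicator measurableSet_Iio]
    rfl
  have hi1 : Integrable (fun s => g s * primitive h s) μ := by
    have := (hgh.indicator hm).integral_prod_left
    refine this.congr (Eventually.of_forall fun s => ?_)
    simp only [primitive]
    rw [← integral_const_mul, ← integral_indicator measurableSet_Iic]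
    rfl
  have hi2 : Integrable (fun s => primitive g s * h s) μ := by
    have := (hgh.indicator hm').integral_prod_right
    refine this.congr (Eventually.of_forall fun s => ?_)
    simp only [primitive]
    rw [← integral_mul_const, setIntegral_congr_set Iio_ae_eq_Iic.symm,
      ← integral_indicator measurableSet_Iio]
    rfl
  rw [integral_add hi1 hi2, ← h1, ← h2, ← integral_prod_mul]
  have hc : {p : Horizon T × Horizon T | p.1 < p.2} = {p | p.2 ≤ p.1}ᶜ := by
    ext; simp
  rw [hc, integral_add_compl hm hgh]

lemma primitive_add {f g : Horizon T → E} (hf : Integrable f (leb T)) (hg : Integrable g (leb T))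
    (t : Horizon T) : primitive (fun s => f s + g s) t = primitive f t + primitive g t :=
  integral_add hf.integrableOn hg.integrableOn

lemma primitive_congr_ae {f g : Horizon T → E} (h : f =ᵐ[leb T] g) (t : Horizon T) :
    primitive f t = primitive g t :=
  integral_congr_ae (ae_restrict_of_ae h)

lemma primitive_indicator (f : Horizon T → E) {s t : Horizon T} (hst : s ≤ t) :
    primitive ((Set.Iic t).indicator f) s = primitive f s := by
  refine setIntegral_congr_fun measurableSet_Iic fun u hu => ?_
  exact Set.indicator_of_mem (Set.mem_Iic.2 (le_trans hu hst)) f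

/-- Integration by parts for primitives of integrable functions. -/
lemma primitive_mul_primitive {g h : Horizon T → ℝ} (hg : Integrable g (leb T))
    (hh : Integrable h (leb T)) (t : Horizon T) :
    primitive (fun s => g s * primitive h s + primitive g s * h s) t =
      primitive g t * primitive h t := by
  -- Cutting both densities off at `t` turns the identity for the whole interval into the one up to
  -- time `t`.
  have key := integral_mul_primitive_add ((Set.Iic t).indicator g) ((Set.Iic t).indicator h)
    (hg.indicator measurableSet_Iic) (hh.indicator measurableSet_Iic)
  rw [integral_indicator measurableSet_Iic, integral_indicator measurableSet_Iic] at key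
  unfold primitive at key ⊢
  rw [← key, ← integral_indicator measurableSet_Iic]
  refine integral_congr_ae (Eventually.of_forall fun s => ?_)
  by_cases hs : s ≤ t
  · have h1 := primitive_indicator g hs
    have h2 := primitive_indicator h hs
    unfold primitive at h1 h2
    simp only [h1, h2, Set.indicator_of_mem (Set.mem_Iic.2 hs)]
  · simp [Set.indicator_of_notMem (show s ∉ Set.Iic t from hs)]

lemma integrable_mul_of_continuous {g c : Horizon T → ℝ} (hg : Integrable g (leb T))
    (hc : Continuous c) : Integrable (fun s => g s * c s) (leb T) := by
  obtain ⟨C, hC⟩ := isCompact_univ.exists_bound_of_continuousOn hc.continuousOn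
  exact hg.mul_bdd (c := C) hc.measurable.aestronglyMeasurable
    (Eventually.of_forall fun s => hC s (Set.mem_univ s))

lemma integrable_of_continuous {c : Horizon T → E} (hc : Continuous c) : Integrable c (leb T) := by
  obtain ⟨C, hC⟩ := isCompact_univ.exists_bound_of_continuousOn hc.continuousOn
  exact Integrable.of_bound hc.aestronglyMeasurable C
    (Eventually.of_forall fun s => hC s (Set.mem_univ s))

/-- The product rule for a smooth weight and an absolutely continuous path. -/
lemma weight_mul_primitive (hT : 0 < T) {k k' : ℝ → ℝ} (hk : ∀ x, HasDerivAt k (k' x) x)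
    (hk' : Continuous k') (c : ℝ) {g : Horizon T → ℝ} (hg : Integrable g (leb T)) (t : Horizon T) :
    primitive (fun s => k' s * (c + primitive g s) + k s * g s) t =
      k t * (c + primitive g t) - k 0 * c := by
  have hkc : Continuous k := continuous_iff_continuousAt.2 fun x => (hk x).continuousAt
  have hgp := continuous_primitive hT hg
  have hk'i : Integrable (fun s : Horizon T => k' s) (leb T) :=
    integrable_of_continuous (hk'.comp continuous_subtype_val)
  -- Since `k` is `k 0` plus the primitive of `k'`, the product of two primitives splits off and the
  -- rest is linear in `g` and `k'`.
  have hfun : (fun s : Horizon T => k' s * (c + primitive g s) + k s * g s) = fun s : Horizon T =>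
      ((k' s * primitive g s + primitive (fun s : Horizon T => k' s) s * g s) + c * k' s) +
        k 0 * g s := by
    ext s
    rw [primitive_deriv hk hk' s]
    ring
  have i1 : Integrable (fun s : Horizon T => k' s * primitive g s) (leb T) :=
    integrable_mul_of_continuous hk'i hgp
  have i2 : Integrable (fun s : Horizon T => primitive (fun s : Horizon T => k' s) s * g s)
      (leb T) := by
    simp_rw [mul_comm _ (g _)]
    exact integrable_mul_of_continuous hg (continuous_primitive hT hk'i)
  have i3 : Integrable (fun s : Horizon T => k' s * primitive g s +
      primitive (fun s : Horizon T => k' s) s * g s) (leb T) := i1.add i2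
  have i4 : Integrable (fun s : Horizon T => k' s * primitive g s +
      primitive (fun s : Horizon T => k' s) s * g s + c * k' s) (leb T) :=
    i3.add (hk'i.const_mul c)
  rw [hfun, primitive_add i4 (hg.const_mul (k 0)),
    primitive_add i3 (hk'i.const_mul c), primitive_mul_primitive hk'i hg]
  have e1 : primitive (fun s : Horizon T => c * k' s) t =
      c * primitive (fun s : Horizon T => k' s) t := integral_const_mul _ _
  have e2 : primitive (fun s => k 0 * g s) t = k 0 * primitive g t := integral_const_mul _ _
  rw [e1, e2, primitive_deriv hk hk']
  ring

/-- The intervals `Set.Iic t` form a π-system generating the Borel sets, so all set integrals of `f`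
vanish. -/
lemma ae_eq_zero_of_primitive_eq_zero [CompleteSpace E] (hT : 0 < T) {f : Horizon T → E}
    (hf : Integrable f (leb T)) (h : ∀ t, primitive f t = 0) : f =ᵐ[leb T] 0 := by
  have key : ∀ s, MeasurableSet s → ∫ x in s, f x ∂leb T = 0 := by
    have huniv : ∫ x, f x ∂leb T = 0 := by rw [← primitive_finalTime hT, h]
    refine MeasurableSpace.induction_on_inter (s := Set.range Set.Iic)
      (borel_eq_generateFrom_Iic (Horizon T) ▸ BorelSpace.measurable_eq) isPiSystem_Iic
      (by simp) ?_ ?_ ?_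
    · rintro _ ⟨t, rfl⟩
      exact h t
    · intro t ht hts
      have := integral_add_compl ht hf
      rw [hts, zero_add, huniv] at this
      exact this
    · intro F hd hm hF
      rw [integral_iUnion hm hd hf.integrableOn]
      simp [hF]
  exact hf.ae_eq_zero_of_forall_setIntegral_eq_zero fun s hs _ => key s hs

end Time

end PriceImpact

end

/-! ### Optional processes: progressive measurability, and measurability of primitives. -/

noncomputable section

namespace PriceImpact

section Optional

variable {Ω : Type*} {mΩ : MeasurableSpace Ω} {T : ℝ} {d : ℕ} {F : Filtration (Horizon T) mΩ}

/-- The right end point of the grid interval of mesh `1 / (n + 1)` with number `k`, capped at `t`. -/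
def gridPoint (t : Horizon T) (n k : ℕ) : Horizon T :=
  ⟨min t (((k : ℝ) + 1) / (n + 1)), le_min t.2.1 (by positivity), (min_le_left _ _).trans t.2.2⟩

/-- The index picks the right end of the cell that contains `s`, so right-continuity recovers the
value at `s`. The cap at `t` prevents the approximation from looking beyond time `t`. -/
lemma tendsto_gridPoint {s t : Horizon T} (hst : s ≤ t) :
    Tendsto (fun n : ℕ => gridPoint t n ⌊((n : ℝ) + 1) * s⌋₊) atTop (𝓝[≥] s) := by
  have hs0 : (0 : ℝ) ≤ s := s.2.1
  have hle : ∀ n : ℕ, (s : ℝ) ≤ (gridPoint t n ⌊((n : ℝ) + 1) * s⌋₊ : ℝ) := by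
    intro n
    refine le_min hst ?_
    rw [le_div_iff₀ (by positivity), mul_comm]
    exact (Nat.lt_floor_add_one _).le
  have hge : ∀ n : ℕ, (gridPoint t n ⌊((n : ℝ) + 1) * s⌋₊ : ℝ) ≤ s + 1 / ((n : ℝ) + 1) := by
    intro n
    refine (min_le_right _ _).trans ?_
    rw [div_le_iff₀ (by positivity)]
    have h1 : ((s : ℝ) + 1 / ((n : ℝ) + 1)) * (n + 1) = (n + 1) * s + 1 := by
      field_simp
    rw [h1]
    have := Nat.floor_le (show 0 ≤ ((n : ℝ) + 1) * s by positivity)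
    linarith
  refine tendsto_nhdsWithin_iff.2 ⟨?_, Eventually.of_forall fun n => hle n⟩
  rw [tendsto_subtype_rng]
  refine tendsto_of_tendsto_of_tendsto_of_le_of_le tendsto_const_nhds ?_ hle hge
  simpa using tendsto_const_nhds.add (tendsto_one_div_add_atTop_nhds_zero_nat (𝕜 := ℝ))

/-- In this and the next two lemmas the σ-algebra on `Ω` is a parameter, so that they apply with `F
t` in place of the ambient one. -/
lemma measurable_of_nat_prod {β : Type*} [MeasurableSpace β] {m : MeasurableSpace Ω}
    {Y : ℕ → Ω → β} (h : ∀ k, Measurable (Y k)) : Measurable fun q : ℕ × Ω => Y q.1 q.2 :=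
  measurable_from_prod_countable_right h

lemma measurable_integral_prod_left {α E : Type*} [NormedAddCommGroup E] [NormedSpace ℝ E]
    [MeasurableSpace E] [BorelSpace E] [SecondCountableTopology E] [MeasurableSpace α]
    {m : MeasurableSpace Ω} (μ : Measure α) [SFinite μ] {f : α × Ω → E} (hf : Measurable f) :
    Measurable fun y => ∫ x, f (x, y) ∂μ :=
  (hf.stronglyMeasurable.integral_prod_left').measurable

lemma measurable_pair_left {α : Type*} [MeasurableSpace α] {m : MeasurableSpace Ω} (x : α) :
    Measurable fun ω : Ω => (x, ω) :=
  measurable_prodMk_left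

/-- Càdlàg adapted processes are progressive. -/
lemma IsCadlagAdapted.isProgressive {Y : Horizon T → Ω → ℝ} (hY : IsCadlagAdapted F Y) :
    IsProgressive F Y := by
  intro t
  let mt : MeasurableSpace Ω := F t
  have hmeas : ∀ n : ℕ, Measurable[Subtype.instMeasurableSpace.prod (F t)]
      fun p : Set.Iic t × Ω => Y (gridPoint t n ⌊((n : ℝ) + 1) * (p.1 : Horizon T)⌋₊) p.2 := by
    intro n
    have h1 : Measurable[Prod.instMeasurableSpace (m₂ := F t)]
        fun q : ℕ × Ω => Y (gridPoint t n q.1) q.2 := by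
      refine measurable_of_nat_prod (m := F t) (Y := fun k => Y (gridPoint t n k)) fun k => ?_
      exact (hY.1 _).mono (F.mono (Subtype.coe_le_coe.1 (min_le_left _ _))) le_rfl
    have h2 : Measurable[Subtype.instMeasurableSpace.prod (F t),
        Prod.instMeasurableSpace (m₂ := F t)]
        fun p : Set.Iic t × Ω => (⌊((n : ℝ) + 1) * ((p.1 : Horizon T) : ℝ)⌋₊, p.2) := by
      refine Measurable.prodMk ?_ measurable_snd
      refine Nat.measurable_floor.comp (measurable_const.mul ?_)
      exact measurable_subtype_coe.comp (measurable_subtype_coe.comp measurable_fst)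
    exact h1.comp h2
  refine @measurable_of_tendsto_metrizable _ _ (Subtype.instMeasurableSpace.prod (F t)) _ _ _ _
    _ _ hmeas ?_
  rw [tendsto_pi_nhds]
  intro p
  exact ((hY.2 p.2 p.1).1.tendsto).comp (tendsto_gridPoint p.1.2)

/-- The generators of the optional σ-algebra are càdlàg adapted, hence progressive, so every
optional set is progressive. Measurability of sections and of primitives at time `t` follows by
composition with this map. -/
lemma measurable_restrict_optional (t : Horizon T) :
    @Measurable _ _ (Subtype.instMeasurableSpace.prod (F t)) (optionalSigma F)
      (fun p : Set.Iic t × Ω => ((p.1 : Horizon T), p.2)) := by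
  refine @measurable_generateFrom _ _ (Subtype.instMeasurableSpace.prod (F t)) _ _ ?_
  rintro _ ⟨Y, hY, B, hB, rfl⟩
  exact hY.isProgressive t hB

lemma optionalSigma_le (hT : 0 < T) :
    optionalSigma F ≤ (inferInstance : MeasurableSpace (Horizon T × Ω)) := by
  have h1 := measurable_restrict_optional (F := F) (finalTime hT)
  have h2 : Measurable[inferInstance, Subtype.instMeasurableSpace.prod (F (finalTime hT))]
      (fun p : Horizon T × Ω =>
        ((⟨p.1, le_finalTime hT p.1⟩ : Set.Iic (finalTime hT)), p.2)) := by
    refine Measurable.prodMk (measurable_fst.subtype_mk) ?_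
    exact measurable_snd.mono le_rfl (F.le _)
  have h3 : Measurable[inferInstance, optionalSigma F] (id : Horizon T × Ω → Horizon T × Ω) :=
    h1.comp h2
  simpa using h3.le_map

lemma IsOptional.measurable (hT : 0 < T) {X : Proc T Ω d} (hX : IsOptional F X) :
    Measurable fun p : Horizon T × Ω => X p.1 p.2 :=
  hX.mono (optionalSigma_le hT) le_rfl

lemma measurable_section_of_optional {β : Type*} [MeasurableSpace β] {f : Horizon T × Ω → β}
    (hf : Measurable[optionalSigma F] f) (t : Horizon T) :
    Measurable[F t] fun ω => f (t, ω) := by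
  have h1 := hf.comp (measurable_restrict_optional (F := F) t)
  have h2 : Measurable[F t, Subtype.instMeasurableSpace.prod (F t)]
      fun ω : Ω => ((⟨t, Set.mem_Iic.2 le_rfl⟩ : Set.Iic t), ω) :=
    measurable_pair_left (m := F t) (⟨t, Set.mem_Iic.2 le_rfl⟩ : Set.Iic t)
  exact h1.comp h2

/-- Fubini on `[0,t] × Ω` with `F t` on the second factor; it needs joint, progressive measurability
and not only adaptedness. -/
lemma measurable_primitive_of_optional {E : Type*} [NormedAddCommGroup E] [NormedSpace ℝ E]
    [MeasurableSpace E] [BorelSpace E] [SecondCountableTopology E]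
    {f : Horizon T × Ω → E} (hf : Measurable[optionalSigma F] f) (t : Horizon T) :
    Measurable[F t] fun ω => primitive (fun s => f (s, ω)) t := by
  have h1 := hf.comp (measurable_restrict_optional (F := F) t)
  have h3 := measurable_integral_prod_left (m := F t) (Measure.comap Subtype.val (leb T)) h1
  have h4 : (fun ω => primitive (fun s => f (s, ω)) t) = fun ω => ∫ s : Set.Iic t,
      (f ∘ fun p : Set.Iic t × Ω => ((p.1 : Horizon T), p.2)) (s, ω)
        ∂Measure.comap Subtype.val (leb T) := by
    ext ω
    exact (integral_subtype_comap measurableSet_Iic fun s => f (s, ω)).symm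
  rw [h4]
  exact h3

lemma optional_of_continuous {Y : Horizon T → Ω → ℝ} (hY : Adapted F Y)
    (hc : ∀ ω, Continuous fun t => Y t ω) :
    Measurable[optionalSigma F] fun p : Horizon T × Ω => Y p.1 p.2 := by
  intro B hB
  exact MeasurableSpace.measurableSet_generateFrom ⟨Y, ⟨hY, fun ω t =>
    ⟨(hc ω).continuousWithinAt, Y t ω, (hc ω).continuousWithinAt⟩⟩, B, hB, rfl⟩

lemma measurable_time_optional :
    Measurable[optionalSigma F] fun p : Horizon T × Ω => p.1 := by
  have h : Measurable[optionalSigma F] fun p : Horizon T × Ω => (p.1 : ℝ) :=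
    optional_of_continuous (Y := fun t _ => (t : ℝ)) (fun _ => measurable_const)
      (fun _ => continuous_subtype_val)
  exact h.subtype_mk

lemma measurable_toVec {α : Type*} [MeasurableSpace α] {f : α → Vec d}
    (h : ∀ i, Measurable fun x => f x i) : Measurable f := by
  have : f = fun x => WithLp.toLp 2 (fun i => f x i) := rfl
  rw [this]
  exact (PiLp.continuous_toLp 2 _).measurable.comp (measurable_pi_lambda _ h)

lemma measurable_coord (i : Fin d) : Measurable fun x : Vec d => x i :=
  (EuclideanSpace.proj (𝕜 := ℝ) i).continuous.measurable

lemma isOptional_of_continuous {X : Proc T Ω d} (hX : ∀ t, Measurable[F t] (X t))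
    (hc : ∀ ω, Continuous fun t => X t ω) : IsOptional F X := by
  refine @measurable_toVec _ _ (optionalSigma F) _ fun i => ?_
  exact optional_of_continuous (Y := fun t ω => X t ω i)
    (fun t => (measurable_coord i).comp (hX t))
    (fun ω => (EuclideanSpace.proj (𝕜 := ℝ) i).continuous.comp (hc ω))

lemma isOptional_cumulative (hT : 0 < T) {X : Proc T Ω d} (hX : IsOptional F X)
    (hi : ∀ ω, Integrable (fun t => X t ω) (leb T)) : IsOptional F (cumulative X) :=
  isOptional_of_continuous (fun t => measurable_primitive_of_optional hX t)
    (fun ω => continuous_primitive hT (hi ω))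

lemma measurable_act (A : Matrix (Fin d) (Fin d) ℝ) : Measurable (act A) :=
  (LinearMap.continuous_of_finiteDimensional (Matrix.toEuclideanLin A)).measurable

lemma IsOptional.act {X : Proc T Ω d} (hX : IsOptional F X) (A : Matrix (Fin d) (Fin d) ℝ) :
    IsOptional F fun t ω => PriceImpact.act A (X t ω) :=
  (measurable_act A).comp hX

lemma IsOptional.add {X Y : Proc T Ω d} (hX : IsOptional F X) (hY : IsOptional F Y) :
    IsOptional F fun t ω => X t ω + Y t ω :=
  Measurable.add hX hY

lemma IsOptional.sub {X Y : Proc T Ω d} (hX : IsOptional F X) (hY : IsOptional F Y) :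
    IsOptional F fun t ω => X t ω - Y t ω :=
  Measurable.sub hX hY

lemma IsOptional.weight {X : Proc T Ω d} (hX : IsOptional F X) {w : Horizon T → ℝ}
    (hw : Measurable w) : IsOptional F fun t ω => w t • X t ω :=
  Measurable.smul (hw.comp measurable_time_optional) hX

lemma IsOptional.const_smul {X : Proc T Ω d} (hX : IsOptional F X) (c : ℝ) :
    IsOptional F fun t ω => c • X t ω :=
  hX.weight measurable_const

end Optional

end PriceImpact

end

/-! ### Continuous versions of martingales: the maximal inequality and stability under limits. -/

noncomputable section

namespace PriceImpact

section ContinuousVersion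

set_option linter.unusedSectionVars false

variable {Ω : Type*} {mΩ : MeasurableSpace Ω} {T : ℝ} {F : Filtration (Horizon T) mΩ}
  {P : Measure Ω} [IsProbabilityMeasure P]

/-- `M` is a continuous version of the martingale `E[ξ | F t]`. -/
structure IsContinuousVersion (P : Measure Ω) (F : Filtration (Horizon T) mΩ)
    (M : Horizon T → Ω → ℝ) (ξ : Ω → ℝ) : Prop where
  adapted : Adapted F M
  continuous_paths : ∀ ω, Continuous fun t => M t ω
  ae_eq : ∀ t, M t =ᵐ[P] P[ξ | F t]

/-- The martingale `E[ξ | F t]` has a continuous version. -/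
def HasContinuousVersion (P : Measure Ω) (F : Filtration (Horizon T) mΩ) (ξ : Ω → ℝ) : Prop :=
  ∃ M, IsContinuousVersion P F M ξ

namespace IsContinuousVersion

variable {M N : Horizon T → Ω → ℝ} {ξ η : Ω → ℝ}

lemma congr (h : IsContinuousVersion P F M ξ) (hξ : ξ =ᵐ[P] η) : IsContinuousVersion P F M η :=
  ⟨h.adapted, h.continuous_paths, fun t => (h.ae_eq t).trans (condExp_congr_ae hξ)⟩

lemma add (hM : IsContinuousVersion P F M ξ) (hN : IsContinuousVersion P F N η)
    (hξ : Integrable ξ P) (hη : Integrable η P) :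
    IsContinuousVersion P F (fun t ω => M t ω + N t ω) (fun ω => ξ ω + η ω) := by
  refine ⟨fun t => (hM.adapted t).add (hN.adapted t),
    fun ω => (hM.continuous_paths ω).add (hN.continuous_paths ω), fun t => ?_⟩
  filter_upwards [hM.ae_eq t, hN.ae_eq t, condExp_add hξ hη (F t)] with ω h1 h2 h3
  rw [h1, h2]
  exact h3.symm

lemma const_mul (hM : IsContinuousVersion P F M ξ) (c : ℝ) :
    IsContinuousVersion P F (fun t ω => c * M t ω) (fun ω => c * ξ ω) := by
  refine ⟨fun t => (hM.adapted t).const_mul c,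
    fun ω => continuous_const.mul (hM.continuous_paths ω), fun t => ?_⟩
  filter_upwards [hM.ae_eq t, condExp_smul (μ := P) c ξ (F t)] with ω h1 h3
  rw [h1]
  exact h3.symm

lemma sub (hM : IsContinuousVersion P F M ξ) (hN : IsContinuousVersion P F N η)
    (hξ : Integrable ξ P) (hη : Integrable η P) :
    IsContinuousVersion P F (fun t ω => M t ω - N t ω) (fun ω => ξ ω - η ω) := by
  have := hM.add (hN.const_mul (-1)) hξ (hη.const_mul (-1))
  simpa [neg_one_mul, sub_eq_add_neg] using this

lemma integrable (h : IsContinuousVersion P F M ξ) (t : Horizon T) : Integrable (M t) P :=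
  integrable_condExp.congr (h.ae_eq t).symm

lemma condExp_eq (h : IsContinuousVersion P F M ξ) {s t : Horizon T} (hst : s ≤ t) :
    P[M t | F s] =ᵐ[P] M s :=
  (condExp_congr_ae (h.ae_eq t)).trans
    ((condExp_condExp_of_le (F.mono hst) (F.le t)).trans (h.ae_eq s).symm)

/-- Restriction of the filtration to a sequence of times. -/
def sampledFiltration (F : Filtration (Horizon T) mΩ) {τ : ℕ → Horizon T} (hτ : Monotone τ) :
    Filtration ℕ mΩ where
  seq n := F (τ n)
  mono' _ _ h := F.mono (hτ h)
  le' n := F.le (τ n)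

/-- Sampling gives a discrete martingale, whose absolute value `M ⊔ -M` is a nonnegative
submartingale, so the discrete maximal inequality applies. Conditional expectation contracts L¹,
hence the bound by `ξ` itself, uniform in the grid. -/
lemma maximal_sampled (h : IsContinuousVersion P F M ξ)
    {τ : ℕ → Horizon T} (hτ : Monotone τ) {ε : ℝ} (hε : 0 < ε) (n : ℕ) :
    P {ω | ∃ k ≤ n, ε ≤ |M (τ k) ω|} ≤ eLpNorm ξ 1 P / ENNReal.ofReal ε := by
  have hmart : Martingale (fun k => M (τ k)) (sampledFiltration F hτ) P :=
    ⟨fun k => (h.adapted (τ k)).stronglyMeasurable, fun i j hij => h.condExp_eq (hτ hij)⟩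
  have hsub : Submartingale (fun k => M (τ k)) (sampledFiltration F hτ) P := hmart.submartingale
  have hsub' : Submartingale (-fun k => M (τ k)) (sampledFiltration F hτ) P :=
    hmart.neg.submartingale
  have hs := hsub.sup hsub'
  have hnonneg : 0 ≤ (fun k => M (τ k)) ⊔ (-fun k => M (τ k)) := by
    intro k ω
    exact abs_nonneg (M (τ k) ω)
  have key := maximal_ineq hs hnonneg (ε := ε.toNNReal) n
  have hset : {ω | ∃ k ≤ n, ε ≤ |M (τ k) ω|} = {ω | ((ε.toNNReal : NNReal) : ℝ) ≤
      (Finset.range (n + 1)).sup' Finset.nonempty_range_add_one fun k =>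
        ((fun k => M (τ k)) ⊔ (-fun k => M (τ k))) k ω} := by
    ext ω
    simp only [Set.mem_ofPred_eq, Real.coe_toNNReal _ hε.le, Finset.le_sup'_iff, Finset.mem_range,
      Nat.lt_succ_iff]
    rfl
  rw [ENNReal.le_div_iff_mul_le (Or.inl (by simpa using hε)) (Or.inl ENNReal.ofReal_ne_top),
    mul_comm, hset]
  refine key.trans ?_
  have habs : Integrable (fun ω => |M (τ n) ω|) P := (h.integrable (τ n)).abs
  calc _ ≤ ENNReal.ofReal (∫ ω, |M (τ n) ω| ∂P) :=
        ENNReal.ofReal_le_ofReal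
          (setIntegral_le_integral habs (Eventually.of_forall fun ω => abs_nonneg _))
    _ = eLpNorm (M (τ n)) 1 P := by
        rw [eLpNorm_one_eq_lintegral_enorm,
          ofReal_integral_eq_lintegral_ofReal habs (Eventually.of_forall fun ω => abs_nonneg _)]
        simp only [Real.enorm_eq_ofReal_abs]
    _ = eLpNorm (P[ξ | F (τ n)]) 1 P := eLpNorm_congr_ae (h.ae_eq _)
    _ ≤ eLpNorm ξ 1 P := eLpNorm_condExp_le_eLpNorm ξ le_rfl

/-- Doob's maximal inequality on `[0,T]`. -/
lemma maximal (hT : 0 < T) (h : IsContinuousVersion P F M ξ) {ε : ℝ}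
    (hε : 0 < ε) : P {ω | ∃ t, ε < |M t ω|} ≤ eLpNorm ξ 1 P / ENNReal.ofReal ε := by
  have hτ : ∀ n, Monotone (gridPoint (finalTime hT) n) := by
    intro n i j hij
    refine Subtype.coe_le_coe.1 (min_le_min_left _ ?_)
    have : (i : ℝ) ≤ j := Nat.cast_le.2 hij
    gcongr
  let A : ℕ → Set Ω := fun n => {ω | ∃ k ≤ ⌊((n : ℝ) + 1) * T⌋₊,
    ε ≤ |M (gridPoint (finalTime hT) n k) ω|}
  have hA : ∀ n, P (A n) ≤ eLpNorm ξ 1 P / ENNReal.ofReal ε := fun n =>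
    h.maximal_sampled (hτ n) hε _
  -- The grids are not nested, so the events `A n` need not increase; their tail intersections do.
  -- By continuity a value strictly above `ε` at `t` forces values above `ε` at the grid points near
  -- `t` on all fine grids.
  let B : ℕ → Set Ω := fun N => ⋂ n ≥ N, A n
  have hBmono : Monotone B := fun i j hij ω hω => by
    simp only [B, Set.mem_iInter] at hω ⊢
    exact fun n hn => hω n (le_trans hij hn)
  have hsub : {ω | ∃ t, ε < |M t ω|} ⊆ ⋃ N, B N := by
    rintro ω ⟨t, ht⟩
    have hc : Tendsto (fun n : ℕ =>
        |M (gridPoint (finalTime hT) n ⌊((n : ℝ) + 1) * t⌋₊) ω|) atTop (𝓝 |M t ω|) :=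
      ((h.continuous_paths ω).abs.tendsto t).comp
        ((tendsto_gridPoint (le_finalTime hT t)).mono_right nhdsWithin_le_nhds)
    obtain ⟨N, hN⟩ := eventually_atTop.1 (hc.eventually (lt_mem_nhds ht))
    refine Set.mem_iUnion.2 ⟨N, Set.mem_iInter₂.2 fun n hn => ⟨_, ?_, (hN n hn).le⟩⟩
    have := t.2.2
    exact Nat.floor_le_floor (by gcongr)
  refine (measure_mono hsub).trans ?_
  rw [hBmono.measure_iUnion]
  exact iSup_le fun N => (measure_mono (Set.iInter₂_subset N le_rfl)).trans (hA N)

end IsContinuousVersion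

/-- All null events belong to every `F t`. -/
def ContainsNull (P : Measure Ω) (F : Filtration (Horizon T) mΩ) : Prop :=
  ∀ s, MeasurableSet s → P s = 0 → ∀ t, MeasurableSet[F t] s

lemma exists_null_superset {p : Ω → Prop} (h : ∀ᵐ ω ∂P, p ω) :
    ∃ S, MeasurableSet S ∧ P S = 0 ∧ ∀ ω, ω ∉ S → p ω := by
  refine ⟨toMeasurable P {ω | ¬ p ω}, measurableSet_toMeasurable _ _, ?_, fun ω hω => ?_⟩
  · rw [measure_toMeasurable]
    exact h
  · by_contra hp
    exact hω (subset_toMeasurable _ _ hp)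

/-- With L¹ errors of order 4⁻ⁿ, the maximal inequality at level 2⁻ⁿ gives exceptional events of
probability at most 2·2⁻ⁿ. By Borel-Cantelli the continuous versions are almost surely Cauchy
uniformly on `[0,T]`. -/
lemma hasContinuousVersion_of_rate (hT : 0 < T) (hF : ContainsNull P F) {ξ : Ω → ℝ}
    {ξs : ℕ → Ω → ℝ} (hξ : Integrable ξ P) (hξs : ∀ n, Integrable (ξs n) P)
    (hv : ∀ n, HasContinuousVersion P F (ξs n))
    (hrate : ∀ n, eLpNorm (fun ω => ξs n ω - ξ ω) 1 P ≤ ENNReal.ofReal ((1 / 4) ^ n)) :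
    HasContinuousVersion P F ξ := by
  choose M hM using hv
  have hdiff : ∀ n, eLpNorm (fun ω => ξs (n + 1) ω - ξs n ω) 1 P ≤
      ENNReal.ofReal (2 * (1 / 4) ^ n) := by
    intro n
    have e : (fun ω => ξs (n + 1) ω - ξs n ω) =
        (fun ω => ξs (n + 1) ω - ξ ω) - (fun ω => ξs n ω - ξ ω) := by
      ext ω; simp
    rw [e]
    refine (eLpNorm_sub_le ((hξs _).sub hξ).1 ((hξs _).sub hξ).1 le_rfl).trans ?_
    refine (add_le_add (hrate _) (hrate _)).trans ?_
    rw [← ENNReal.ofReal_add (by positivity) (by positivity)]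
    refine ENNReal.ofReal_le_ofReal ?_
    rw [pow_succ]
    have : (0 : ℝ) ≤ (1 / 4) ^ n := by positivity
    linarith
  have hbound : ∀ n, P {ω | ∃ t, (1 / 2 : ℝ) ^ n < |M (n + 1) t ω - M n t ω|} ≤
      ENNReal.ofReal (2 * (1 / 2) ^ n) := by
    intro n
    refine (((hM (n + 1)).sub (hM n) (hξs _) (hξs _)).maximal hT
      (by positivity : (0 : ℝ) < (1 / 2) ^ n)).trans ?_
    refine (ENNReal.div_le_div_right (hdiff n) _).trans ?_
    rw [← ENNReal.ofReal_div_of_pos (by positivity)]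
    refine ENNReal.ofReal_le_ofReal (le_of_eq ?_)
    rw [mul_div_assoc, ← div_pow]
    norm_num
  have hBC : ∀ᵐ ω ∂P, ∀ᶠ n in atTop,
      ω ∉ {ω | ∃ t, (1 / 2 : ℝ) ^ n < |M (n + 1) t ω - M n t ω|} := by
    refine ae_eventually_notMem ?_
    refine ne_top_of_le_ne_top ?_ (ENNReal.tsum_le_tsum hbound)
    have hs : Summable fun n : ℕ => (2 : ℝ) * (1 / 2) ^ n :=
      (summable_geometric_of_lt_one (by norm_num) (by norm_num)).mul_left 2
    rw [← ENNReal.ofReal_tsum_of_nonneg (fun n => by positivity) hs]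
    exact ENNReal.ofReal_ne_top
  have hlim : ∀ᵐ ω ∂P, ∃ f : C(Horizon T, ℝ), ∀ t, Tendsto (fun n => M n t ω) atTop (𝓝 (f t)) := by
    filter_upwards [hBC] with ω hω
    let m : ℕ → C(Horizon T, ℝ) := fun n => ⟨fun t => M n t ω, (hM n).continuous_paths ω⟩
    have hd : ∀ᶠ n in atTop, dist (m n) (m (n + 1)) ≤ (1 / 2 : ℝ) ^ n := by
      filter_upwards [hω] with n hn
      refine (ContinuousMap.dist_le (by positivity)).2 fun t => ?_
      simp only [not_exists, not_lt] at hn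
      rw [dist_comm]
      exact hn t
    have hsum : Summable fun n => dist (m n) (m (n + 1)) := by
      refine Summable.of_norm_bounded_eventually_nat
        (summable_geometric_of_lt_one (r := (1 / 2 : ℝ)) (by norm_num) (by norm_num)) ?_
      filter_upwards [hd] with n hn
      rwa [Real.norm_of_nonneg dist_nonneg]
    obtain ⟨f, hf⟩ := cauchySeq_tendsto_of_complete (cauchySeq_of_summable_dist hsum)
    exact ⟨f, fun t => ((ContinuousEvalConst.continuous_eval_const t).tendsto f).comp hf⟩
  obtain ⟨S, hSm, hS0, hS⟩ := exists_null_superset hlim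
  classical
  choose! f hf using hS
  -- Resetting the paths on the null event `S` preserves adaptedness because each `F t` contains all
  -- null events.
  refine ⟨fun t ω => if ω ∈ S then 0 else f ω t, ?_, ?_, ?_⟩
  · intro t
    have hmeas : ∀ n, Measurable[F t] fun ω => if ω ∈ S then 0 else M n t ω := fun n =>
      Measurable.ite (hF S hSm hS0 t) measurable_const ((hM n).adapted t)
    refine @measurable_of_tendsto_metrizable _ _ (F t) _ _ _ _ _ _ hmeas ?_
    rw [tendsto_pi_nhds]
    intro ω
    by_cases hω : ω ∈ S
    · simp [hω]
    · simpa [hω] using hf ω hω t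
  · intro ω
    by_cases hω : ω ∈ S
    · simpa [hω] using continuous_const
    · simpa [hω] using (f ω).continuous
  · intro t
    have hSae : ∀ᵐ ω ∂P, ω ∉ S := measure_eq_zero_iff_ae_notMem.1 hS0
    -- At fixed `t` the sequence tends in measure both to the new path value and to the conditional
    -- expectation of `ξ`, so the two limits agree.
    have h1 : TendstoInMeasure P (fun n => M n t) atTop
        (fun ω => if ω ∈ S then 0 else f ω t) := by
      refine tendstoInMeasure_of_tendsto_ae (fun n => ((hM n).integrable t).1) ?_
      filter_upwards [hSae] with ω hω
      simpa [hω] using hf ω hω t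
    have h2 : TendstoInMeasure P (fun n => M n t) atTop (P[ξ | F t]) := by
      refine tendstoInMeasure_of_tendsto_eLpNorm one_ne_zero (fun n => ((hM n).integrable t).1)
        integrable_condExp.1 ?_
      have hle : ∀ n, eLpNorm (M n t - P[ξ | F t]) 1 P ≤ ENNReal.ofReal ((1 / 4) ^ n) := by
        intro n
        have e : M n t - P[ξ | F t] =ᵐ[P] P[fun ω => ξs n ω - ξ ω | F t] := by
          filter_upwards [(hM n).ae_eq t, condExp_sub (hξs n) hξ (F t)] with ω a b
          rw [Pi.sub_apply, a]
          exact b.symm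
        rw [eLpNorm_congr_ae e]
        exact (eLpNorm_condExp_le_eLpNorm _ le_rfl).trans (hrate n)
      refine tendsto_of_tendsto_of_tendsto_of_le_of_le tendsto_const_nhds ?_
        (fun _ => zero_le) hle
      rw [← ENNReal.ofReal_zero]
      exact ENNReal.tendsto_ofReal
        (tendsto_pow_atTop_nhds_zero_of_lt_one (by norm_num) (by norm_num))
    exact tendstoInMeasure_ae_unique h1 h2

/-- Existence of continuous versions is stable under bounded pointwise limits. -/
lemma hasContinuousVersion_of_tendsto (hT : 0 < T) (hF : ContainsNull P F) {ξ : Ω → ℝ}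
    {ξs : ℕ → Ω → ℝ} (hξs : ∀ n, AEStronglyMeasurable (ξs n) P) {C : ℝ}
    (hC : ∀ n, ∀ᵐ ω ∂P, ‖ξs n ω‖ ≤ C) (hlim : ∀ᵐ ω ∂P, Tendsto (fun n => ξs n ω) atTop (𝓝 (ξ ω)))
    (hv : ∀ n, HasContinuousVersion P F (ξs n)) : HasContinuousVersion P F ξ := by
  have hL := tendsto_lintegral_norm_of_dominated_convergence hξs
    (integrable_const (μ := P) C).hasFiniteIntegral hC hlim
  have hξm : AEStronglyMeasurable ξ P := aestronglyMeasurable_of_tendsto_ae atTop hξs hlim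
  have hξC : ∀ᵐ ω ∂P, ‖ξ ω‖ ≤ C := by
    filter_upwards [hlim, ae_all_iff.2 hC] with ω h1 h2
    exact le_of_tendsto h1.norm (Eventually.of_forall h2)
  -- Dominated convergence gives L¹ convergence. A selection with the required rate suffices; the
  -- selected indices need not increase.
  have hsel : ∀ k : ℕ, ∃ n, eLpNorm (fun ω => ξs n ω - ξ ω) 1 P ≤
      ENNReal.ofReal ((1 / 4) ^ k) := by
    intro k
    have hpos : (0 : ENNReal) < ENNReal.ofReal ((1 / 4) ^ k) := by positivity
    obtain ⟨n, hn⟩ := (hL.eventually (gt_mem_nhds hpos)).exists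
    refine ⟨n, ?_⟩
    rw [eLpNorm_one_eq_lintegral_enorm]
    simpa only [ofReal_norm] using hn.le
  choose φ hφ using hsel
  exact hasContinuousVersion_of_rate hT hF (Integrable.of_bound hξm C hξC)
    (fun n => Integrable.of_bound (hξs _) C (hC _)) (fun n => hv (φ n)) hφ

end ContinuousVersion

end PriceImpact

end

/-! ### The augmented Brownian filtration and its Markov property. -/

noncomputable section

namespace PriceImpact

section Brownian

set_option linter.unusedSectionVars false

variable {Ω : Type*} {mΩ : MeasurableSpace Ω} {T : ℝ} {d : ℕ} {P : Measure Ω}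
  [IsProbabilityMeasure P] {W : Proc T Ω d}

lemma containsNull_augmentedFiltration (hW : ∀ t, Measurable (W t)) :
    ContainsNull P (augmentedFiltration P W hW) := by
  intro s hs h0 t
  exact (le_sup_right : _ ≤ pastSigma W t ⊔
    MeasurableSpace.generateFrom {S : Set Ω | MeasurableSet S ∧ P S = 0}) s
    (MeasurableSpace.measurableSet_generateFrom ⟨hs, h0⟩)

lemma pastSigma_le_augmentedFiltration (hW : ∀ t, Measurable (W t)) (t : Horizon T) :
    pastSigma W t ≤ augmentedFiltration P W hW t :=
  (le_sup_left : pastSigma W t ≤ pastSigma W t ⊔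
    MeasurableSpace.generateFrom {S : Set Ω | MeasurableSet S ∧ P S = 0})

lemma measurable_past (t : Horizon T) : Measurable[pastSigma W t] (W t) := fun B hB =>
  MeasurableSpace.measurableSet_generateFrom ⟨t, le_rfl, B, hB, rfl⟩

lemma pastSigma_le (hW : ∀ t, Measurable (W t)) (t : Horizon T) : pastSigma W t ≤ mΩ := by
  refine MeasurableSpace.generateFrom_le ?_
  rintro S ⟨u, -, B, hB, rfl⟩
  exact hW u hB

lemma adapted_augmentedFiltration (hW : ∀ t, Measurable (W t)) (t : Horizon T) :
    Measurable[augmentedFiltration P W hW t] (W t) :=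
  (measurable_past t).mono (pastSigma_le_augmentedFiltration hW t) le_rfl

/-- To replace augmented events by events of a smaller σ-algebra up to null sets, it suffices to
treat the generators `W u ⁻¹' B`. It is used with the past of `W` and with the closed cylinders of a
regular version. -/
lemma augmentedFiltration_le_eventually (hW : ∀ t, Measurable (W t)) (t : Horizon T)
    {m : MeasurableSpace Ω}
    (hm : ∀ u ≤ t, ∀ B, MeasurableSet B →
      ∃ A, MeasurableSet[m] A ∧ (W u ⁻¹' B : Set Ω) =ᵐ[P] A) :
    augmentedFiltration P W hW t ≤ eventuallyMeasurableSpace m (ae P) := by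
  refine sup_le (MeasurableSpace.generateFrom_le ?_) (MeasurableSpace.generateFrom_le ?_)
  · rintro S ⟨u, hu, B, hB, rfl⟩
    exact hm u hu B hB
  · rintro S ⟨-, hS⟩
    exact ⟨∅, MeasurableSet.empty, ae_eq_empty.2 hS⟩

lemma exists_past_ae_eq (hW : ∀ t, Measurable (W t)) (t : Horizon T) {A : Set Ω}
    (hA : MeasurableSet[augmentedFiltration P W hW t] A) :
    ∃ A', MeasurableSet[pastSigma W t] A' ∧ A =ᵐ[P] A' :=
  augmentedFiltration_le_eventually (P := P) (m := pastSigma W t) hW t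
    (fun u hu B hB => ⟨_, MeasurableSpace.measurableSet_generateFrom ⟨u, hu, B, hB, rfl⟩,
      EventuallyEq.rfl⟩) A hA

/-- The average of `g` over the Gaussian law with mean `x` and covariance `τ I`. -/
def gaussAvg (g : Vec d → ℝ) (τ : ℝ) (x : Vec d) : ℝ :=
  ∫ z, g (x + Real.sqrt τ • z) ∂stdGaussian (Vec d)

/-- Joint continuity, including at variance `0`, is what makes the conditional expectation of g(W u)
continuous in time up to and including `u`. -/
lemma continuous_gaussAvg {g : Vec d → ℝ} (hg : Continuous g) {C : ℝ} (hC : ∀ x, ‖g x‖ ≤ C) :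
    Continuous fun p : ℝ × Vec d => gaussAvg g p.1 p.2 := by
  refine continuous_of_dominated (bound := fun _ => C) (fun p => ?_)
    (fun p => Eventually.of_forall fun z => hC _) (integrable_const C)
    (Eventually.of_forall fun z => ?_)
  · exact (hg.comp (by fun_prop)).aestronglyMeasurable
  · have : Continuous fun p : ℝ × Vec d => p.2 + Real.sqrt p.1 • z :=
      continuous_snd.add ((Real.continuous_sqrt.comp continuous_fst).smul continuous_const)
    exact hg.comp this

lemma norm_gaussAvg_le {g : Vec d → ℝ} {C : ℝ} (hC : ∀ x, ‖g x‖ ≤ C) (τ : ℝ) (x : Vec d) :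
    ‖gaussAvg g τ x‖ ≤ C := by
  have := norm_integral_le_of_norm_le_const (μ := stdGaussian (Vec d)) (C := C)
    (f := fun z => g (x + Real.sqrt τ • z)) (Eventually.of_forall fun z => hC _)
  simpa [gaussAvg] using this

lemma gaussAvg_zero (g : Vec d → ℝ) (x : Vec d) : gaussAvg g 0 x = g x := by
  simp [gaussAvg]

/-- The freezing argument: the increment is independent of the past, so it can be integrated out
with its Gaussian law while the past is held fixed. -/
lemma setIntegral_past_increment (hB : IsBrownianMotion P W) {t u : Horizon T} (htu : t ≤ u)
    {g : Vec d → ℝ} (hg : Continuous g) {C : ℝ} (hC : ∀ x, ‖g x‖ ≤ C) {A : Set Ω}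
    (hA : MeasurableSet[pastSigma W t] A) :
    ∫ ω in A, g (W u ω) ∂P = ∫ ω in A, gaussAvg g ((u : ℝ) - t) (W t ω) ∂P := by
  have hW := hB.measurable
  have hAm : MeasurableSet A := pastSigma_le hW t A hA
  -- Packing the indicator of `A` and `W t` into one past variable lets a single product-law
  -- statement handle both.
  let Z : Ω → ℝ × Vec d := fun ω => (A.indicator (fun _ => 1) ω, W t ω)
  let D : Ω → Vec d := fun ω => W u ω - W t ω
  have hZp : Measurable[pastSigma W t] Z :=
    Measurable.prodMk (measurable_const.indicator hA) (measurable_past t)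
  have hZ : Measurable Z := hZp.mono (pastSigma_le hW t) le_rfl
  have hD : Measurable D := (hW u).sub (hW t)
  have hind : IndepFun Z D P := by
    rw [IndepFun_iff_Indep]
    exact indep_of_indep_of_le_left (hB.indep_increments t u htu) hZp.comap_le
  have hprod := (indepFun_iff_map_prod_eq_prod_map_map hZ.aemeasurable hD.aemeasurable).1 hind
  let h : (ℝ × Vec d) × Vec d → ℝ := fun q => q.1.1 * g (q.1.2 + q.2)
  have hhc : Continuous h := by fun_prop
  have hcomp : ∀ ω, h (Z ω, D ω) = A.indicator (fun ω => g (W u ω)) ω := by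
    intro ω
    by_cases hω : ω ∈ A <;> simp [h, Z, D, hω]
  have hbase : Integrable (fun ω => g (W u ω)) P :=
    Integrable.of_bound (hg.measurable.comp (hW u)).aestronglyMeasurable C
      (Eventually.of_forall fun ω => hC _)
  have hint : Integrable h (P.map fun ω => (Z ω, D ω)) := by
    rw [integrable_map_measure hhc.aestronglyMeasurable (hZ.prodMk hD).aemeasurable]
    refine (hbase.indicator hAm).congr (Eventually.of_forall fun ω => (hcomp ω).symm)
  rw [← integral_indicator hAm, ← integral_indicator hAm]
  calc ∫ ω, A.indicator (fun ω => g (W u ω)) ω ∂P = ∫ ω, h (Z ω, D ω) ∂P :=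
        integral_congr_ae (Eventually.of_forall fun ω => (hcomp ω).symm)
    _ = ∫ q, h q ∂(P.map fun ω => (Z ω, D ω)) :=
        (integral_map (hZ.prodMk hD).aemeasurable hhc.aestronglyMeasurable).symm
    _ = ∫ a, ∫ b, h (a, b) ∂P.map D ∂P.map Z := by
        rw [hprod] at hint ⊢
        exact integral_prod _ hint
    _ = ∫ ω, ∫ b, h (Z ω, b) ∂P.map D ∂P := by
        rw [hprod] at hint
        exact integral_map hZ.aemeasurable hint.1.integral_prod_right'
    _ = _ := by
        refine integral_congr_ae (Eventually.of_forall fun ω => ?_)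
        have hlaw : P.map D = (stdGaussian (Vec d)).map
            (fun x => Real.sqrt ((u : ℝ) - (t : ℝ)) • x) := hB.gaussian_increments t u htu
        simp only [hlaw]
        rw [integral_map (by fun_prop) (by
          exact (hhc.comp (by fun_prop : Continuous fun b => (Z ω, b))).aestronglyMeasurable)]
        by_cases hω : ω ∈ A <;> simp [h, Z, hω, gaussAvg]

/-- The Markov property of Brownian motion with respect to its augmented filtration. -/
lemma condExp_brownian (hB : IsBrownianMotion P W) {t u : Horizon T} (htu : t ≤ u)
    {g : Vec d → ℝ} (hg : Continuous g) {C : ℝ} (hC : ∀ x, ‖g x‖ ≤ C) :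
    P[fun ω => g (W u ω) | augmentedFiltration P W hB.measurable t] =ᵐ[P]
      fun ω => gaussAvg g ((u : ℝ) - t) (W t ω) := by
  have hW := hB.measurable
  have hgm : Measurable[augmentedFiltration P W hB.measurable t]
      fun ω => gaussAvg g ((u : ℝ) - t) (W t ω) :=
    (((continuous_gaussAvg hg hC).comp (by fun_prop :
      Continuous fun x : Vec d => ((u : ℝ) - t, x))).measurable).comp
        (adapted_augmentedFiltration hW t)
  have hint : Integrable (fun ω => gaussAvg g ((u : ℝ) - t) (W t ω)) P :=
    Integrable.of_bound (hgm.mono ((augmentedFiltration P W hW).le t) le_rfl).aestronglyMeasurable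
      C (Eventually.of_forall fun ω => norm_gaussAvg_le hC _ _)
  refine (ae_eq_condExp_of_forall_setIntegral_eq ((augmentedFiltration P W hW).le t) ?_
    (fun _ _ _ => hint.integrableOn) ?_ hgm.stronglyMeasurable.aestronglyMeasurable).symm
  · exact Integrable.of_bound (hg.measurable.comp (hW u)).aestronglyMeasurable C
      (Eventually.of_forall fun ω => hC _)
  · intro A hA _
    -- Independence is assumed only for the raw past; an augmented event differs from a raw one by a
    -- null set, which set integrals ignore.
    obtain ⟨A', hA', hAA'⟩ := exists_past_ae_eq hW t hA
    rw [setIntegral_congr_set hAA', setIntegral_congr_set hAA']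
    exact (setIntegral_past_increment hB htu hg hC hA').symm

/-- A version of the Brownian motion all of whose paths are continuous and start at `0`. -/
lemma exists_regular_version (hB : IsBrownianMotion P W) :
    ∃ V : Proc T Ω d, (∀ t, Measurable[augmentedFiltration P W hB.measurable t] (V t)) ∧
      (∀ ω, Continuous fun t => V t ω) ∧ (∀ ω (t : Horizon T), (t : ℝ) = 0 → V t ω = 0) ∧
      ∀ t, V t =ᵐ[P] W t := by
  obtain ⟨S, hSm, hS0, hS⟩ := exists_null_superset (hB.start.and hB.continuous_paths)
  classical
  refine ⟨fun t ω => if ω ∈ S then 0 else W t ω, fun t => ?_, fun ω => ?_, fun ω t ht => ?_,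
    fun t => ?_⟩
  · exact Measurable.ite (containsNull_augmentedFiltration hB.measurable S hSm hS0 t)
      measurable_const (adapted_augmentedFiltration _ t)
  · by_cases hω : ω ∈ S
    · simpa [hω] using continuous_const
    · simpa [hω] using (hS ω hω).2
  · by_cases hω : ω ∈ S
    · simp [hω]
    · simpa [hω] using (hS ω hω).1 t ht
  · filter_upwards [measure_eq_zero_iff_ae_notMem.1 hS0] with ω hω
    simp [hω]

end Brownian

end PriceImpact

end

/-! ### Continuity of the bounded martingales of the Brownian filtration. -/

noncomputable section

namespace PriceImpact

section BrownianMartingales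

set_option linter.unusedSectionVars false

variable {Ω : Type*} {mΩ : MeasurableSpace Ω} {T : ℝ} {d : ℕ} {P : Measure Ω}
  [IsProbabilityMeasure P] {W : Proc T Ω d}

/-- The time at which the conditional expectation of `g (W u)` given `F s` is revealed. -/
def clampTime (s u t : Horizon T) : Horizon T := min (max t s) u

lemma continuous_clampTime (s u : Horizon T) : Continuous (clampTime s u) := by
  unfold clampTime
  fun_prop

/-- The contribution of the increment after `s` to the martingale generated by `X * g (W u)`. -/
lemma isContinuousVersion_increment (hB : IsBrownianMotion P W) {V : Proc T Ω d}
    (hVm : ∀ t, Measurable[augmentedFiltration P W hB.measurable t] (V t))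
    (hVc : ∀ ω, Continuous fun t => V t ω) (hVW : ∀ t, V t =ᵐ[P] W t) {s u : Horizon T}
    (hsu : s ≤ u) {g : Vec d → ℝ} (hg : Continuous g) {C : ℝ} (hC : ∀ x, ‖g x‖ ≤ C)
    {X : Ω → ℝ} (hX : Measurable[augmentedFiltration P W hB.measurable s] X) {C' : ℝ}
    (hX' : ∀ ω, ‖X ω‖ ≤ C') :
    HasContinuousVersion P (augmentedFiltration P W hB.measurable)
      (fun ω => X ω * g (V u ω) - X ω * gaussAvg g ((u : ℝ) - s) (V s ω)) := by
  set F := augmentedFiltration P W hB.measurable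
  -- On `[s,u]` this is the conditional expectation of `g (V u)` given by the Markov property;
  -- clamping freezes it outside. As `X` is known at time `s`, the desired version is `X * (h t - h
  -- s)`.
  let h : Horizon T → Ω → ℝ := fun t ω =>
    gaussAvg g ((u : ℝ) - clampTime s u t) (V (clampTime s u t) ω)
  have hgc := continuous_gaussAvg hg hC
  have hVm' : ∀ t, Measurable (V t) := fun t => (hVm t).mono (F.le t) le_rfl
  have hHm : ∀ τ t, Measurable[F t] fun ω => gaussAvg g τ (V t ω) := fun τ t =>
    (hgc.comp (by fun_prop : Continuous fun x : Vec d => (τ, x))).measurable.comp (hVm t)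
  have hH : ∀ τ t, Integrable (fun ω => gaussAvg g τ (V t ω)) P := fun τ t =>
    Integrable.of_bound ((hHm τ t).mono (F.le t) le_rfl).aestronglyMeasurable C
      (Eventually.of_forall fun ω => norm_gaussAvg_le hC _ _)
  have hXm : Measurable X := hX.mono (F.le s) le_rfl
  have hbdd : ∀ {Y : Ω → ℝ}, Integrable Y P → Integrable (fun ω => X ω * Y ω) P := fun hY =>
    hY.bdd_mul hXm.aestronglyMeasurable (Eventually.of_forall hX')
  have hgi : Integrable (fun ω => g (V u ω)) P :=
    Integrable.of_bound (hg.measurable.comp (hVm' u)).aestronglyMeasurable C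
      (Eventually.of_forall fun ω => hC _)
  have hs : clampTime s u s = s := by simp [clampTime, hsu]
  have hmarkov : ∀ t, t ≤ u → P[fun ω => g (V u ω) | F t] =ᵐ[P]
      fun ω => gaussAvg g ((u : ℝ) - t) (V t ω) := by
    intro t ht
    have e1 : (fun ω => g (V u ω)) =ᵐ[P] fun ω => g (W u ω) := by
      filter_upwards [hVW u] with ω hω
      rw [hω]
    refine (condExp_congr_ae e1).trans ((condExp_brownian hB ht hg hC).trans ?_)
    filter_upwards [hVW t] with ω hω
    rw [hω]
  have hint : Integrable
      (fun ω => X ω * g (V u ω) - X ω * gaussAvg g ((u : ℝ) - s) (V s ω)) P :=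
    (hbdd hgi).sub (hbdd (hH _ _))
  have hlate : ∀ t, s ≤ t → (fun ω => X ω * (h t ω - h s ω)) =ᵐ[P]
      P[fun ω => X ω * g (V u ω) - X ω * gaussAvg g ((u : ℝ) - s) (V s ω) | F t] := by
    intro t hst
    have hXt : StronglyMeasurable[F t] X := (hX.mono (F.mono hst) le_rfl).stronglyMeasurable
    have hconst : StronglyMeasurable[F t]
        fun ω => X ω * gaussAvg g ((u : ℝ) - s) (V s ω) :=
      hXt.mul ((hHm _ s).mono (F.mono hst) le_rfl).stronglyMeasurable
    have e1 := condExp_sub (hbdd hgi) (hbdd (hH ((u : ℝ) - s) s)) (F t)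
    have e2 : P[fun ω => X ω * gaussAvg g ((u : ℝ) - s) (V s ω) | F t] =
        fun ω => X ω * gaussAvg g ((u : ℝ) - s) (V s ω) :=
      condExp_of_stronglyMeasurable (F.le t) hconst (hbdd (hH _ _))
    have e3 : P[fun ω => X ω * g (V u ω) | F t] =ᵐ[P]
        fun ω => X ω * P[fun ω => g (V u ω) | F t] ω :=
      condExp_mul_of_stronglyMeasurable_left hXt (hbdd hgi) hgi
    have e4 : P[fun ω => g (V u ω) | F t] =ᵐ[P] h t := by
      rcases le_total t u with htu | hut
      · have : clampTime s u t = t := by simp [clampTime, hst, htu]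
        simp only [h, this]
        exact hmarkov t htu
      · have : clampTime s u t = u := by simp [clampTime, hst, hut]
        have e5 : P[fun ω => g (V u ω) | F t] = fun ω => g (V u ω) :=
          condExp_of_stronglyMeasurable (F.le t)
            (hg.measurable.comp ((hVm u).mono (F.mono hut) le_rfl)).stronglyMeasurable hgi
        rw [e5]
        simp only [h, this, sub_self, gaussAvg_zero]
        exact EventuallyEq.rfl
    filter_upwards [e1, e3, e4] with ω a1 a3 a4
    have a1' : P[fun ω => X ω * g (V u ω) - X ω * gaussAvg g ((u : ℝ) - s) (V s ω) | F t] ω =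
        P[fun ω => X ω * g (V u ω) | F t] ω -
          P[fun ω => X ω * gaussAvg g ((u : ℝ) - s) (V s ω) | F t] ω := a1
    rw [a1', a3, a4, e2]
    simp only [h, hs]
    ring
  -- Before `s` the version is identically zero, so it is adapted there although `X` is measurable
  -- only from time `s` on.
  have hearly : ∀ t, t ≤ s → h t = h s := by
    intro t hts
    have : clampTime s u t = s := by simp [clampTime, hts, hsu]
    simp only [h, this, hs]
  refine ⟨fun t ω => X ω * (h t ω - h s ω), fun t => ?_, fun ω => ?_, fun t => ?_⟩
  · rcases le_total t s with hts | hst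
    · simp only [hearly t hts, sub_self, mul_zero]
      exact measurable_const
    · have hct : clampTime s u t ≤ t := by
        simp only [clampTime, max_eq_left hst]
        exact min_le_left _ _
      refine (hX.mono (F.mono hst) le_rfl).mul (Measurable.sub ?_ ?_)
      · exact (hHm _ _).mono (F.mono hct) le_rfl
      · simp only [h, hs]
        exact (hHm _ _).mono (F.mono hst) le_rfl
  · refine continuous_const.mul (Continuous.sub ?_ continuous_const)
    have hcl := continuous_clampTime s u
    exact hgc.comp ((continuous_const.sub (continuous_subtype_val.comp hcl)).prodMk
      ((hVc ω).comp hcl))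
  · rcases le_total t s with hts | hst
    · have e0 : P[fun ω => X ω * g (V u ω) - X ω * gaussAvg g ((u : ℝ) - s) (V s ω) | F s]
          =ᵐ[P] 0 := by
        refine (hlate s le_rfl).symm.trans ?_
        simp only [sub_self, mul_zero]
        exact EventuallyEq.rfl
      have e1 := condExp_condExp_of_le (μ := P)
        (f := fun ω => X ω * g (V u ω) - X ω * gaussAvg g ((u : ℝ) - s) (V s ω))
        (F.mono hts) (F.le s)
      refine EventuallyEq.trans ?_ e1
      refine EventuallyEq.trans ?_ (condExp_congr_ae e0).symm
      simp only [hearly t hts, sub_self, mul_zero, condExp_zero]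
      exact EventuallyEq.rfl
    · exact hlate t hst

lemma hasContinuousVersion_const {F : Filtration (Horizon T) mΩ} (c : ℝ) :
    HasContinuousVersion P F fun _ => c := by
  refine ⟨fun _ _ => c, fun _ => measurable_const, fun _ => continuous_const, fun t => ?_⟩
  rw [condExp_const (F.le t)]

/-- Functions of finitely many values of the Brownian motion. -/
lemma hasContinuousVersion_cylinder (hT : 0 < T) (hB : IsBrownianMotion P W) {V : Proc T Ω d}
    (hVm : ∀ t, Measurable[augmentedFiltration P W hB.measurable t] (V t))
    (hVc : ∀ ω, Continuous fun t => V t ω) (hV0 : ∀ ω (t : Horizon T), (t : ℝ) = 0 → V t ω = 0)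
    (hVW : ∀ t, V t =ᵐ[P] W t)
    {f : Horizon T → Vec d → ℝ} (hf : ∀ t, Continuous (f t)) {C : ℝ} (hC1 : 1 ≤ C)
    (hC : ∀ t x, ‖f t x‖ ≤ C) (S : Finset (Horizon T)) :
    ∀ u, (∀ t ∈ S, t < u) → ∀ g : Vec d → ℝ, Continuous g → ∀ C', (∀ x, ‖g x‖ ≤ C') →
      HasContinuousVersion P (augmentedFiltration P W hB.measurable)
        (fun ω => g (V u ω) * ∏ t ∈ S, f t (V t ω)) := by
  set F := augmentedFiltration P W hB.measurable
  have hVm' : ∀ t, Measurable (V t) := fun t => (hVm t).mono (F.le t) le_rfl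
  have hint : ∀ {s : Horizon T} {g : Vec d → ℝ} {C' : ℝ} {X : Ω → ℝ} {C'' : ℝ}, Continuous g →
      (∀ x, ‖g x‖ ≤ C') → Measurable X → (∀ ω, ‖X ω‖ ≤ C'') →
      Integrable (fun ω => X ω * g (V s ω)) P := by
    intro s g C' X C'' hg hC' hX hX'
    exact (Integrable.of_bound (hg.measurable.comp (hVm' s)).aestronglyMeasurable C'
      (Eventually.of_forall fun ω => hC' _)).bdd_mul hX.aestronglyMeasurable
      (Eventually.of_forall hX')
  have hHc : ∀ {g : Vec d → ℝ} {C' : ℝ} (τ : ℝ), Continuous g → (∀ x, ‖g x‖ ≤ C') →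
      Continuous (gaussAvg g τ) := fun τ hg hC' =>
    (continuous_gaussAvg hg hC').comp (by fun_prop : Continuous fun x : Vec d => (τ, x))
  -- Peel off the last time `s` of `S`: the factors up to `s` are known at `s`, and `g (V u)` splits
  -- into its centred part and its Gaussian average at `V s`. The average merges with `f s` into a
  -- new outer function at time `s`, to which the induction hypothesis applies.
  induction S using Finset.induction_on_max with
  | empty =>
    intro u _ g hg C' hC'
    obtain ⟨D, hD⟩ := isContinuousVersion_increment hB hVm hVc hVW (initialTime_le hT u) hg hC'
      (X := fun _ => 1) measurable_const (C' := 1) (by simp)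
    -- At time zero the path sits at the origin, so the Gaussian average is a constant.
    have hz : ∀ ω, V (initialTime hT) ω = 0 := fun ω => hV0 ω _ rfl
    obtain ⟨N, hN⟩ := hasContinuousVersion_const (P := P) (F := F)
      (gaussAvg g ((u : ℝ) - initialTime hT) 0)
    refine ⟨_, (hD.add hN ?_ (integrable_const _)).congr (Eventually.of_forall fun ω => ?_)⟩
    · exact (hint hg hC' measurable_const (C'' := 1) (by simp)).sub
        (hint (hHc _ hg hC') (norm_gaussAvg_le hC' _) measurable_const (C'' := 1) (by simp))
    · simp [hz]
  | insert s S hlt ih =>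
    intro u hu g hg C' hC'
    have hsu : s < u := hu s (Finset.mem_insert_self _ _)
    have hsS : s ∉ S := fun h => lt_irrefl _ (hlt s h)
    let X : Ω → ℝ := fun ω => f s (V s ω) * ∏ t ∈ S, f t (V t ω)
    have hXm : Measurable[F s] X := by
      refine ((hf s).measurable.comp (hVm s)).mul (Finset.measurable_prod _ fun t ht => ?_)
      exact (hf t).measurable.comp ((hVm t).mono (F.mono (hlt t ht).le) le_rfl)
    have hXb : ∀ ω, ‖X ω‖ ≤ C * C ^ S.card := by
      intro ω
      rw [norm_mul, norm_prod]
      exact mul_le_mul (hC _ _) ((Finset.prod_le_prod (fun _ _ => norm_nonneg _)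
        (fun t _ => hC t _)).trans_eq (by simp)) (Finset.prod_nonneg fun _ _ => norm_nonneg _)
        (by linarith)
    have hXm' : Measurable X := hXm.mono (F.le s) le_rfl
    obtain ⟨D, hD⟩ := isContinuousVersion_increment hB hVm hVc hVW hsu.le hg hC' hXm hXb
    obtain ⟨N, hN⟩ := ih s hlt (fun x => f s x * gaussAvg g ((u : ℝ) - s) x)
      ((hf s).mul (hHc _ hg hC')) (C * C') (fun x => by
        rw [norm_mul]
        exact mul_le_mul (hC _ _) (norm_gaussAvg_le hC' _ _) (norm_nonneg _) (by linarith))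
    have hNX : (fun ω => f s (V s ω) * gaussAvg g ((u : ℝ) - s) (V s ω) *
        ∏ t ∈ S, f t (V t ω)) = fun ω => X ω * gaussAvg g ((u : ℝ) - s) (V s ω) := by
      ext ω; simp only [X]; ring
    rw [hNX] at hN
    have i1 := hint (s := u) hg hC' hXm' hXb
    have i2 := hint (s := s) (hHc ((u : ℝ) - s) hg hC') (norm_gaussAvg_le hC' _) hXm' hXb
    refine ⟨_, (hD.add hN (i1.sub i2) i2).congr (Eventually.of_forall fun ω => ?_)⟩
    simp only [X, Finset.prod_insert hsS]
    ring

/-- Finite intersections of events `V t ∈ C t` with closed sets `C t`. -/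
def closedCylinders (V : Proc T Ω d) : Set (Set Ω) :=
  {A | ∃ (S : Finset (Horizon T)) (C : Horizon T → Set (Vec d)),
    (∀ t, IsClosed (C t)) ∧ A = {ω | ∀ t ∈ S, V t ω ∈ C t}}

lemma isPiSystem_closedCylinders (V : Proc T Ω d) : IsPiSystem (closedCylinders V) := by
  classical
  rintro _ ⟨S, C, hC, rfl⟩ _ ⟨S', C', hC', rfl⟩ -
  -- The families `C` and `C'` are arbitrary off their index sets, so they are replaced by the whole
  -- space there before intersecting.
  refine ⟨S ∪ S', fun t => (if t ∈ S then C t else Set.univ) ∩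
    (if t ∈ S' then C' t else Set.univ), fun t => ?_, ?_⟩
  · refine IsClosed.inter ?_ ?_
    · split_ifs
      exacts [hC t, isClosed_univ]
    · split_ifs
      exacts [hC' t, isClosed_univ]
  · ext ω
    simp only [Set.mem_inter_iff, Set.mem_ofPred_eq, Finset.mem_union]
    constructor
    · rintro ⟨h1, h2⟩ t -
      refine ⟨?_, ?_⟩
      · split_ifs with h
        exacts [h1 t h, Set.mem_univ _]
      · split_ifs with h
        exacts [h2 t h, Set.mem_univ _]
    · intro h
      refine ⟨fun t ht => ?_, fun t ht => ?_⟩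
      · simpa [ht] using (h t (Or.inl ht)).1
      · simpa [ht] using (h t (Or.inr ht)).2

lemma measurable_closedCylinders (V : Proc T Ω d) (t : Horizon T) :
    Measurable[MeasurableSpace.generateFrom (closedCylinders V)] (V t) := by
  refine @measurable_of_isClosed _ _ _ _ _ (MeasurableSpace.generateFrom (closedCylinders V)) _
    fun C hC => ?_
  exact MeasurableSpace.measurableSet_generateFrom ⟨{t}, fun _ => C, fun _ => hC, by ext; simp⟩

/-- The indicator of a closed set is a bounded limit of continuous functions, which reduces the
claim to products of continuous functions of path values. -/
lemma hasContinuousVersion_closedCylinder (hT : 0 < T) (hB : IsBrownianMotion P W) {V : Proc T Ω d}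
    (hVm : ∀ t, Measurable[augmentedFiltration P W hB.measurable t] (V t))
    (hVc : ∀ ω, Continuous fun t => V t ω) (hV0 : ∀ ω (t : Horizon T), (t : ℝ) = 0 → V t ω = 0)
    (hVW : ∀ t, V t =ᵐ[P] W t) {A : Set Ω} (hA : A ∈ closedCylinders V) :
    HasContinuousVersion P (augmentedFiltration P W hB.measurable) (A.indicator fun _ => 1) := by
  classical
  set F := augmentedFiltration P W hB.measurable
  have hVm' : ∀ t, Measurable (V t) := fun t => (hVm t).mono (F.le t) le_rfl
  obtain ⟨S₀, C₀, hC₀, rfl⟩ := hA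
  -- The product lemma wants an outer time strictly after the others. Time `T` plays this role, with
  -- the factor at `T` as outer function if there is one and `1` otherwise.
  set S := S₀.erase (finalTime hT)
  let g : ℕ → Horizon T → Vec d → ℝ := fun n t x => ((hC₀ t).apprSeq n x : ℝ)
  have hgc : ∀ n t, Continuous (g n t) := fun n t =>
    NNReal.continuous_coe.comp ((hC₀ t).apprSeq n).continuous
  have hgb : ∀ n t x, ‖g n t x‖ ≤ 1 := fun n t x => by
    simp only [g, NNReal.norm_eq]
    exact_mod_cast HasOuterApproxClosed.apprSeq_apply_le_one (hC₀ t) n x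
  have hgl : ∀ t x, Tendsto (fun n => g n t x) atTop (𝓝 ((C₀ t).indicator (fun _ => 1) x)) := by
    intro t x
    have h := tendsto_pi_nhds.1 (HasOuterApproxClosed.tendsto_apprSeq (hC₀ t)) x
    have h2 := (NNReal.continuous_coe.tendsto _).comp h
    have e : (((C₀ t).indicator (fun _ => (1 : NNReal)) x : NNReal) : ℝ) =
        (C₀ t).indicator (fun _ => 1) x := by
      by_cases hx : x ∈ C₀ t <;> simp [hx]
    rw [← e]
    exact h2
  have hone : ∀ x : Vec d, ‖(fun _ : Vec d => (1 : ℝ)) x‖ ≤ 1 := by simp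
  have hv : ∀ n, HasContinuousVersion P F fun ω => ∏ t ∈ S₀, g n t (V t ω) := by
    intro n
    by_cases hf : finalTime hT ∈ S₀
    · have := hasContinuousVersion_cylinder hT hB hVm hVc hV0 hVW (hgc n) le_rfl (hgb n)
        S (finalTime hT) (fun t ht => lt_of_le_of_ne (le_finalTime hT t)
          (Finset.ne_of_mem_erase ht)) (g n (finalTime hT)) (hgc n _) 1 (hgb n _)
      have he : (fun ω => ∏ t ∈ S₀, g n t (V t ω)) = fun ω =>
          g n (finalTime hT) (V (finalTime hT) ω) * ∏ t ∈ S, g n t (V t ω) := by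
        ext ω
        exact (Finset.mul_prod_erase S₀ (fun t => g n t (V t ω)) hf).symm
      rw [he]
      exact this
    · have := hasContinuousVersion_cylinder hT hB hVm hVc hV0 hVW (hgc n) le_rfl (hgb n)
        S (finalTime hT) (fun t ht => lt_of_le_of_ne (le_finalTime hT t)
          (Finset.ne_of_mem_erase ht)) (fun _ => 1) continuous_const 1 hone
      simpa only [S, Finset.erase_eq_of_notMem hf, one_mul] using this
  refine hasContinuousVersion_of_tendsto hT (containsNull_augmentedFiltration hB.measurable)
    (C := 1) (fun n => ?_) (fun n => Eventually.of_forall fun ω => ?_)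
    (Eventually.of_forall fun ω => ?_) hv
  · exact (Finset.measurable_prod _ fun t _ =>
      (hgc n t).measurable.comp (hVm' t)).aestronglyMeasurable
  · rw [norm_prod]
    exact Finset.prod_le_one (fun _ _ => norm_nonneg _) (fun t _ => hgb n t _)
  · have h := tendsto_finsetProd S₀ (fun t _ => hgl t (V t ω))
    convert h using 2
    by_cases hω : ∀ t ∈ S₀, V t ω ∈ C₀ t
    · rw [Set.indicator_of_mem (by exact hω)]
      exact (Finset.prod_eq_one fun t ht => by simp [hω t ht]).symm
    · rw [Set.indicator_of_notMem (by exact hω)]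
      push Not at hω
      obtain ⟨t, ht, htC⟩ := hω
      exact (Finset.prod_eq_zero ht (by simp [htC])).symm

lemma hasContinuousVersion_add {F : Filtration (Horizon T) mΩ} {ξ η : Ω → ℝ}
    (hξ : HasContinuousVersion P F ξ) (hη : HasContinuousVersion P F η) (hξi : Integrable ξ P)
    (hηi : Integrable η P) : HasContinuousVersion P F fun ω => ξ ω + η ω := by
  obtain ⟨M, hM⟩ := hξ
  obtain ⟨N, hN⟩ := hη
  exact ⟨_, hM.add hN hξi hηi⟩

/-- Dynkin's argument from the closed cylinders: complements by linearity, disjoint unions as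
bounded limits of finite unions. The null sets of the augmentation do not affect conditional
expectations. -/
lemma hasContinuousVersion_indicator (hT : 0 < T) (hB : IsBrownianMotion P W) {A : Set Ω}
    (hA : MeasurableSet[augmentedFiltration P W hB.measurable (finalTime hT)] A) :
    HasContinuousVersion P (augmentedFiltration P W hB.measurable) (A.indicator fun _ => 1) := by
  classical
  set F := augmentedFiltration P W hB.measurable
  obtain ⟨V, hVm, hVc, hV0, hVW⟩ := exists_regular_version hB
  have hgen : MeasurableSpace.generateFrom (closedCylinders V) ≤ mΩ := by
    refine MeasurableSpace.generateFrom_le ?_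
    rintro _ ⟨S, C, hC, rfl⟩
    have : {ω | ∀ t ∈ S, V t ω ∈ C t} = ⋂ t ∈ S, V t ⁻¹' C t := by ext; simp
    rw [this]
    exact S.measurableSet_biInter fun t _ =>
      ((hVm t).mono (F.le t) le_rfl) (hC t).measurableSet
  have key : ∀ A, MeasurableSet[MeasurableSpace.generateFrom (closedCylinders V)] A →
      HasContinuousVersion P F (A.indicator fun _ => 1) := by
    refine MeasurableSpace.induction_on_inter rfl (isPiSystem_closedCylinders V) ?_ ?_ ?_ ?_
    · simpa using hasContinuousVersion_const (P := P) (F := F) 0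
    · intro A hA
      exact hasContinuousVersion_closedCylinder hT hB hVm hVc hV0 hVW hA
    · intro A hAm ⟨M, hM⟩
      obtain ⟨N, hN⟩ := hasContinuousVersion_const (P := P) (F := F) 1
      refine ⟨_, (hN.sub hM (integrable_const _)
        ((integrable_const (1 : ℝ)).indicator (hgen _ hAm))).congr
        (Eventually.of_forall fun ω => ?_)⟩
      by_cases hω : ω ∈ A <;> simp [hω]
    · intro f hd hfm hf
      let D : ℕ → Set Ω := fun n => ⋃ i < n, f i
      have hDm : ∀ n, MeasurableSet (D n) := fun n =>
        MeasurableSet.biUnion (Set.to_countable _) fun i _ => hgen _ (hfm i)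
      have hD : ∀ n, HasContinuousVersion P F ((D n).indicator fun _ => 1) := by
        intro n
        induction n with
        | zero => simpa [D] using hasContinuousVersion_const (P := P) (F := F) 0
        | succ n ih =>
          have hsucc : D (n + 1) = D n ∪ f n := by
            ext ω
            simp only [D, Set.mem_iUnion, Set.mem_union, Nat.lt_succ_iff_lt_or_eq]
            aesop
          have hdis : Disjoint (D n) (f n) := by
            simp only [D, Set.disjoint_iUnion_left]
            exact fun i hi => hd hi.ne
          have := hasContinuousVersion_add ih (hf n) ((integrable_const _).indicator (hDm n))
            ((integrable_const _).indicator (hgen _ (hfm n)))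
          rw [hsucc, Set.indicator_union_of_disjoint hdis]
          exact this
      refine hasContinuousVersion_of_tendsto hT (containsNull_augmentedFiltration hB.measurable)
        (C := 1) (fun n => ?_) (fun n => Eventually.of_forall fun ω => ?_)
        (Eventually.of_forall fun ω => ?_) hD
      · exact (measurable_const.indicator (hDm n)).aestronglyMeasurable
      · by_cases hω : ω ∈ D n <;> simp [hω]
      · by_cases hω : ω ∈ ⋃ i, f i
        · rw [Set.indicator_of_mem hω]
          obtain ⟨i, hi⟩ := Set.mem_iUnion.1 hω
          refine tendsto_const_nhds.congr' ?_
          filter_upwards [eventually_gt_atTop i] with n hn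
          rw [Set.indicator_of_mem (Set.mem_iUnion₂.2 ⟨i, hn, hi⟩)]
        · rw [Set.indicator_of_notMem hω]
          refine tendsto_const_nhds.congr fun n => ?_
          rw [Set.indicator_of_notMem]
          intro h
          obtain ⟨i, -, hi⟩ := Set.mem_iUnion₂.1 h
          exact hω (Set.mem_iUnion.2 ⟨i, hi⟩)
  obtain ⟨A', hA', hAA'⟩ := augmentedFiltration_le_eventually (P := P)
    (m := MeasurableSpace.generateFrom (closedCylinders V)) hB.measurable (finalTime hT)
    (fun u _ B hBm => ⟨V u ⁻¹' B, measurable_closedCylinders V u hBm, by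
      filter_upwards [hVW u] with ω hω
      exact congrArg (· ∈ B) hω.symm⟩) A hA
  obtain ⟨M, hM⟩ := key A' hA'
  exact ⟨M, hM.congr (indicator_ae_eq_of_ae_eq_set hAA'.symm)⟩

/-- Bounded martingales of the augmented Brownian filtration have continuous versions. -/
theorem exists_continuousVersion (hT : 0 < T) (hB : IsBrownianMotion P W) {ξ : Ω → ℝ}
    (hξ : AEStronglyMeasurable ξ P) {C : ℝ} (hC : ∀ᵐ ω ∂P, ‖ξ ω‖ ≤ C) :
    ∃ M, IsContinuousVersion P (augmentedFiltration P W hB.measurable) M ξ ∧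
      ∀ t ω, ‖M t ω‖ ≤ C := by
  set F := augmentedFiltration P W hB.measurable
  have hξi : Integrable ξ P := Integrable.of_bound hξ C hC
  have hC0 : 0 ≤ C := by
    obtain ⟨ω, hω⟩ := hC.exists
    exact (norm_nonneg _).trans hω
  have hcond : ∀ t, ∀ᵐ ω ∂P, ‖P[ξ | F t] ω‖ ≤ C := by
    intro t
    have h1 := condExp_mono (m := F t) (integrable_const (-C)) hξi
      (hC.mono fun ω h => (abs_le.1 h).1)
    have h2 := condExp_mono (m := F t) hξi (integrable_const C)
      (hC.mono fun ω h => (abs_le.1 h).2)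
    rw [condExp_const (F.le t)] at h1 h2
    filter_upwards [h1, h2] with ω a b
    exact abs_le.2 ⟨a, b⟩
  have hmeas : StronglyMeasurable[F (finalTime hT)] (P[ξ | F (finalTime hT)]) :=
    stronglyMeasurable_condExp
  have hsimple : ∀ f : @SimpleFunc Ω (F (finalTime hT)) ℝ, HasContinuousVersion P F f := by
    intro f
    refine @SimpleFunc.induction Ω ℝ (F (finalTime hT)) _
      (fun f => HasContinuousVersion P F f) ?_ ?_ f
    · intro c A hA
      obtain ⟨M, hM⟩ := hasContinuousVersion_indicator hT hB hA
      refine ⟨_, (hM.const_mul c).congr (Eventually.of_forall fun ω => ?_)⟩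
      by_cases hω : ω ∈ A <;> simp [hω]
    · intro f g _ hf hg
      have hi : ∀ f : @SimpleFunc Ω (F (finalTime hT)) ℝ, Integrable f P := by
        intro f
        obtain ⟨K, hK⟩ := @SimpleFunc.exists_forall_norm_le _ _ (F (finalTime hT)) _ f
        refine Integrable.of_bound ?_ K (Eventually.of_forall hK)
        exact ((@SimpleFunc.measurable _ _ (F (finalTime hT)) _ f).mono (F.le _)
          le_rfl).aestronglyMeasurable
      exact hasContinuousVersion_add hf hg (hi f) (hi g)
  -- Passing to the conditional expectation at `T` does not change the martingale, and it makes the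
  -- variable a bounded limit of simple functions of `F T`.
  have hv : HasContinuousVersion P F (P[ξ | F (finalTime hT)]) := by
    refine hasContinuousVersion_of_tendsto hT (containsNull_augmentedFiltration hB.measurable)
      (C := C) (fun n => ?_) (fun n => Eventually.of_forall fun ω => ?_) ?_
      (fun n => hsimple (hmeas.approxBounded C n))
    · exact ((@SimpleFunc.measurable _ _ (F (finalTime hT)) _ (hmeas.approxBounded C n)).mono
        (F.le _) le_rfl).aestronglyMeasurable
    · exact hmeas.norm_approxBounded_le hC0 n ω
    · filter_upwards [hcond (finalTime hT)] with ω hω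
      exact hmeas.tendsto_approxBounded_of_norm_le hω
  obtain ⟨M, hM⟩ := hv
  have hMae : ∀ t, M t =ᵐ[P] P[ξ | F t] := fun t =>
    (hM.ae_eq t).trans (condExp_condExp_of_le (F.mono (le_finalTime hT t)) (F.le _))
  -- Truncation makes the bound hold for every `ω` and every time; it changes each `M t` only on a
  -- null set.
  refine ⟨fun t ω => max (-C) (min C (M t ω)), ⟨fun t => ?_, fun ω => ?_, fun t => ?_⟩,
    fun t ω => abs_le.2 ⟨le_max_left _ _, max_le (by linarith) (min_le_left _ _)⟩⟩
  · exact measurable_const.max (measurable_const.min (hM.adapted t))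
  · exact continuous_const.max (continuous_const.min (hM.continuous_paths ω))
  · filter_upwards [hMae t, hcond t] with ω h1 h2
    rw [h1, min_eq_right (abs_le.1 h2).2, max_eq_right (abs_le.1 h2).1]

end BrownianMartingales

end PriceImpact

end

/-! ### Square-integrable processes, essentially bounded processes and discounted expectations. -/

noncomputable section

namespace PriceImpact

section SquareIntegrable

set_option linter.unusedSectionVars false

variable {Ω : Type*} {mΩ : MeasurableSpace Ω} {T : ℝ} {d : ℕ} {P : Measure Ω}
  [IsProbabilityMeasure P] {F : Filtration (Horizon T) mΩ}

/-- Square integrability of a process with respect to `dP ⊗ dt`. -/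
def SqInt (P : Measure Ω) (X : Proc T Ω d) : Prop :=
  MemLp (fun p : Ω × Horizon T => X p.2 p.1) 2 (P.prod (leb T))

/-- Integrability of a real process with respect to `dP ⊗ dt`. -/
def JointInt (P : Measure Ω) (f : Horizon T → Ω → ℝ) : Prop :=
  Integrable (fun p : Ω × Horizon T => f p.2 p.1) (P.prod (leb T))

/-- The discounted expectation `E ∫₀ᵀ e^{-rt} f t dt`. -/
def discounted (P : Measure Ω) (r : ℝ) (f : Horizon T → Ω → ℝ) : ℝ :=
  ∫ p : Ω × Horizon T, Real.exp (-r * (p.2 : ℝ)) * f p.2 p.1 ∂P.prod (leb T)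

/-- Almost sure equality with respect to `dP ⊗ dt`. -/
def JointEq {β : Type*} (P : Measure Ω) (f g : Horizon T → Ω → β) : Prop :=
  ∀ᵐ p : Ω × Horizon T ∂P.prod (leb T), f p.2 p.1 = g p.2 p.1

lemma JointEq.eqAE {X Y : Proc T Ω d} (h : JointEq P X Y) : EqAE P X Y :=
  Measure.ae_ae_of_ae_prod h

lemma IsOptional.measurable_swap (hT : 0 < T) {X : Proc T Ω d} (hX : IsOptional F X) :
    Measurable fun p : Ω × Horizon T => X p.2 p.1 :=
  (hX.measurable hT).comp _root_.measurable_swap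

lemma EqAE.jointEq (hT : 0 < T) {X Y : Proc T Ω d} (h : EqAE P X Y) (hX : IsOptional F X)
    (hY : IsOptional F Y) : JointEq P X Y :=
  (Measure.ae_prod_iff_ae_ae
    (measurableSet_eq_fun (hX.measurable_swap hT) (hY.measurable_swap hT))).2 h

lemma EqAE.trans {X Y Z : Proc T Ω d} (h : EqAE P X Y) (h' : EqAE P Y Z) : EqAE P X Z := by
  filter_upwards [h, h'] with ω h1 h2
  filter_upwards [h1, h2] with t h3 h4
  exact h3.trans h4

lemma EqAE.cumulative_eq {X Y : Proc T Ω d} (h : EqAE P X Y) :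
    ∀ᵐ ω ∂P, ∀ t, cumulative X t ω = cumulative Y t ω := by
  filter_upwards [h] with ω hω t
  exact primitive_congr_ae hω t

lemma eqAE_of_forall {X Y : Proc T Ω d} (h : ∀ᵐ ω ∂P, ∀ t, X t ω = Y t ω) : EqAE P X Y := by
  filter_upwards [h] with ω h1
  exact Eventually.of_forall h1

/-- Tonelli identifies the iterated integral with an L² norm on `Ω × [0,T]`; joint measurability
comes from optionality. -/
lemma memH2_iff (hT : 0 < T) {X : Proc T Ω d} :
    MemH2 P F X ↔ IsOptional F X ∧ SqInt P X := by
  refine and_congr_right fun hX => ?_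
  have hm := hX.measurable_swap hT
  have h2 : ∫⁻ ω, ∫⁻ t, ‖X t ω‖ₑ ^ 2 ∂leb T ∂P =
      ∫⁻ p : Ω × Horizon T, ‖X p.2 p.1‖ₑ ^ 2 ∂P.prod (leb T) := by
    rw [lintegral_prod _ (hm.enorm.pow_const 2).aemeasurable]
  rw [h2, SqInt, MemLp, and_iff_right hm.aestronglyMeasurable,
    eLpNorm_lt_top_iff_lintegral_rpow_enorm_lt_top two_ne_zero ENNReal.ofNat_ne_top]
  simp

lemma SqInt.add {X Y : Proc T Ω d} (hX : SqInt P X) (hY : SqInt P Y) :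
    SqInt P fun t ω => X t ω + Y t ω :=
  MemLp.add hX hY

lemma SqInt.sub {X Y : Proc T Ω d} (hX : SqInt P X) (hY : SqInt P Y) :
    SqInt P fun t ω => X t ω - Y t ω :=
  MemLp.sub hX hY

lemma SqInt.const_smul {X : Proc T Ω d} (hX : SqInt P X) (c : ℝ) :
    SqInt P fun t ω => c • X t ω :=
  MemLp.const_smul hX c

lemma SqInt.act {X : Proc T Ω d} (hX : SqInt P X) (A : Matrix (Fin d) (Fin d) ℝ) :
    SqInt P fun t ω => PriceImpact.act A (X t ω) :=
  (LinearMap.toContinuousLinearMap (Matrix.toEuclideanLin A)).comp_memLp' hX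

lemma SqInt.of_bound {X : Proc T Ω d} (hm : Measurable fun p : Ω × Horizon T => X p.2 p.1)
    {C : ℝ} (hC : ∀ᵐ p : Ω × Horizon T ∂P.prod (leb T), ‖X p.2 p.1‖ ≤ C) : SqInt P X :=
  MemLp.of_bound hm.aestronglyMeasurable C hC

lemma SqInt.inner {X Y : Proc T Ω d} (hX : SqInt P X) (hY : SqInt P Y) :
    JointInt P fun t ω => inner ℝ (X t ω) (Y t ω) := by
  have h := hX.norm.integrable_mul hY.norm
  refine h.mono' (hX.1.inner hY.1) (Eventually.of_forall fun p => ?_)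
  exact norm_inner_le_norm _ _

lemma SqInt.integrable {X : Proc T Ω d} (hX : SqInt P X) :
    Integrable (fun p : Ω × Horizon T => X p.2 p.1) (P.prod (leb T)) :=
  MemLp.integrable one_le_two hX

lemma SqInt.ae_integrable {X : Proc T Ω d} (hX : SqInt P X) :
    ∀ᵐ ω ∂P, Integrable (fun t => X t ω) (leb T) :=
  hX.integrable.prod_right_ae

lemma MemH2.add (hT : 0 < T) {X Y : Proc T Ω d} (hX : MemH2 P F X) (hY : MemH2 P F Y) :
    MemH2 P F fun t ω => X t ω + Y t ω := by
  rw [memH2_iff hT] at *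
  exact ⟨hX.1.add hY.1, hX.2.add hY.2⟩

lemma MemH2.sub (hT : 0 < T) {X Y : Proc T Ω d} (hX : MemH2 P F X) (hY : MemH2 P F Y) :
    MemH2 P F fun t ω => X t ω - Y t ω := by
  rw [memH2_iff hT] at *
  exact ⟨hX.1.sub hY.1, hX.2.sub hY.2⟩

lemma MemH2.const_smul (hT : 0 < T) {X : Proc T Ω d} (hX : MemH2 P F X) (c : ℝ) :
    MemH2 P F fun t ω => c • X t ω := by
  rw [memH2_iff hT] at *
  exact ⟨hX.1.const_smul c, hX.2.const_smul c⟩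

lemma MemH2.act (hT : 0 < T) {X : Proc T Ω d} (hX : MemH2 P F X)
    (A : Matrix (Fin d) (Fin d) ℝ) : MemH2 P F fun t ω => PriceImpact.act A (X t ω) := by
  rw [memH2_iff hT] at *
  exact ⟨hX.1.act A, hX.2.act A⟩

lemma MemH2.sqInt (hT : 0 < T) {X : Proc T Ω d} (hX : MemH2 P F X) : SqInt P X :=
  ((memH2_iff hT).1 hX).2

lemma MemHInfty.memH2 (hT : 0 < T) {X : Proc T Ω d} (hX : MemHInfty P F X) : MemH2 P F X := by
  rw [memH2_iff hT]
  obtain ⟨ho, C, hC⟩ := hX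
  have hm := ho.measurable_swap hT
  exact ⟨ho, .of_bound hm ((Measure.ae_prod_iff_ae_ae (measurableSet_le hm.norm
    measurable_const)).2 hC)⟩

lemma MemHInfty.add {X Y : Proc T Ω d} (hX : MemHInfty P F X) (hY : MemHInfty P F Y) :
    MemHInfty P F fun t ω => X t ω + Y t ω := by
  obtain ⟨hX, C, hC⟩ := hX
  obtain ⟨hY, D, hD⟩ := hY
  refine ⟨hX.add hY, C + D, ?_⟩
  filter_upwards [hC, hD] with ω h1 h2
  filter_upwards [h1, h2] with t h3 h4
  exact (norm_add_le _ _).trans (add_le_add h3 h4)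

lemma MemHInfty.act {X : Proc T Ω d} (hX : MemHInfty P F X) (A : Matrix (Fin d) (Fin d) ℝ) :
    MemHInfty P F fun t ω => PriceImpact.act A (X t ω) := by
  obtain ⟨hX, C, hC⟩ := hX
  let L := LinearMap.toContinuousLinearMap (Matrix.toEuclideanLin A)
  refine ⟨hX.act A, ‖L‖ * C, ?_⟩
  filter_upwards [hC] with ω h1
  filter_upwards [h1] with t h2
  exact (L.le_opNorm _).trans (mul_le_mul_of_nonneg_left h2 (norm_nonneg _))

lemma MemHInfty.const_smul {X : Proc T Ω d} (hX : MemHInfty P F X) (c : ℝ) :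
    MemHInfty P F fun t ω => c • X t ω := by
  obtain ⟨hX, C, hC⟩ := hX
  refine ⟨hX.const_smul c, ‖c‖ * C, ?_⟩
  filter_upwards [hC] with ω h1
  filter_upwards [h1] with t h2
  rw [norm_smul]
  exact mul_le_mul_of_nonneg_left h2 (norm_nonneg _)

lemma MemHInfty.sub {X Y : Proc T Ω d} (hX : MemHInfty P F X) (hY : MemHInfty P F Y) :
    MemHInfty P F fun t ω => X t ω - Y t ω := by
  simpa [sub_eq_add_neg] using hX.add (hY.const_smul (-1))

lemma norm_weight_le (r : ℝ) : ∃ K, ∀ t : Horizon T, ‖Real.exp (-r * (t : ℝ))‖ ≤ K := by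
  obtain ⟨C, hC⟩ := isCompact_univ.exists_bound_of_continuousOn
    (f := fun t : Horizon T => Real.exp (-r * (t : ℝ))) (by fun_prop)
  exact ⟨C, fun t => hC t (Set.mem_univ t)⟩

lemma JointInt.weight {f : Horizon T → Ω → ℝ} (hf : JointInt P f) (r : ℝ) :
    JointInt P fun t ω => Real.exp (-r * (t : ℝ)) * f t ω := by
  obtain ⟨K, hK⟩ := norm_weight_le (T := T) r
  refine Integrable.bdd_mul (c := K) hf ?_ (Eventually.of_forall fun p => hK p.2)
  exact (by fun_prop : Measurable fun p : Ω × Horizon T =>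
    Real.exp (-r * (p.2 : ℝ))).aestronglyMeasurable

lemma JointInt.add {f g : Horizon T → Ω → ℝ} (hf : JointInt P f) (hg : JointInt P g) :
    JointInt P fun t ω => f t ω + g t ω :=
  Integrable.add hf hg

lemma JointInt.sub {f g : Horizon T → Ω → ℝ} (hf : JointInt P f) (hg : JointInt P g) :
    JointInt P fun t ω => f t ω - g t ω :=
  Integrable.sub hf hg

lemma JointInt.const_mul {f : Horizon T → Ω → ℝ} (hf : JointInt P f) (c : ℝ) :
    JointInt P fun t ω => c * f t ω :=
  Integrable.const_mul hf c

lemma discounted_add {f g : Horizon T → Ω → ℝ} (hf : JointInt P f) (hg : JointInt P g) (r : ℝ) :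
    discounted P r (fun t ω => f t ω + g t ω) = discounted P r f + discounted P r g := by
  simp only [discounted, mul_add]
  exact integral_add (hf.weight r) (hg.weight r)

lemma discounted_sub {f g : Horizon T → Ω → ℝ} (hf : JointInt P f) (hg : JointInt P g) (r : ℝ) :
    discounted P r (fun t ω => f t ω - g t ω) = discounted P r f - discounted P r g := by
  simp only [discounted, mul_sub]
  exact integral_sub (hf.weight r) (hg.weight r)

lemma discounted_const_mul (f : Horizon T → Ω → ℝ) (c r : ℝ) :
    discounted P r (fun t ω => c * f t ω) = c * discounted P r f := by
  simp only [discounted, mul_left_comm _ c]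
  exact integral_const_mul _ _

lemma discounted_congr {f g : Horizon T → Ω → ℝ} (h : JointEq P f g) (r : ℝ) :
    discounted P r f = discounted P r g := by
  refine integral_congr_ae ?_
  filter_upwards [h] with p hp
  rw [hp]

lemma discounted_nonneg {f : Horizon T → Ω → ℝ} (h : ∀ t ω, 0 ≤ f t ω) (r : ℝ) :
    0 ≤ discounted P r f :=
  integral_nonneg fun _ => mul_nonneg (Real.exp_pos _).le (h _ _)

lemma discounted_eq_integral {f : Horizon T → Ω → ℝ} (hf : JointInt P f) (r : ℝ) :
    discounted P r f = ∫ ω, ∫ t : Horizon T, Real.exp (-r * (t : ℝ)) * f t ω ∂leb T ∂P :=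
  integral_prod _ (hf.weight r)

lemma discounted_eq_zero_iff {X : Proc T Ω d} (hX : SqInt P X) (r : ℝ) :
    discounted P r (fun t ω => inner ℝ (X t ω) (X t ω)) = 0 ↔ JointEq P X fun _ _ => 0 := by
  have h := (hX.inner hX).weight r
  rw [discounted, integral_eq_zero_iff_of_nonneg
    (fun p => mul_nonneg (Real.exp_pos _).le real_inner_self_nonneg) h]
  refine eventually_congr (Eventually.of_forall fun p => ?_)
  simp [(Real.exp_pos _).ne']

lemma measurable_cumulative (hT : 0 < T) {X : Proc T Ω d} (hX : IsOptional F X) :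
    Measurable fun p : Ω × Horizon T => cumulative X p.2 p.1 := by
  have hm := hX.measurable_swap hT
  have h1 : Measurable fun q : (Ω × Horizon T) × Horizon T =>
      {q : (Ω × Horizon T) × Horizon T | q.2 ≤ q.1.2}.indicator
        (fun q => X q.2 q.1.1) q := by
    refine Measurable.indicator ?_ (measurableSet_le measurable_snd
      (measurable_snd.comp measurable_fst))
    exact hm.comp ((measurable_fst.comp measurable_fst).prodMk measurable_snd)
  have h2 := (h1.stronglyMeasurable.integral_prod_right' (ν := leb T)).measurable
  have h3 : (fun p : Ω × Horizon T => cumulative X p.2 p.1) = fun p => ∫ s,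
      {q : (Ω × Horizon T) × Horizon T | q.2 ≤ q.1.2}.indicator
        (fun q => X q.2 q.1.1) (p, s) ∂leb T := by
    ext1 p
    simp only [cumulative]
    rw [← integral_indicator measurableSet_Iic]
    rfl
  rw [h3]
  exact h2

/-- Cauchy-Schwarz against the constant `1`; it makes time integration bounded in L². -/
lemma enorm_cumulative_sq_le {X : Proc T Ω d} {ω : Ω}
    (hm : AEMeasurable (fun t => ‖X t ω‖ₑ) (leb T)) (t : Horizon T) :
    ‖cumulative X t ω‖ₑ ^ 2 ≤ leb T Set.univ * ∫⁻ s, ‖X s ω‖ₑ ^ 2 ∂leb T := by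
  have h1 : ‖cumulative X t ω‖ₑ ≤ ∫⁻ s, ‖X s ω‖ₑ ∂leb T :=
    (enorm_integral_le_lintegral_enorm _).trans (setLIntegral_le_lintegral _ _)
  have h2 := ENNReal.lintegral_mul_le_Lp_mul_Lq (leb T) (p := 2) (q := 2)
    Real.HolderConjugate.two_two hm (aemeasurable_const (b := (1 : ENNReal)))
  simp only [Pi.mul_apply, mul_one, ENNReal.one_rpow, lintegral_const, one_mul] at h2
  have h3 := pow_le_pow_left' (h1.trans h2) 2
  refine h3.trans_eq ?_
  rw [mul_pow, ← ENNReal.rpow_natCast, ← ENNReal.rpow_natCast, ← ENNReal.rpow_mul,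
    ← ENNReal.rpow_mul]
  norm_num
  rw [mul_comm]

lemma SqInt.cumulative (hT : 0 < T) {X : Proc T Ω d} (hX : IsOptional F X) (h : SqInt P X) :
    SqInt P (PriceImpact.cumulative X) := by
  have hm := hX.measurable_swap hT
  have hmc := measurable_cumulative hT hX
  have hfin := ((memH2_iff (P := P) hT).2 ⟨hX, h⟩).2
  refine ⟨hmc.aestronglyMeasurable, ?_⟩
  rw [eLpNorm_lt_top_iff_lintegral_rpow_enorm_lt_top two_ne_zero ENNReal.ofNat_ne_top]
  have hmono : ∫⁻ p : Ω × Horizon T, ‖PriceImpact.cumulative X p.2 p.1‖ₑ ^ 2 ∂P.prod (leb T) ≤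
      ∫⁻ p : Ω × Horizon T, leb T Set.univ * ∫⁻ s, ‖X s p.1‖ₑ ^ 2 ∂leb T ∂P.prod (leb T) :=
    lintegral_mono fun p => enorm_cumulative_sq_le
      (hm.comp (measurable_prodMk_left (x := p.1))).enorm.aemeasurable p.2
  have hin : Measurable fun ω => ∫⁻ s, ‖X s ω‖ₑ ^ 2 ∂leb T :=
    (hm.enorm.pow_const 2).lintegral_prod_right'
  have heq : ∫⁻ p : Ω × Horizon T, leb T Set.univ * ∫⁻ s, ‖X s p.1‖ₑ ^ 2 ∂leb T ∂P.prod (leb T) =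
      leb T Set.univ * ((∫⁻ ω, ∫⁻ s, ‖X s ω‖ₑ ^ 2 ∂leb T ∂P) * leb T Set.univ) := by
    have hin' : Measurable fun p : Ω × Horizon T => ∫⁻ s, ‖X s p.1‖ₑ ^ 2 ∂leb T :=
      hin.comp measurable_fst
    rw [lintegral_const_mul _ hin', lintegral_prod _ hin'.aemeasurable]
    simp only [lintegral_const]
    rw [lintegral_mul_const _ hin]
  have hlt : leb T Set.univ * ((∫⁻ ω, ∫⁻ s, ‖X s ω‖ₑ ^ 2 ∂leb T ∂P) * leb T Set.univ) < ⊤ :=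
    ENNReal.mul_lt_top (measure_lt_top _ _) (ENNReal.mul_lt_top hfin (measure_lt_top _ _))
  have := (hmono.trans_eq heq).trans_lt hlt
  simpa using this

end SquareIntegrable

end PriceImpact

end

/-! ### Bounded continuous martingales, the adjoint of time integration and the martingale part of
class `𝒜`. -/

noncomputable section

namespace PriceImpact

section Martingales

set_option linter.unusedSectionVars false

variable {Ω : Type*} {mΩ : MeasurableSpace Ω} {T : ℝ} {d : ℕ} {P : Measure Ω}
  [IsProbabilityMeasure P] {F : Filtration (Horizon T) mΩ}

/-- Bounded real martingales with continuous paths. -/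
structure IsContMartingale (P : Measure Ω) (F : Filtration (Horizon T) mΩ)
    (N : Horizon T → Ω → ℝ) : Prop where
  adapted : Adapted F N
  continuous_paths : ∀ ω, Continuous fun t => N t ω
  condExp_eq : ∀ s t, s ≤ t → P[N t | F s] =ᵐ[P] N s
  bounded : ∃ C, ∀ᵐ ω ∂P, ∀ t, ‖N t ω‖ ≤ C

lemma IsContinuousVersion.isContMartingale {M : Horizon T → Ω → ℝ} {ξ : Ω → ℝ}
    (h : IsContinuousVersion P F M ξ) {C : ℝ} (hC : ∀ t ω, ‖M t ω‖ ≤ C) :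
    IsContMartingale P F M :=
  ⟨h.adapted, h.continuous_paths, fun _ _ hst => h.condExp_eq hst,
    C, Eventually.of_forall fun ω t => hC t ω⟩

namespace IsContMartingale

variable {N : Horizon T → Ω → ℝ}

lemma measurable (h : IsContMartingale P F N) (t : Horizon T) : Measurable (N t) :=
  (h.adapted t).mono (F.le t) le_rfl

lemma integrable (h : IsContMartingale P F N) (t : Horizon T) : Integrable (N t) P := by
  obtain ⟨C, hC⟩ := h.bounded
  exact Integrable.of_bound (h.measurable t).aestronglyMeasurable C (hC.mono fun ω h => h t)

lemma measurable_joint (hT : 0 < T) (h : IsContMartingale P F N) :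
    Measurable fun p : Ω × Horizon T => N p.2 p.1 :=
  ((optional_of_continuous h.adapted h.continuous_paths).mono (optionalSigma_le hT) le_rfl).comp
    measurable_swap

lemma setIntegral_eq (h : IsContMartingale P F N) {s t : Horizon T} (hst : s ≤ t) {A : Set Ω}
    (hA : MeasurableSet[F s] A) : ∫ ω in A, N t ω ∂P = ∫ ω in A, N s ω ∂P := by
  rw [← setIntegral_condExp (F.le s) (h.integrable t) hA]
  exact setIntegral_congr_ae (F.le s A hA) ((h.condExp_eq s t hst).mono fun ω hω _ => hω)

lemma of_setIntegral (hN : Adapted F N) (hc : ∀ ω, Continuous fun t => N t ω) {C : ℝ}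
    (hC : ∀ᵐ ω ∂P, ∀ t, ‖N t ω‖ ≤ C)
    (h : ∀ s t, s ≤ t → ∀ A, MeasurableSet[F s] A → ∫ ω in A, N t ω ∂P = ∫ ω in A, N s ω ∂P) :
    IsContMartingale P F N := by
  have hi : ∀ t, Integrable (N t) P := fun t =>
    Integrable.of_bound ((hN t).mono (F.le t) le_rfl).aestronglyMeasurable C
      (hC.mono fun ω h => h t)
  refine ⟨hN, hc, fun s t hst => ?_, C, hC⟩
  exact (ae_eq_condExp_of_forall_setIntegral_eq (F.le s) (hi t) (fun _ _ _ => (hi s).integrableOn)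
    (fun A hA _ => (h s t hst A hA).symm) (hN s).stronglyMeasurable.aestronglyMeasurable).symm

/-- The integral of a smooth deterministic weight against a continuous martingale, written by
means of integration by parts, is a martingale. -/
lemma weighted (hT : 0 < T) (h : IsContMartingale P F N) {k k' : ℝ → ℝ}
    (hk : ∀ x, HasDerivAt k (k' x) x) (hk' : Continuous k') :
    IsContMartingale P F fun t ω =>
      k t * N t ω - primitive (fun s : Horizon T => k' s * N s ω) t := by
  have hkc : Continuous k := continuous_iff_continuousAt.2 fun x => (hk x).continuousAt
  have hopt := optional_of_continuous h.adapted h.continuous_paths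
  have hprodc : ∀ ω, Continuous fun s : Horizon T => k' s * N s ω := fun ω =>
    (hk'.comp continuous_subtype_val).mul (h.continuous_paths ω)
  have hprodi : ∀ ω, Integrable (fun s : Horizon T => k' s * N s ω) (leb T) := fun ω =>
    integrable_of_continuous (hprodc ω)
  obtain ⟨C, hC⟩ := h.bounded
  obtain ⟨K, hK⟩ := isCompact_univ.exists_bound_of_continuousOn
    (f := fun t : Horizon T => k t) (hkc.comp continuous_subtype_val).continuousOn
  obtain ⟨K', hK'⟩ := isCompact_univ.exists_bound_of_continuousOn
    (f := fun t : Horizon T => k' t) (hk'.comp continuous_subtype_val).continuousOn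
  have hK0 : 0 ≤ K := (norm_nonneg _).trans (hK (finalTime hT) (Set.mem_univ _))
  have hK0' : 0 ≤ K' := (norm_nonneg _).trans (hK' (finalTime hT) (Set.mem_univ _))
  have hprodb : ∀ᵐ ω ∂P, ∀ s : Horizon T, ‖k' s * N s ω‖ ≤ K' * C := by
    filter_upwards [hC] with ω hω s
    rw [norm_mul]
    exact mul_le_mul (hK' s (Set.mem_univ _)) (hω s) (norm_nonneg _) hK0'
  have hprimm : ∀ t, Measurable[F t] fun ω => primitive (fun s : Horizon T => k' s * N s ω) t :=
    fun t => measurable_primitive_of_optional (f := fun p : Horizon T × Ω => k' p.1 * N p.1 p.2)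
      ((hk'.measurable.comp (measurable_subtype_coe.comp measurable_time_optional)).mul hopt) t
  refine of_setIntegral (C := K * C + K' * C * (leb T).real Set.univ) (fun t => ?_) (fun ω => ?_)
    ?_ ?_
  · exact ((h.adapted t).const_mul _).sub (hprimm t)
  · exact ((hkc.comp continuous_subtype_val).mul (h.continuous_paths ω)).sub
      (continuous_primitive hT (hprodi ω))
  · filter_upwards [hC, hprodb] with ω h1 h2 t
    refine (norm_sub_le _ _).trans (add_le_add ?_ (norm_primitive_le h2 t))
    rw [norm_mul]
    exact mul_le_mul (hK t (Set.mem_univ _)) (h1 t) (norm_nonneg _) hK0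
  · intro s t hst A hA
    have hAm := F.le s A hA
    have hprimi : ∀ t, Integrable (fun ω => primitive (fun s : Horizon T => k' s * N s ω) t) P :=
      fun t => Integrable.of_bound ((hprimm t).mono (F.le t) le_rfl).aestronglyMeasurable
        (K' * C * (leb T).real Set.univ) (hprodb.mono fun ω h2 => norm_primitive_le h2 t)
    have hjoint : Integrable (fun p : Ω × Horizon T => k' p.2 * N p.2 p.1)
        ((P.restrict A).prod ((leb T).restrict (Set.Ioc s t))) := by
      have hm : Measurable fun p : Ω × Horizon T => k' p.2 * N p.2 p.1 :=
        (hk'.measurable.comp (measurable_subtype_coe.comp measurable_snd)).mul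
          (h.measurable_joint hT)
      have hfull : Integrable (fun p : Ω × Horizon T => k' p.2 * N p.2 p.1) (P.prod (leb T)) :=
        Integrable.of_bound hm.aestronglyMeasurable (K' * C)
          ((Measure.ae_prod_iff_ae_ae (measurableSet_le hm.norm measurable_const)).2
            (hprodb.mono fun ω h2 => Eventually.of_forall h2))
      rw [Measure.prod_restrict]
      exact hfull.mono_measure Measure.restrict_le_self
    -- After exchanging the integrals, the martingale property replaces `N v` by `N s` on the event
    -- `A`, and only the increment of `k` remains.
    have hfub : ∫ ω in A, (∫ v in Set.Ioc s t, k' v * N v ω ∂leb T) ∂P =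
        (k t - k s) * ∫ ω in A, N s ω ∂P := by
      rw [integral_integral_swap hjoint]
      have : ∀ v ∈ Set.Ioc s t, ∫ ω in A, k' v * N v ω ∂P = k' v * ∫ ω in A, N s ω ∂P := by
        intro v hv
        rw [integral_const_mul, h.setIntegral_eq hv.1.le hA]
      rw [setIntegral_congr_fun measurableSet_Ioc this, integral_mul_const,
        setIntegral_Ioc_eq_primitive_sub (f := fun v : Horizon T => k' v)
          (integrable_of_continuous (hk'.comp continuous_subtype_val)) hst,
        primitive_deriv hk hk', primitive_deriv hk hk']
      ring
    have hdiff : ∫ ω in A, (primitive (fun s : Horizon T => k' s * N s ω) t -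
        primitive (fun s : Horizon T => k' s * N s ω) s) ∂P =
        (k t - k s) * ∫ ω in A, N s ω ∂P := by
      rw [← hfub]
      refine integral_congr_ae (Eventually.of_forall fun ω => ?_)
      exact (setIntegral_Ioc_eq_primitive_sub (hprodi ω) hst).symm
    rw [integral_sub (hprimi t).integrableOn (hprimi s).integrableOn] at hdiff
    have it := (h.integrable t).const_mul (k t)
    have is := (h.integrable s).const_mul (k s)
    rw [integral_sub it.integrableOn (hprimi t).integrableOn,
      integral_sub is.integrableOn (hprimi s).integrableOn, integral_const_mul, integral_const_mul,
      h.setIntegral_eq hst hA]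
    linarith

/-- Taking out what is known at time `t`. It is applied below separately at almost every time. -/
lemma integral_mul_increment (hT : 0 < T) (h : IsContMartingale P F N) {t : Horizon T} {ξ : Ω → ℝ}
    (hξ : Measurable[F t] ξ) (hi : Integrable ξ P) :
    ∫ ω, ξ ω * (N (finalTime hT) ω - N t ω) ∂P = 0 := by
  obtain ⟨C, hC⟩ := h.bounded
  have hb : ∀ s, Integrable (fun ω => ξ ω * N s ω) P := fun s =>
    hi.mul_bdd (c := C) (h.measurable s).aestronglyMeasurable (hC.mono fun ω h => h s)
  have h1 := condExp_mul_of_stronglyMeasurable_left (μ := P) hξ.stronglyMeasurable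
    (hb (finalTime hT)) (h.integrable _)
  have h2 : ∫ ω, ξ ω * N (finalTime hT) ω ∂P = ∫ ω, ξ ω * N t ω ∂P := by
    rw [← integral_condExp (F.le t)]
    refine integral_congr_ae ?_
    filter_upwards [h1, h.condExp_eq t _ (le_finalTime hT t)] with ω e1 e2
    have e1' : P[fun ω => ξ ω * N (finalTime hT) ω | F t] ω =
        ξ ω * P[N (finalTime hT) | F t] ω := e1
    rw [e1', e2]
  simp only [mul_sub]
  rw [integral_sub (hb _) (hb _), h2, sub_self]

/-- Future increments of a martingale are orthogonal to optional processes. -/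
lemma orthogonal (hT : 0 < T) (h : IsContMartingale P F N) {η : Horizon T → Ω → ℝ}
    (hη : Measurable[optionalSigma F] fun p : Horizon T × Ω => η p.1 p.2) (hi : JointInt P η) :
    JointInt P (fun t ω => η t ω * (N (finalTime hT) ω - N t ω)) ∧
    ∫ p : Ω × Horizon T, η p.2 p.1 * (N (finalTime hT) p.1 - N p.2 p.1) ∂P.prod (leb T) = 0 := by
  obtain ⟨C, hC⟩ := h.bounded
  have hm : Measurable fun p : Ω × Horizon T => N (finalTime hT) p.1 - N p.2 p.1 :=
    ((h.measurable _).comp measurable_fst).sub (h.measurable_joint hT)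
  have hint : JointInt P (fun t ω => η t ω * (N (finalTime hT) ω - N t ω)) := by
    refine Integrable.mul_bdd (c := C + C) hi hm.aestronglyMeasurable ?_
    refine (Measure.ae_prod_iff_ae_ae (measurableSet_le hm.norm measurable_const)).2 ?_
    filter_upwards [hC] with ω hω
    exact Eventually.of_forall fun t => (norm_sub_le _ _).trans (add_le_add (hω _) (hω _))
  refine ⟨hint, ?_⟩
  rw [integral_prod_symm _ hint]
  refine integral_eq_zero_of_ae ?_
  filter_upwards [Integrable.prod_left_ae hi] with t ht
  exact h.integral_mul_increment hT (measurable_section_of_optional hη t) ht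

end IsContMartingale

/-- Pathwise, the adjoint of integration over `[0,t]` is integration over `[t,T]`; each coordinate
is an integration by parts. -/
lemma integral_inner_primitive (hT : 0 < T) {g h : Horizon T → Vec d} (hg : Integrable g (leb T))
    (hh : Integrable h (leb T)) :
    ∫ s, inner ℝ (primitive g s) (h s) ∂leb T =
      ∫ s, inner ℝ (g s) (primitive h (finalTime hT) - primitive h s) ∂leb T := by
  have hco : ∀ {f : Horizon T → Vec d}, Integrable f (leb T) → ∀ (i : Fin d),
      Integrable (fun s => f s i) (leb T) := fun hf i =>
    (EuclideanSpace.proj (𝕜 := ℝ) i).integrable_comp hf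
  have hpc : ∀ {f : Horizon T → Vec d}, Integrable f (leb T) → ∀ (i : Fin d) t,
      primitive f t i = primitive (fun s => f s i) t := fun hf i t =>
    ((EuclideanSpace.proj (𝕜 := ℝ) i).integral_comp_comm hf.integrableOn).symm
  have i1 : ∀ i : Fin d, Integrable (fun s => primitive (fun s => g s i) s * h s i) (leb T) := by
    intro i
    simp_rw [mul_comm _ (h _ i)]
    exact integrable_mul_of_continuous (hco hh i) (continuous_primitive hT (hco hg i))
  have i2 : ∀ i : Fin d, Integrable (fun s => g s i * (primitive (fun s => h s i) (finalTime hT) -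
      primitive (fun s => h s i) s)) (leb T) := fun i =>
    integrable_mul_of_continuous (hco hg i)
      (continuous_const.sub (continuous_primitive hT (hco hh i)))
  have e1 : ∀ s, inner ℝ (primitive g s) (h s) = ∑ i, primitive (fun s => g s i) s * h s i := by
    intro s
    simp only [PiLp.inner_apply, RCLike.inner_apply, conj_trivial, hpc hg]
    exact Finset.sum_congr rfl fun i _ => mul_comm _ _
  have e2 : ∀ s, inner ℝ (g s) (primitive h (finalTime hT) - primitive h s) =
      ∑ i, g s i * (primitive (fun s => h s i) (finalTime hT) - primitive (fun s => h s i) s) := by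
    intro s
    simp only [PiLp.inner_apply, RCLike.inner_apply, conj_trivial, PiLp.sub_apply, hpc hh]
    exact Finset.sum_congr rfl fun i _ => mul_comm _ _
  simp only [e1, e2]
  rw [integral_finsetSum _ fun i _ => i1 i, integral_finsetSum _ fun i _ => i2 i]
  refine Finset.sum_congr rfl fun i _ => ?_
  have key := integral_mul_primitive_add (fun s => g s i) (fun s => h s i) (hco hg i) (hco hh i)
  have i3 := integrable_mul_of_continuous (hco hg i) (continuous_primitive hT (hco hh i))
  rw [integral_add i3 (i1 i)] at key
  simp only [mul_sub]
  rw [integral_sub ((hco hg i).mul_const _) i3, integral_mul_const, primitive_finalTime hT]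
  linarith

lemma MemHInfty.sqInt_total (hT : 0 < T) {β : Proc T Ω d} (hβ : MemHInfty P F β) :
    SqInt P fun (_ : Horizon T) ω => cumulative β (finalTime hT) ω := by
  have hm : Measurable fun p : Ω × Horizon T => cumulative β (finalTime hT) p.1 :=
    (measurable_cumulative hT hβ.1).comp
      (measurable_fst.prodMk (measurable_const (a := finalTime hT)))
  obtain ⟨C, hC⟩ := hβ.2
  refine SqInt.of_bound hm (C := C * (leb T).real Set.univ) ?_
  refine (Measure.ae_prod_iff_ae_ae (measurableSet_le hm.norm measurable_const)).2 ?_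
  filter_upwards [hC] with ω hω
  refine Eventually.of_forall fun t => ?_
  have : cumulative β (finalTime hT) ω = ∫ s, β s ω ∂leb T := primitive_finalTime hT _
  rw [this]
  exact norm_integral_le_of_norm_le_const hω

/-- The adjoint of time integration. -/
lemma integral_inner_cumulative (hT : 0 < T) {η β : Proc T Ω d} (hη : MemH2 P F η)
    (hβ : MemHInfty P F β) :
    ∫ p : Ω × Horizon T, inner ℝ (cumulative η p.2 p.1) (β p.2 p.1) ∂P.prod (leb T) =
      ∫ p : Ω × Horizon T, inner ℝ (η p.2 p.1)
        (cumulative β (finalTime hT) p.1 - cumulative β p.2 p.1) ∂P.prod (leb T) := by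
  have hβ2 := (hβ.memH2 hT).sqInt hT
  have hη2 := hη.sqInt hT
  have h1 : JointInt P fun t ω => inner ℝ (cumulative η t ω) (β t ω) :=
    (hη2.cumulative hT hη.1).inner hβ2
  have h2 : JointInt P fun t ω => inner ℝ (η t ω)
      (cumulative β (finalTime hT) ω - cumulative β t ω) :=
    hη2.inner ((hβ.sqInt_total hT).sub (hβ2.cumulative hT hβ.1))
  rw [integral_prod _ h1, integral_prod _ h2]
  refine integral_congr_ae ?_
  filter_upwards [hη2.ae_integrable, hβ2.ae_integrable] with ω i1 i2
  exact integral_inner_primitive hT i1 i2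

lemma forall_le_of_ae_le (hT : 0 < T) {f : Horizon T → ℝ} (hf : Continuous f) {C : ℝ}
    (h : ∀ᵐ t ∂leb T, f t ≤ C) (t : Horizon T) : f t ≤ C := by
  have := isOpenPosMeasure_leb hT
  by_contra hlt
  have ho : IsOpen {t | C < f t} := isOpen_lt continuous_const hf
  have h0 : leb T {t | C < f t} = 0 := by
    simpa only [not_le] using (ae_iff.1 h)
  have he := (ho.measure_eq_zero_iff (μ := leb T)).1 h0
  have : t ∈ {t | C < f t} := not_le.1 hlt
  rw [he] at this
  exact this

/-- Processes in `H^∞` have everywhere bounded representatives. -/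
lemma MemHInfty.exists_bounded {X : Proc T Ω d} (hX : MemHInfty P F X) :
    ∃ (Y : Proc T Ω d) (C : ℝ), IsOptional F Y ∧ (∀ t ω, ‖Y t ω‖ ≤ C) ∧ EqAE P X Y := by
  classical
  obtain ⟨ho, C, hC⟩ := hX
  refine ⟨fun t ω => if ‖X t ω‖ ≤ C then X t ω else 0, max C 0, ?_, fun t ω => ?_, ?_⟩
  · exact Measurable.ite (measurableSet_le (measurable_norm.comp ho) measurable_const) ho
      measurable_const
  · dsimp only
    split_ifs with h
    · exact h.trans (le_max_left _ _)
    · simp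
  · filter_upwards [hC] with ω h1
    filter_upwards [h1] with t h2
    rw [if_pos h2]

lemma memHInfty_of_bound {X : Proc T Ω d} (ho : IsOptional F X) {C : ℝ}
    (hC : ∀ t ω, ‖X t ω‖ ≤ C) : MemHInfty P F X :=
  ⟨ho, C, Eventually.of_forall fun ω => Eventually.of_forall fun t => hC t ω⟩

lemma integrable_of_isOptional_bound (hT : 0 < T) {X : Proc T Ω d} (ho : IsOptional F X) {C : ℝ}
    (hC : ∀ t ω, ‖X t ω‖ ≤ C) (ω : Ω) : Integrable (fun t => X t ω) (leb T) := by
  have hm : Measurable fun t => X t ω := (ho.measurable hT).comp (measurable_prodMk_right (y := ω))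
  exact Integrable.of_bound hm.aestronglyMeasurable C (Eventually.of_forall fun t => hC t ω)

lemma cumulative_coord {X : Proc T Ω d} {ω : Ω} (hi : Integrable (fun t => X t ω) (leb T))
    (t : Horizon T) (i : Fin d) : cumulative X t ω i = primitive (fun s => X s ω i) t :=
  ((EuclideanSpace.proj (𝕜 := ℝ) i).integral_comp_comm hi.integrableOn).symm

lemma condExp_coord {f : Ω → Vec d} (hf : Integrable f P) (m : MeasurableSpace Ω) (i : Fin d) :
    P[fun ω => f ω i | m] =ᵐ[P] fun ω => P[f | m] ω i :=
  ((EuclideanSpace.proj (𝕜 := ℝ) i).comp_condExp_comm hf (m := m)).symm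

lemma MemAWithDrift.measurable_section {X a : Proc T Ω d} (h : MemAWithDrift P F X a)
    (t : Horizon T) : Measurable[F t] (X t) :=
  measurable_section_of_optional h.bounded.1 t

lemma MemAWithDrift.ae_bounded (hT : 0 < T) {X a : Proc T Ω d} (h : MemAWithDrift P F X a) :
    ∃ C, ∀ᵐ ω ∂P, ∀ t, ‖X t ω‖ ≤ C := by
  obtain ⟨C, hC⟩ := h.bounded.2
  refine ⟨C, ?_⟩
  filter_upwards [hC] with ω hω
  exact forall_le_of_ae_le hT (h.continuous_paths ω).norm hω

/-- The martingale part of a process of class `𝒜`, with a bounded representative of the drift. -/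
lemma MemAWithDrift.exists_martingale (hT : 0 < T) {X a : Proc T Ω d}
    (h : MemAWithDrift P F X a) :
    ∃ (b : Proc T Ω d) (C : ℝ), IsOptional F b ∧ (∀ t ω, ‖b t ω‖ ≤ C) ∧ EqAE P a b ∧
      ∀ i, IsContMartingale P F fun t ω => X t ω i - cumulative b t ω i := by
  obtain ⟨b, C, hbo, hbC, hab⟩ := h.drift_bounded.exists_bounded
  obtain ⟨D, hD⟩ := h.ae_bounded hT
  obtain ⟨M, hM, hmart, hdec⟩ := h.decomposition
  have hbi := integrable_of_isOptional_bound hT hbo hbC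
  refine ⟨b, C, hbo, hbC, hab, fun i => ?_⟩
  have hcm : ∀ t, Measurable[F t] (cumulative b t) := fun t =>
    measurable_primitive_of_optional hbo t
  have hcc : ∀ ω, Continuous fun t => cumulative b t ω := fun ω => continuous_primitive hT (hbi ω)
  have hbd : ∀ᵐ ω ∂P, ∀ t, ‖X t ω i - cumulative b t ω i‖ ≤ D + C * (leb T).real Set.univ := by
    filter_upwards [hD] with ω hω t
    refine (norm_sub_le _ _).trans (add_le_add ((PiLp.norm_apply_le _ i).trans (hω t)) ?_)
    exact (PiLp.norm_apply_le _ i).trans (norm_primitive_le (fun s => hbC s ω) t)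
  have had : Adapted F fun t ω => X t ω i - cumulative b t ω i := fun t =>
    ((measurable_coord i).comp (h.measurable_section t)).sub ((measurable_coord i).comp (hcm t))
  have hint : ∀ t, Integrable (fun ω => X t ω i - cumulative b t ω i) P := fun t =>
    Integrable.of_bound ((had t).mono (F.le t) le_rfl).aestronglyMeasurable _
      (hbd.mono fun ω h => h t)
  refine ⟨had, fun ω => ?_, fun s t hst => ?_, _, hbd⟩
  · exact ((EuclideanSpace.proj (𝕜 := ℝ) i).continuous.comp (h.continuous_paths ω)).sub
      ((EuclideanSpace.proj (𝕜 := ℝ) i).continuous.comp (hcc ω))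
  · have hMi : ∀ t, Integrable (M t) P := fun t => hmart.integrable t
    have hMci : ∀ t, Integrable (fun ω => M t ω i) P := fun t =>
      (EuclideanSpace.proj (𝕜 := ℝ) i).integrable_comp (hMi t)
    -- Up to null sets `X - ∫ b` has the increments of `M`, which gives the martingale property.
    -- Continuity comes from `X` and not from `M`, whose paths may be irregular.
    have e1 : (fun ω => X t ω i - cumulative b t ω i) =ᵐ[P]
        (fun ω => X s ω i - cumulative b s ω i) + ((fun ω => M t ω i) - fun ω => M s ω i) := by
      filter_upwards [hdec, hab] with ω h1 h2
      have h3 := h1 s t hst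
      rw [integral_congr_ae (ae_restrict_of_ae h2)] at h3
      have h4 : ∫ u in Set.Ioc s t, b u ω ∂leb T = cumulative b t ω - cumulative b s ω :=
        setIntegral_Ioc_eq_primitive_sub (hbi ω) hst
      rw [h4] at h3
      have h5 := congrArg (fun v : Vec d => v i) h3
      simp only [PiLp.sub_apply, PiLp.add_apply] at h5
      simp only [Pi.add_apply, Pi.sub_apply]
      linarith
    have e2 : P[fun ω => M t ω i | F s] =ᵐ[P] fun ω => M s ω i := by
      filter_upwards [condExp_coord (hMi t) (F s) i, hmart.2 s t hst] with ω h1 h2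
      rw [h1, h2]
    have e3 : P[fun ω => M s ω i | F s] = fun ω => M s ω i :=
      condExp_of_stronglyMeasurable (F.le s)
        ((measurable_coord i).comp (hmart.1 s).measurable).stronglyMeasurable (hMci s)
    have e4 : P[fun ω => X s ω i - cumulative b s ω i | F s] =
        fun ω => X s ω i - cumulative b s ω i :=
      condExp_of_stronglyMeasurable (F.le s) (had s).stronglyMeasurable (hint s)
    have e5 := condExp_add (hint s) ((hMci t).sub (hMci s)) (F s)
    have e6 := condExp_sub (hMci t) (hMci s) (F s)
    filter_upwards [condExp_congr_ae (m := F s) e1, e2, e5, e6] with ω h1 h2 h5 h6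
    rw [h1, h5, Pi.add_apply, h6, Pi.sub_apply, h2, e3, e4]
    ring

/-- A criterion for membership in `𝒜`. -/
lemma MemAWithDrift.of_martingale (hT : 0 < T) {X b : Proc T Ω d} {C D : ℝ}
    (hXm : ∀ t, Measurable[F t] (X t)) (hXc : ∀ ω, Continuous fun t => X t ω)
    (hXb : ∀ t ω, ‖X t ω‖ ≤ D) (hXT : ∀ᵐ ω ∂P, X (finalTime hT) ω = 0)
    (hbo : IsOptional F b) (hbC : ∀ t ω, ‖b t ω‖ ≤ C)
    (hM : ∀ i, IsContMartingale P F fun t ω => X t ω i - cumulative b t ω i) :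
    MemAWithDrift P F X b := by
  have hbi := integrable_of_isOptional_bound hT hbo hbC
  have hcm : ∀ t, Measurable[F t] (cumulative b t) := fun t =>
    measurable_primitive_of_optional hbo t
  have hcc : ∀ ω, Continuous fun t => cumulative b t ω := fun ω => continuous_primitive hT (hbi ω)
  have hMb : ∀ t ω, ‖X t ω - cumulative b t ω‖ ≤ D + C * (leb T).real Set.univ := fun t ω =>
    (norm_sub_le _ _).trans (add_le_add (hXb t ω) (norm_primitive_le (fun s => hbC s ω) t))
  have hMm : ∀ t, Measurable[F t] fun ω => X t ω - cumulative b t ω := fun t =>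
    (hXm t).sub (hcm t)
  have hMi : ∀ t, Integrable (fun ω => X t ω - cumulative b t ω) P := fun t =>
    Integrable.of_bound ((hMm t).mono (F.le t) le_rfl).aestronglyMeasurable _
      (Eventually.of_forall fun ω => hMb t ω)
  refine ⟨memHInfty_of_bound (isOptional_of_continuous hXm hXc) hXb, hXc, ?_,
    memHInfty_of_bound hbo hbC, fun t ω => X t ω - cumulative b t ω, ?_, ?_, ?_⟩
  · filter_upwards [hXT] with ω hω t ht
    have : t = finalTime hT := Subtype.ext ht
    rw [this, hω]
  · exact memHInfty_of_bound (isOptional_of_continuous hMm fun ω => (hXc ω).sub (hcc ω)) hMb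
  · refine ⟨fun t => (hMm t).stronglyMeasurable, fun s t hst => ?_⟩
    have h1 : ∀ᵐ ω ∂P, ∀ i, P[fun ω => X t ω - cumulative b t ω | F s] ω i =
        X s ω i - cumulative b s ω i := by
      refine ae_all_iff.2 fun i => ?_
      filter_upwards [condExp_coord (hMi t) (F s) i, (hM i).condExp_eq s t hst] with ω e1 e2
      rw [← e1]
      exact e2
    filter_upwards [h1] with ω hω
    ext i
    simpa using hω i
  · refine Eventually.of_forall fun ω s t hst => ?_
    have h4 : ∫ u in Set.Ioc s t, b u ω ∂leb T = cumulative b t ω - cumulative b s ω :=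
      setIntegral_Ioc_eq_primitive_sub (hbi ω) hst
    rw [h4]
    ext i
    simp only [PiLp.add_apply, PiLp.sub_apply]
    ring

end Martingales

end PriceImpact

end

/-! ### Integration by parts for class `𝒜` and the variational lemma. -/

noncomputable section

namespace PriceImpact

section ClassA

set_option linter.unusedSectionVars false

variable {Ω : Type*} {mΩ : MeasurableSpace Ω} {T : ℝ} {d : ℕ} {P : Measure Ω}
  [IsProbabilityMeasure P] {F : Filtration (Horizon T) mΩ}

lemma MemHInfty.discount {X : Proc T Ω d} (hX : MemHInfty P F X) (r : ℝ) :
    MemHInfty P F fun t ω => Real.exp (-r * (t : ℝ)) • X t ω := by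
  obtain ⟨ho, C, hC⟩ := hX
  obtain ⟨K, hK⟩ := norm_weight_le (T := T) r
  refine ⟨ho.weight (w := fun t : Horizon T => Real.exp (-r * (t : ℝ))) (by fun_prop),
    K * C, ?_⟩
  filter_upwards [hC] with ω h1
  filter_upwards [h1] with t h2
  rw [norm_smul]
  exact mul_le_mul (hK t) h2 (norm_nonneg _) ((norm_nonneg _).trans (hK t))

lemma MemHInfty.ae_integrable (hT : 0 < T) {X : Proc T Ω d} (hX : MemHInfty P F X) :
    ∀ᵐ ω ∂P, Integrable (fun t => X t ω) (leb T) :=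
  ((hX.memH2 hT).sqInt hT).ae_integrable

lemma MemAWithDrift.add (hT : 0 < T) {X Y a b : Proc T Ω d} (hX : MemAWithDrift P F X a)
    (hY : MemAWithDrift P F Y b) :
    MemAWithDrift P F (fun t ω => X t ω + Y t ω) (fun t ω => a t ω + b t ω) := by
  refine ⟨hX.bounded.add hY.bounded, fun ω => (hX.continuous_paths ω).add (hY.continuous_paths ω),
    ?_, hX.drift_bounded.add hY.drift_bounded, ?_⟩
  · filter_upwards [hX.terminal, hY.terminal] with ω h1 h2 t ht
    rw [h1 t ht, h2 t ht, add_zero]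
  · obtain ⟨M, hM, hMm, hMd⟩ := hX.decomposition
    obtain ⟨N, hN, hNm, hNd⟩ := hY.decomposition
    refine ⟨fun t ω => M t ω + N t ω, hM.add hN, hMm.add hNm, ?_⟩
    filter_upwards [hMd, hNd, hX.drift_bounded.ae_integrable hT,
      hY.drift_bounded.ae_integrable hT] with ω h1 h2 i1 i2 s t hst
    rw [integral_add i1.integrableOn i2.integrableOn]
    have e1 := h1 s t hst
    have e2 := h2 s t hst
    rw [add_sub_add_comm, e1, e2, add_sub_add_comm, add_add_add_comm]

lemma MemAWithDrift.act {X a : Proc T Ω d} (hT : 0 < T) (hX : MemAWithDrift P F X a)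
    (A : Matrix (Fin d) (Fin d) ℝ) :
    MemAWithDrift P F (fun t ω => PriceImpact.act A (X t ω))
      (fun t ω => PriceImpact.act A (a t ω)) := by
  let L := LinearMap.toContinuousLinearMap (Matrix.toEuclideanLin A)
  refine ⟨hX.bounded.act A, fun ω => L.continuous.comp (hX.continuous_paths ω), ?_,
    hX.drift_bounded.act A, ?_⟩
  · filter_upwards [hX.terminal] with ω h1 t ht
    rw [h1 t ht]
    exact map_zero L
  · obtain ⟨M, hM, hMm, hMd⟩ := hX.decomposition
    refine ⟨fun t ω => PriceImpact.act A (M t ω), hM.act A, ⟨fun t => ?_, fun s t hst => ?_⟩, ?_⟩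
    · exact L.continuous.comp_stronglyMeasurable (hMm.1 t)
    · have h1 := L.comp_condExp_comm (hMm.integrable t) (m := F s)
      filter_upwards [h1, hMm.2 s t hst] with ω e1 e2
      have e3 : L (P[M t | F s] ω) = P[fun ω => PriceImpact.act A (M t ω) | F s] ω := e1
      rw [← e3, e2]
      rfl
    · filter_upwards [hMd, hX.drift_bounded.ae_integrable hT] with ω h1 i1 s t hst
      have e1 := congrArg L (h1 s t hst)
      rw [map_sub, map_add, map_sub, ← L.integral_comp_comm i1.integrableOn] at e1
      exact e1

lemma act_smul_one (c : ℝ) (x : Vec d) : act (c • (1 : Matrix (Fin d) (Fin d) ℝ)) x = c • x := by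
  ext i
  simp [act]

lemma MemAWithDrift.const_smul {X a : Proc T Ω d} (hT : 0 < T) (hX : MemAWithDrift P F X a)
    (c : ℝ) : MemAWithDrift P F (fun t ω => c • X t ω) (fun t ω => c • a t ω) := by
  simpa only [act_smul_one] using hX.act hT (c • (1 : Matrix (Fin d) (Fin d) ℝ))

lemma hasDerivAt_exp_neg_mul (r x : ℝ) :
    HasDerivAt (fun x => Real.exp (-r * x)) (-r * Real.exp (-r * x)) x := by
  have h := ((hasDerivAt_id x).const_mul (-r)).exp
  simpa [mul_comm] using h

lemma MemAWithDrift.memH2 (hT : 0 < T) {X a : Proc T Ω d} (hX : MemAWithDrift P F X a) :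
    MemH2 P F X :=
  hX.bounded.memH2 hT

/-- Integration by parts for the discounted inner product of a demand with a process of
class `𝒜`. -/
theorem discounted_cumulative_drift (hT : 0 < T) {θ a η : Proc T Ω d}
    (hθ : MemAWithDrift P F θ a) (hη : MemH2 P F η) (r : ℝ) :
    discounted P r (fun t ω => inner ℝ (cumulative η t ω) (a t ω - r • θ t ω)) =
      -discounted P r (fun t ω => inner ℝ (η t ω) (θ t ω)) := by
  obtain ⟨b, C, hbo, hbC, hab, hN⟩ := hθ.exists_martingale hT
  have hbi := integrable_of_isOptional_bound hT hbo hbC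
  have hbH : MemHInfty P F b := memHInfty_of_bound hbo hbC
  -- The drift of the discounted process e^{-rt}θ. The bounded representative `b` makes every path
  -- integrable, not only almost every one.
  let β : Proc T Ω d := fun t ω => Real.exp (-r * (t : ℝ)) • (b t ω - r • θ t ω)
  have hβ : MemHInfty P F β := (hbH.sub (hθ.bounded.const_smul r)).discount r
  have hη2 := hη.sqInt hT
  have hab' := hab.jointEq hT hθ.drift_bounded.1 hbo
  have hL : discounted P r (fun t ω => inner ℝ (cumulative η t ω) (a t ω - r • θ t ω)) =
      ∫ p : Ω × Horizon T, inner ℝ (cumulative η p.2 p.1) (β p.2 p.1) ∂P.prod (leb T) := by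
    refine integral_congr_ae ?_
    filter_upwards [hab'] with p hp
    simp only [β, real_inner_smul_right, hp]
  have hker := fun x => hasDerivAt_exp_neg_mul r x
  have hkerc : Continuous fun x => -r * Real.exp (-r * x) := by fun_prop
  let Z : Fin d → Horizon T → Ω → ℝ := fun i t ω =>
    Real.exp (-r * (t : ℝ)) * (θ t ω i - cumulative b t ω i) -
      primitive (fun s : Horizon T => -r * Real.exp (-r * (s : ℝ)) *
        (θ s ω i - cumulative b s ω i)) t
  have hZ : ∀ i, IsContMartingale P F (Z i) := fun i => (hN i).weighted hT hker hkerc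
  have hcoord : ∀ ω i, Integrable (fun t => b t ω i) (leb T) := fun ω i =>
    (EuclideanSpace.proj (𝕜 := ℝ) i).integrable_comp (hbi ω)
  have hθc : ∀ ω i, Continuous fun t => θ t ω i := fun ω i =>
    (EuclideanSpace.proj (𝕜 := ℝ) i).continuous.comp (hθ.continuous_paths ω)
  have hβi : ∀ ω, Integrable (fun t => β t ω) (leb T) := by
    intro ω
    obtain ⟨K, hK⟩ := norm_weight_le (T := T) r
    refine Integrable.bdd_smul (C := K) ((hbi ω).sub
      ((integrable_of_continuous (hθ.continuous_paths ω)).smul r)) ?_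
      (Eventually.of_forall fun p => hK p)
    exact (by fun_prop : Measurable fun t : Horizon T =>
      Real.exp (-r * (t : ℝ))).aestronglyMeasurable
  -- The martingale `Z`, the integral of e^{-rt} against the martingale part of θ written by parts,
  -- is thus the martingale part of e^{-rt}θ.
  have hZeq : ∀ i t ω, Z i t ω = Real.exp (-r * (t : ℝ)) * θ t ω i - cumulative β t ω i := by
    intro i t ω
    have h1 := weight_mul_primitive hT hker hkerc 0 (hcoord ω i) t
    simp only [zero_add, mul_zero, sub_zero] at h1
    have hNc : Continuous fun s : Horizon T => -r * Real.exp (-r * (s : ℝ)) *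
        (θ s ω i - cumulative b s ω i) :=
      (by fun_prop : Continuous fun s : Horizon T => -r * Real.exp (-r * (s : ℝ))).mul
        ((hN i).continuous_paths ω)
    have hcb : Continuous (primitive fun s => b s ω i) := continuous_primitive hT (hcoord ω i)
    have hbint : Integrable (fun s : Horizon T => -r * Real.exp (-r * (s : ℝ)) *
        primitive (fun s => b s ω i) s + Real.exp (-r * (s : ℝ)) * b s ω i) (leb T) := by
      refine (integrable_of_continuous ?_).add ?_
      · exact (by fun_prop : Continuous fun s : Horizon T =>
          -r * Real.exp (-r * (s : ℝ))).mul hcb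
      · simp_rw [mul_comm _ (b _ ω i)]
        exact integrable_mul_of_continuous (hcoord ω i) (by fun_prop)
    have h2 := primitive_add (integrable_of_continuous hNc) hbint t
    have h3 : (fun s : Horizon T => -r * Real.exp (-r * (s : ℝ)) *
        (θ s ω i - cumulative b s ω i) + (-r * Real.exp (-r * (s : ℝ)) *
        primitive (fun s => b s ω i) s + Real.exp (-r * (s : ℝ)) * b s ω i)) =
        fun s => β s ω i := by
      ext s
      simp only [β, PiLp.smul_apply, PiLp.sub_apply, smul_eq_mul, cumulative_coord (hbi ω)]
      ring
    rw [h3, h1] at h2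
    rw [cumulative_coord (hβi ω), h2]
    simp only [Z, cumulative_coord (hbi ω)]
    ring
  have hηo : ∀ i, Measurable[optionalSigma F] fun p : Horizon T × Ω => η p.1 p.2 i := fun i =>
    (measurable_coord i).comp hη.1
  have hηi : ∀ i, JointInt P fun t ω => η t ω i := fun i =>
    (EuclideanSpace.proj (𝕜 := ℝ) i).integrable_comp hη2.integrable
  have horth := fun i => (hZ i).orthogonal hT (hηo i) (hηi i)
  have hsum : ∫ p : Ω × Horizon T, ∑ i, η p.2 p.1 i * (Z i (finalTime hT) p.1 - Z i p.2 p.1)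
      ∂P.prod (leb T) = 0 := by
    rw [integral_finsetSum _ fun i _ => (horth i).1]
    exact Finset.sum_eq_zero fun i _ => (horth i).2
  have hβ2 := (hβ.memH2 hT).sqInt hT
  have hθ2 := (hθ.memH2 hT).sqInt hT
  have hI1 : JointInt P fun t ω => inner ℝ (η t ω)
      (cumulative β (finalTime hT) ω - cumulative β t ω) :=
    hη2.inner ((hβ.sqInt_total hT).sub (hβ2.cumulative hT hβ.1))
  have hI2 := (hη2.inner hθ2).weight r
  have hterm : ∀ᵐ p : Ω × Horizon T ∂P.prod (leb T), θ (finalTime hT) p.1 = 0 :=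
    Measure.quasiMeasurePreserving_fst.ae
      (hθ.terminal.mono fun ω h => h (finalTime hT) rfl)
  -- As θ vanishes at `T`, e^{-rt}θ_t plus the integral of `β` over `[t,T]` equals -(Z_T - Z_t),
  -- which is orthogonal to the optional process `η`.
  have hrel : ∫ p : Ω × Horizon T, (inner ℝ (η p.2 p.1)
      (cumulative β (finalTime hT) p.1 - cumulative β p.2 p.1) +
      Real.exp (-r * (p.2 : ℝ)) * inner ℝ (η p.2 p.1) (θ p.2 p.1)) ∂P.prod (leb T) =
      ∫ p : Ω × Horizon T, -∑ i, η p.2 p.1 i * (Z i (finalTime hT) p.1 - Z i p.2 p.1)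
        ∂P.prod (leb T) := by
    refine integral_congr_ae ?_
    filter_upwards [hterm] with p hp
    simp only [PiLp.inner_apply, RCLike.inner_apply, conj_trivial, PiLp.sub_apply]
    rw [Finset.mul_sum, ← Finset.sum_add_distrib, ← Finset.sum_neg_distrib]
    refine Finset.sum_congr rfl fun i _ => ?_
    rw [hZeq, hZeq, hp]
    simp only [PiLp.zero_apply]
    ring
  rw [integral_neg, hsum, neg_zero, integral_add hI1 hI2] at hrel
  rw [hL, integral_inner_cumulative hT hη hβ, discounted]
  linarith

lemma norm_le_sum_coord (x : Vec d) : ‖x‖ ≤ ∑ i, ‖x i‖ := by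
  have h := (EuclideanSpace.basisFun (Fin d) ℝ).sum_repr x
  calc ‖x‖ = ‖∑ i, (EuclideanSpace.basisFun (Fin d) ℝ).repr x i •
        EuclideanSpace.basisFun (Fin d) ℝ i‖ := by rw [h]
    _ ≤ _ := norm_sum_le_of_le _ fun i _ => by
        rw [norm_smul, (EuclideanSpace.basisFun (Fin d) ℝ).orthonormal.1 i, mul_one]
        simp

lemma integral_inner_self_eq_zero {X : Proc T Ω d} (hX : SqInt P X)
    (h : ∫ p : Ω × Horizon T, inner ℝ (X p.2 p.1) (X p.2 p.1) ∂P.prod (leb T) = 0) :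
    JointEq P X fun _ _ => 0 := by
  rw [← discounted_eq_zero_iff hX 0]
  simpa [discounted] using h

/-- A bounded optional process that is orthogonal to the demands of all rates of class `𝒜`
vanishes. -/
theorem eqAE_zero_of_orthogonal (hT : 0 < T) {W : Proc T Ω d} (hB : IsBrownianMotion P W)
    {Q : Proc T Ω d} (hQ : MemHInfty P (augmentedFiltration P W hB.measurable) Q) (r : ℝ)
    (h : ∀ η a, MemAWithDrift P (augmentedFiltration P W hB.measurable) η a →
      discounted P r (fun t ω => inner ℝ (cumulative η t ω) (Q t ω)) = 0) :
    EqAE P Q fun _ _ => 0 := by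
  set F := augmentedFiltration P W hB.measurable
  obtain ⟨R, C, hRo, hRC, hQR⟩ := hQ.exists_bounded
  obtain ⟨K, hK⟩ := norm_weight_le (T := T) r
  let v : Proc T Ω d := fun t ω => Real.exp (-r * (t : ℝ)) • R t ω
  have hvo : IsOptional F v :=
    hRo.weight (w := fun t : Horizon T => Real.exp (-r * (t : ℝ))) (by fun_prop)
  have hvC : ∀ t ω, ‖v t ω‖ ≤ K * C := fun t ω => by
    rw [norm_smul]
    exact mul_le_mul (hK t) (hRC t ω) (norm_nonneg _) ((norm_nonneg _).trans (hK t))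
  have hv : MemHInfty P F v := memHInfty_of_bound hvo hvC
  have hvi := integrable_of_isOptional_bound hT hvo hvC
  set D := K * C * (leb T).real Set.univ
  have hVD : ∀ t ω, ‖cumulative v t ω‖ ≤ D := fun t ω => norm_primitive_le (fun s => hvC s ω) t
  have hVm : ∀ t, Measurable[F t] (cumulative v t) := fun t =>
    measurable_primitive_of_optional hvo t
  have hVc : ∀ ω, Continuous fun t => cumulative v t ω := fun ω => continuous_primitive hT (hvi ω)
  have hVT : ∀ i, Measurable[F (finalTime hT)] fun ω => cumulative v (finalTime hT) ω i := fun i =>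
    (measurable_coord i).comp (hVm _)
  have hex := fun i => exists_continuousVersion hT hB
    (ξ := fun ω => cumulative v (finalTime hT) ω i)
    ((hVT i).mono (F.le _) le_rfl).aestronglyMeasurable (C := D)
    (Eventually.of_forall fun ω => (PiLp.norm_apply_le _ i).trans (hVD _ ω))
  choose M hM hMD using hex
  have hMm : ∀ i, IsContMartingale P F (M i) := fun i => (hM i).isContMartingale (hMD i)
  have hMT : ∀ᵐ ω ∂P, ∀ i, M i (finalTime hT) ω = cumulative v (finalTime hT) ω i := by
    refine ae_all_iff.2 fun i => ?_
    have e := condExp_of_stronglyMeasurable (μ := P) (F.le _) (hVT i).stronglyMeasurable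
      (Integrable.of_bound ((hVT i).mono (F.le _) le_rfl).aestronglyMeasurable D
        (Eventually.of_forall fun ω => (PiLp.norm_apply_le _ i).trans (hVD _ ω)))
    have h1 := (hM i).ae_eq (finalTime hT)
    rw [e] at h1
    exact h1
  -- A continuous version of E[∫_t^T v | F_t]. It has drift `-v` and vanishes at `T`, so it is an
  -- admissible test rate.
  let Y : Proc T Ω d := fun t ω => WithLp.toLp 2 fun i => M i t ω - cumulative v t ω i
  have hYi : ∀ t ω i, Y t ω i = M i t ω - cumulative v t ω i := fun _ _ _ => rfl
  let b : Proc T Ω d := fun t ω => (-1 : ℝ) • v t ω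
  have hcb : ∀ t ω, cumulative b t ω = (-1 : ℝ) • cumulative v t ω := fun t ω =>
    integral_smul _ _
  have hY : MemAWithDrift P F Y b := by
    refine MemAWithDrift.of_martingale hT (C := K * C) (D := ∑ _i : Fin d, (D + D)) ?_ ?_ ?_ ?_
      (hvo.const_smul (-1)) ?_ ?_
    · exact fun t => @measurable_toVec _ _ (F t) _ fun i =>
        ((hM i).adapted t).sub ((measurable_coord i).comp (hVm t))
    · intro ω
      refine (PiLp.continuous_toLp 2 _).comp (continuous_pi fun i => ?_)
      exact ((hM i).continuous_paths ω).sub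
        ((EuclideanSpace.proj (𝕜 := ℝ) i).continuous.comp (hVc ω))
    · intro t ω
      refine (norm_le_sum_coord _).trans (Finset.sum_le_sum fun i _ => ?_)
      exact (norm_sub_le _ _).trans (add_le_add (hMD i t ω)
        ((PiLp.norm_apply_le _ i).trans (hVD t ω)))
    · filter_upwards [hMT] with ω hω
      ext i
      simp [hYi, hω i]
    · intro t ω
      simpa [b] using hvC t ω
    · intro i
      have e : (fun t ω => Y t ω i - cumulative b t ω i) = M i := by
        ext t ω
        rw [hcb, hYi]
        simp
      rw [e]
      exact hMm i
  have hv2 := (hv.memH2 hT).sqInt hT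
  have hV2 := hv2.cumulative hT hv.1
  have hY2 := (hY.memH2 hT).sqInt hT
  have hMTj : ∀ᵐ p : Ω × Horizon T ∂P.prod (leb T),
      ∀ i, M i (finalTime hT) p.1 = cumulative v (finalTime hT) p.1 i :=
    Measure.quasiMeasurePreserving_fst.ae hMT
  -- The tail integral of `v` is `Y` plus a future increment of `M`, which optional processes do not
  -- see.
  have split : ∀ X : Proc T Ω d, MemH2 P F X →
      ∫ p : Ω × Horizon T, inner ℝ (X p.2 p.1)
        (cumulative v (finalTime hT) p.1 - cumulative v p.2 p.1) ∂P.prod (leb T) =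
      ∫ p : Ω × Horizon T, inner ℝ (X p.2 p.1) (Y p.2 p.1) ∂P.prod (leb T) := by
    intro X hX
    have hX2 := hX.sqInt hT
    have ho : ∀ i, Measurable[optionalSigma F] fun p : Horizon T × Ω => X p.1 p.2 i := fun i =>
      (measurable_coord i).comp hX.1
    have hi : ∀ i, JointInt P fun t ω => X t ω i := fun i =>
      (EuclideanSpace.proj (𝕜 := ℝ) i).integrable_comp hX2.integrable
    have horth := fun i => (hMm i).orthogonal hT (ho i) (hi i)
    have hsum : ∫ p : Ω × Horizon T, ∑ i, X p.2 p.1 i * (M i (finalTime hT) p.1 - M i p.2 p.1)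
        ∂P.prod (leb T) = 0 := by
      rw [integral_finsetSum _ fun i _ => (horth i).1]
      exact Finset.sum_eq_zero fun i _ => (horth i).2
    have hsi : Integrable (fun p : Ω × Horizon T =>
        ∑ i, X p.2 p.1 i * (M i (finalTime hT) p.1 - M i p.2 p.1)) (P.prod (leb T)) :=
      integrable_finsetSum _ fun i _ => (horth i).1
    refine Eq.trans ?_ ((integral_add (hX2.inner hY2) hsi).trans (by rw [hsum, add_zero]))
    refine integral_congr_ae ?_
    filter_upwards [hMTj] with p hp
    simp only [PiLp.inner_apply, RCLike.inner_apply, conj_trivial, PiLp.sub_apply]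
    rw [← Finset.sum_add_distrib]
    refine Finset.sum_congr rfl fun i _ => ?_
    rw [hp, hYi]
    ring
  have hQR' := hQR.jointEq hT hQ.1 hRo
  -- Testing the hypothesis with the rate `Y` and moving the time integral to the other side leaves
  -- E∫|Y|² = 0.
  have hY0 : JointEq P Y fun _ _ => 0 := by
    refine integral_inner_self_eq_zero hY2 ?_
    rw [← split Y (hY.memH2 hT), ← integral_inner_cumulative hT (hY.memH2 hT) hv]
    refine Eq.trans (integral_congr_ae ?_) (h Y b hY)
    filter_upwards [hQR'] with p hp
    simp only [v, real_inner_smul_right, hp]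
  have hvv : ∫ p : Ω × Horizon T, inner ℝ (v p.2 p.1)
      (cumulative v (finalTime hT) p.1 - cumulative v p.2 p.1) ∂P.prod (leb T) = 0 := by
    rw [split v (hv.memH2 hT)]
    refine integral_eq_zero_of_ae ?_
    filter_upwards [hY0] with p hp
    simp [hp]
  -- Pathwise, ⟨v_t, V_T - V_t⟩ integrates to |V_T|²/2 for V = ∫v, while `Y = 0` makes its
  -- expectation vanish.
  have hVT0 : ∀ᵐ ω ∂P, cumulative v (finalTime hT) ω = 0 := by
    have hpath : ∀ ω, ∫ t, inner ℝ (v t ω) (cumulative v (finalTime hT) ω - cumulative v t ω) ∂leb T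
        = 2⁻¹ * ‖cumulative v (finalTime hT) ω‖ ^ 2 := by
      intro ω
      have h1 : ∫ s, inner ℝ (cumulative v s ω) (v s ω) ∂leb T =
          ∫ s, inner ℝ (v s ω) (cumulative v (finalTime hT) ω - cumulative v s ω) ∂leb T :=
        integral_inner_primitive hT (hvi ω) (hvi ω)
      have hvb : Integrable (fun s => inner ℝ (v s ω) (cumulative v s ω)) (leb T) := by
        refine Integrable.mono' ((hvi ω).norm.mul_const D)
          ((hvi ω).1.inner (hVc ω).aestronglyMeasurable) (Eventually.of_forall fun s => ?_)
        exact (norm_inner_le_norm _ _).trans (mul_le_mul_of_nonneg_left (hVD s ω) (norm_nonneg _))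
      have hvc : Integrable (fun s => inner ℝ (v s ω) (cumulative v (finalTime hT) ω)) (leb T) :=
        (hvi ω).inner_const _
      have h2 : ∫ s, inner ℝ (v s ω) (cumulative v (finalTime hT) ω) ∂leb T =
          ‖cumulative v (finalTime hT) ω‖ ^ 2 := by
        simp only [real_inner_comm (cumulative v (finalTime hT) ω)]
        rw [integral_inner (hvi ω), ← primitive_finalTime hT]
        exact real_inner_self_eq_norm_sq _
      simp only [inner_sub_right] at h1 ⊢
      rw [integral_sub hvc hvb] at h1 ⊢
      simp only [real_inner_comm (v _ ω)] at h1 h2 ⊢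
      linarith
    rw [integral_prod _ (hv2.inner ((hv.sqInt_total hT).sub hV2))] at hvv
    simp only [hpath] at hvv
    rw [integral_const_mul, mul_eq_zero_iff_left (by norm_num),
      integral_eq_zero_iff_of_nonneg (fun ω => by positivity)] at hvv
    · filter_upwards [hvv] with ω hω
      simpa using hω
    · refine Integrable.of_bound (C := D ^ 2) (((hVm (finalTime hT)).mono (F.le _)
        le_rfl).norm.pow_const 2).aestronglyMeasurable (Eventually.of_forall fun ω => ?_)
      rw [Real.norm_of_nonneg (by positivity)]
      exact pow_le_pow_left₀ (norm_nonneg _) (hVD _ ω) 2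
  -- `M` is the conditional expectation of a null variable; a countable dense set of times and
  -- continuity give one null set for all times. Hence the primitive of `v`, which is `M - Y`,
  -- vanishes.
  have hM0 : ∀ᵐ ω ∂P, ∀ i t, M i t ω = 0 := by
    refine ae_all_iff.2 fun i => ?_
    obtain ⟨S, hSc, hSd⟩ := TopologicalSpace.exists_countable_dense (Horizon T)
    have h1 : ∀ᵐ ω ∂P, ∀ t ∈ S, M i t ω = 0 := by
      refine (ae_ball_iff hSc).2 fun t _ => ?_
      have e : (fun ω => cumulative v (finalTime hT) ω i) =ᵐ[P] (0 : Ω → ℝ) := by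
        filter_upwards [hVT0] with ω hω
        simp [hω]
      have e2 := ((hM i).ae_eq t).trans (condExp_congr_ae e)
      rw [condExp_zero] at e2
      exact e2
    filter_upwards [h1] with ω hω t
    exact congrFun (Continuous.ext_on hSd ((hM i).continuous_paths ω) continuous_const
      (fun t ht => hω t ht)) t
  filter_upwards [hY0.eqAE, hM0, hQR] with ω h1 h2 h3
  have hVz : ∀ t, primitive (fun s => v s ω) t = 0 := by
    have := isOpenPosMeasure_leb hT
    have hae : (fun t => cumulative v t ω) =ᵐ[leb T] fun _ => 0 := by
      filter_upwards [h1] with t ht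
      ext i
      have := congrArg (fun x : Vec d => x i) ht
      simp only [hYi, h2] at this
      simpa using this
    exact fun t => congrFun ((hVc ω).ae_eq_iff_eq (leb T) continuous_const |>.1 hae) t
  filter_upwards [ae_eq_zero_of_primitive_eq_zero hT (hvi ω) hVz, h3] with t h4 h5
  rw [h5]
  simpa [v, (Real.exp_pos _).ne'] using h4

end ClassA

end PriceImpact

end

/-! ### The scalar forward-backward equation and simultaneous diagonalisation. -/

noncomputable section

namespace PriceImpact

section LinearSystem

set_option linter.unusedSectionVars false

variable {Ω : Type*} {mΩ : MeasurableSpace Ω} {T : ℝ} {d : ℕ} {P : Measure Ω}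
  [IsProbabilityMeasure P]

/-- The numbers p and -q are the roots of x² - rx - b, the characteristic polynomial of the equation
for `u` below. -/
lemma exists_pos_roots (r : ℝ) {b : ℝ} (hb : 0 < b) :
    ∃ p q : ℝ, 0 < p ∧ 0 < q ∧ p * q = b ∧ p - q = r := by
  have hs : Real.sqrt (r ^ 2 + 4 * b) ^ 2 = r ^ 2 + 4 * b := Real.sq_sqrt (by positivity)
  have hlt : |r| < Real.sqrt (r ^ 2 + 4 * b) := by
    rw [← Real.sqrt_sq_eq_abs]
    exact Real.sqrt_lt_sqrt (sq_nonneg r) (by linarith)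
  obtain ⟨h1, h2⟩ := abs_lt.1 hlt
  refine ⟨(r + Real.sqrt (r ^ 2 + 4 * b)) / 2, (Real.sqrt (r ^ 2 + 4 * b) - r) / 2,
    by linarith, by linarith, ?_, by ring⟩
  linear_combination (1 / 4) * hs

/-- A positive solution of `u'' = r u' + b u` with `u' T = 0`. -/
lemma exists_pos_ode_solution (r T : ℝ) {b : ℝ} (hb : 0 < b) :
    ∃ u u' : ℝ → ℝ, (∀ x, 0 < u x) ∧ (∀ x, HasDerivAt u (u' x) x) ∧
      (∀ x, HasDerivAt u' (r * u' x + b * u x) x) ∧ u' T = 0 := by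
  obtain ⟨p, q, hp, hq, rfl, rfl⟩ := exists_pos_roots r hb
  have he : ∀ c x : ℝ, HasDerivAt (fun x => Real.exp (c * (x - T)))
      (c * Real.exp (c * (x - T))) x := by
    intro c x
    have h := (((hasDerivAt_id x).sub_const T).const_mul c).exp
    simpa [mul_comm] using h
  -- The weights `q` and `p` make the two terms of the derivative cancel at `T`; both are positive,
  -- hence so is the solution.
  refine ⟨fun x => q * Real.exp (p * (x - T)) + p * Real.exp (-q * (x - T)),
    fun x => p * q * (Real.exp (p * (x - T)) - Real.exp (-q * (x - T))), fun x => by positivity,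
    fun x => ?_, fun x => ?_, by simp⟩
  · have h := ((he p x).const_mul q).add ((he (-q) x).const_mul p)
    exact h.congr_deriv (by ring)
  · have h := ((he p x).sub (he (-q) x)).const_mul (p * q)
    exact h.congr_deriv (by ring)

lemma exists_bound_weight {w : ℝ → ℝ} (hw : Continuous w) :
    ∃ K, 0 ≤ K ∧ ∀ t : Horizon T, ‖w t‖ ≤ K := by
  obtain ⟨C, hC⟩ := isCompact_univ.exists_bound_of_continuousOn
    (f := fun t : Horizon T => w t) (hw.comp continuous_subtype_val).continuousOn
  exact ⟨max C 0, le_max_right _ _, fun t => (hC t (Set.mem_univ t)).trans (le_max_left _ _)⟩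

lemma measurable_weight_optional {F : Filtration (Horizon T) mΩ} {w : ℝ → ℝ} (hw : Continuous w) :
    Measurable[optionalSigma F] fun p : Horizon T × Ω => w p.1 :=
  hw.measurable.comp (measurable_subtype_coe.comp measurable_time_optional)

/-- The scalar linear forward-backward equation `dφ = θ dt`, `dθ = (r θ + b φ + f) dt + dM`,
`φ 0 = 0`, `θ T = 0`. -/
theorem exists_scalar_forwardBackward (hT : 0 < T) {W : Proc T Ω d} (hB : IsBrownianMotion P W)
    (r : ℝ) {b : ℝ} (hb : 0 < b) {f : Horizon T → Ω → ℝ}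
    (hf : Measurable[optionalSigma (augmentedFiltration P W hB.measurable)]
      fun p : Horizon T × Ω => f p.1 p.2) {C : ℝ} (hC : ∀ t ω, ‖f t ω‖ ≤ C) :
    ∃ (θ : Horizon T → Ω → ℝ) (D : ℝ), Adapted (augmentedFiltration P W hB.measurable) θ ∧
      (∀ ω, Continuous fun t => θ t ω) ∧ (∀ t ω, ‖θ t ω‖ ≤ D) ∧
      (∀ᵐ ω ∂P, θ (finalTime hT) ω = 0) ∧
      IsContMartingale P (augmentedFiltration P W hB.measurable) fun t ω => θ t ω -
        primitive (fun s => r * θ s ω + b * primitive (fun v => θ v ω) s + f s ω) t := by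
  set F := augmentedFiltration P W hB.measurable
  -- Ansatz φ = uI and θ = u'I + p with dI = (p/u) dt, which gives dφ = θ dt at once. The equation
  -- for `u` absorbs the terms in I and leaves dp = ((r - u'/u)p + f) dt + dM with p_T = 0, a
  -- backward equation for p alone.
  obtain ⟨u, u', hu0, hu, hu', huT⟩ := exists_pos_ode_solution r T hb
  have hune : ∀ x, u x ≠ 0 := fun x => (hu0 x).ne'
  have huc : Continuous u := continuous_iff_continuousAt.2 fun x => (hu x).continuousAt
  have huc' : Continuous u' := continuous_iff_continuousAt.2 fun x => (hu' x).continuousAt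
  have hu2c : Continuous fun x => r * u' x + b * u x := by fun_prop
  -- The integrating factor: `k` solves k' = (r - u'/u)k, and `w` below is its reciprocal.
  let k : ℝ → ℝ := fun x => Real.exp (r * x) / u x
  let k' : ℝ → ℝ := fun x => (r - u' x / u x) * k x
  have hkc : Continuous k := (by fun_prop : Continuous fun x => Real.exp (r * x)).div huc hune
  have hkc' : Continuous k' := (continuous_const.sub (huc'.div huc hune)).mul hkc
  have hk : ∀ x, HasDerivAt k (k' x) x := by
    intro x
    have h1 : HasDerivAt (fun x => Real.exp (r * x)) (r * Real.exp (r * x)) x := by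
      simpa [mul_comm] using ((hasDerivAt_id x).const_mul r).exp
    refine (h1.div (hu x) (hune x)).congr_deriv ?_
    simp only [k', k]
    field_simp [hune x]
  let w : ℝ → ℝ := fun x => Real.exp (-r * x) * u x
  have hwc : Continuous w := by fun_prop
  have hkw : ∀ x, k x * w x = 1 := by
    intro x
    simp only [k, w]
    rw [div_mul_eq_mul_div, ← mul_assoc, ← Real.exp_add]
    simp [hune x]
  obtain ⟨Kw, hKw0, hKw⟩ := exists_bound_weight (T := T) hwc
  obtain ⟨Kk, hKk0, hKk⟩ := exists_bound_weight (T := T) hkc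
  obtain ⟨Ku, hKu0, hKu⟩ := exists_bound_weight (T := T) huc'
  obtain ⟨Ki, hKi0, hKi⟩ := exists_bound_weight (T := T) (huc.inv₀ hune)
  let g : Horizon T → Ω → ℝ := fun t ω => w t * f t ω
  have hgo : Measurable[optionalSigma F] fun p : Horizon T × Ω => g p.1 p.2 :=
    (measurable_weight_optional hwc).mul hf
  have hgb : ∀ t ω, ‖g t ω‖ ≤ Kw * C := fun t ω => by
    rw [norm_mul]
    exact mul_le_mul (hKw t) (hC t ω) (norm_nonneg _) hKw0
  have hpath : ∀ {h : Horizon T → Ω → ℝ} {D : ℝ},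
      Measurable[optionalSigma F] (fun p : Horizon T × Ω => h p.1 p.2) → (∀ t ω, ‖h t ω‖ ≤ D) →
      ∀ ω, Integrable (fun t => h t ω) (leb T) := by
    intro h D hm hD ω
    have hm' : Measurable fun t => h t ω :=
      (hm.mono (optionalSigma_le hT) le_rfl).comp (measurable_prodMk_right (y := ω))
    exact Integrable.of_bound hm'.aestronglyMeasurable D (Eventually.of_forall fun t => hD t ω)
  have hgi := hpath hgo hgb
  have hfi := hpath hf hC
  let R : Horizon T → Ω → ℝ := fun t ω => primitive (fun s => g s ω) t
  have hRm : ∀ t, Measurable[F t] (R t) := fun t => measurable_primitive_of_optional hgo t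
  have hRc : ∀ ω, Continuous fun t => R t ω := fun ω => continuous_primitive hT (hgi ω)
  set CR := Kw * C * (leb T).real Set.univ
  have hRb : ∀ t ω, ‖R t ω‖ ≤ CR := fun t ω => norm_primitive_le (fun s => hgb s ω) t
  have hRT : Measurable (R (finalTime hT)) := (hRm _).mono (F.le _) le_rfl
  obtain ⟨N, hN, hNb⟩ := exists_continuousVersion hT hB hRT.aestronglyMeasurable (C := CR)
    (Eventually.of_forall fun ω => hRb _ ω)
  have hNm : IsContMartingale P F N := hN.isContMartingale hNb
  have hNT : ∀ᵐ ω ∂P, N (finalTime hT) ω = R (finalTime hT) ω := by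
    have e := condExp_of_stronglyMeasurable (μ := P) (F.le _) (hRm (finalTime hT)).stronglyMeasurable
      (Integrable.of_bound hRT.aestronglyMeasurable CR (Eventually.of_forall fun ω => hRb _ ω))
    have h1 := hN.ae_eq (finalTime hT)
    rw [e] at h1
    exact h1
  -- This is -k_t E[∫_t^T w f | F_t], the solution of the backward equation; it vanishes at `T`
  -- because N_T = R_T almost surely.
  let p : Horizon T → Ω → ℝ := fun t ω => -(k t * (N t ω - R t ω))
  have hpm : ∀ t, Measurable[F t] (p t) := fun t =>
    (((hN.adapted t).sub (hRm t)).const_mul _).neg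
  have hpc : ∀ ω, Continuous fun t => p t ω := fun ω =>
    ((hkc.comp continuous_subtype_val).mul ((hN.continuous_paths ω).sub (hRc ω))).neg
  have hpb : ∀ t ω, ‖p t ω‖ ≤ Kk * (CR + CR) := fun t ω => by
    rw [norm_neg, norm_mul]
    exact mul_le_mul (hKk t) ((norm_sub_le _ _).trans (add_le_add (hNb t ω) (hRb t ω)))
      (norm_nonneg _) hKk0
  let q : Horizon T → Ω → ℝ := fun t ω => (u t)⁻¹ * p t ω
  have hqc : ∀ ω, Continuous fun t => q t ω := fun ω =>
    ((huc.inv₀ hune).comp continuous_subtype_val).mul (hpc ω)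
  have hqo : Measurable[optionalSigma F] fun z : Horizon T × Ω => q z.1 z.2 :=
    optional_of_continuous (fun t => (hpm t).const_mul _) hqc
  have hqb : ∀ t ω, ‖q t ω‖ ≤ Ki * (Kk * (CR + CR)) := fun t ω => by
    rw [norm_mul]
    exact mul_le_mul (hKi t) (hpb t ω) (norm_nonneg _) hKi0
  have hqi : ∀ ω, Integrable (fun t => q t ω) (leb T) := fun ω => integrable_of_continuous (hqc ω)
  let I : Horizon T → Ω → ℝ := fun t ω => primitive (fun s => q s ω) t
  have hIm : ∀ t, Measurable[F t] (I t) := fun t => measurable_primitive_of_optional hqo t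
  have hIc : ∀ ω, Continuous fun t => I t ω := fun ω => continuous_primitive hT (hqi ω)
  set CI := Ki * (Kk * (CR + CR)) * (leb T).real Set.univ
  have hIb : ∀ t ω, ‖I t ω‖ ≤ CI := fun t ω => norm_primitive_le (fun s => hqb s ω) t
  let θ : Horizon T → Ω → ℝ := fun t ω => u' t * I t ω + p t ω
  have hθc : ∀ ω, Continuous fun t => θ t ω := fun ω =>
    ((huc'.comp continuous_subtype_val).mul (hIc ω)).add (hpc ω)
  have hprimθ : ∀ t ω, primitive (fun s => θ s ω) t = u t * I t ω := by
    intro t ω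
    have h := weight_mul_primitive hT hu huc' 0 (hqi ω) t
    simp only [zero_add, mul_zero, sub_zero] at h
    rw [← h]
    congr 1
    ext s
    simp only [θ, I, q]
    field_simp [hune s]
  -- What remains of θ after subtracting its drift is the integral of -k against the martingale `N`
  -- in integrated-by-parts form, up to a constant.
  have hmart : ∀ t ω, θ t ω - primitive (fun s => r * θ s ω + b * primitive (fun v => θ v ω) s +
      f s ω) t = (fun x => -k x) t * N t ω -
        primitive (fun s : Horizon T => (fun x => -k' x) s * N s ω) t := by
    intro t ω
    have h1 := weight_mul_primitive hT hu' hu2c 0 (hqi ω) t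
    have h2 := weight_mul_primitive hT hk hkc' 0 (hgi ω) t
    simp only [zero_add, mul_zero, sub_zero] at h1 h2
    have e : (fun s => r * θ s ω + b * primitive (fun v => θ v ω) s + f s ω) = fun s : Horizon T =>
        (((r * u' s + b * u s) * primitive (fun v => q v ω) s + u' s * q s ω) +
          (k' s * primitive (fun v => g v ω) s + k s * g s ω)) + (fun x => -k' x) s * N s ω := by
      ext s
      have hkf : k s * g s ω = f s ω := by
        simp only [g]
        rw [← mul_assoc, hkw, one_mul]
      rw [hprimθ, hkf]
      simp only [θ, I, q, p, k', R]
      field_simp [hune s]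
      ring
    have c1 : Continuous fun s : Horizon T => (r * u' s + b * u s) * primitive (fun v => q v ω) s +
        u' s * q s ω :=
      ((hu2c.comp continuous_subtype_val).mul (hIc ω)).add
        ((huc'.comp continuous_subtype_val).mul (hqc ω))
    have c2 : Integrable (fun s : Horizon T => k' s * primitive (fun v => g v ω) s + k s * g s ω)
        (leb T) := by
      refine (integrable_of_continuous ((hkc'.comp continuous_subtype_val).mul (hRc ω))).add ?_
      have : (fun s : Horizon T => k s * g s ω) = fun s => f s ω := by
        ext s
        simp only [g]
        rw [← mul_assoc, hkw, one_mul]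
      rw [this]
      exact hfi ω
    have c3 : Continuous fun s : Horizon T => (fun x => -k' x) s * N s ω :=
      (hkc'.neg.comp continuous_subtype_val).mul (hN.continuous_paths ω)
    have c12 : Integrable (fun s : Horizon T =>
        ((r * u' s + b * u s) * primitive (fun v => q v ω) s + u' s * q s ω) +
          (k' s * primitive (fun v => g v ω) s + k s * g s ω)) (leb T) :=
      (integrable_of_continuous c1).add c2
    rw [e, primitive_add c12 (integrable_of_continuous c3),
      primitive_add (integrable_of_continuous c1) c2, h1, h2]
    simp only [θ, I, p, R]
    ring
  refine ⟨θ, Ku * CI + Kk * (CR + CR), fun t => ((hIm t).const_mul _).add (hpm t), hθc,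
    fun t ω => ?_, ?_, ?_⟩
  · refine (norm_add_le _ _).trans (add_le_add ?_ (hpb t ω))
    rw [norm_mul]
    exact mul_le_mul (hKu t) (hIb t ω) (norm_nonneg _) hKu0
  · filter_upwards [hNT] with ω hω
    have hfin : ((finalTime hT : Horizon T) : ℝ) = T := rfl
    simp only [θ, p, hω, hfin, huT]
    ring
  · have h := hNm.weighted hT (k := fun x => -k x) (k' := fun x => -k' x)
      (fun x => (hk x).neg) hkc'.neg
    simpa only [hmart] using h

/-- Simultaneous diagonalisation of a positive definite matrix and a positive definite diagonal
matrix. -/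
lemma exists_simultaneous_diagonalization {Λ S : Matrix (Fin d) (Fin d) ℝ} (hd : Λ.IsDiag)
    (hΛ : Λ.PosDef) (hS : S.PosDef) :
    ∃ (G H : Matrix (Fin d) (Fin d) ℝ) (b : Fin d → ℝ), G * H = 1 ∧ (∀ i, 0 < b i) ∧
      S * G = Λ * G * Matrix.diagonal b := by
  have hl : ∀ i, 0 < Λ i i := fun i => hΛ.diag_pos
  -- Here D = Λ^{-1/2} and D' = Λ^{1/2}. An orthogonal U diagonalises D S D, with positive
  -- eigenvalues `b`, and G = D U does the job.
  let D : Matrix (Fin d) (Fin d) ℝ := Matrix.diagonal fun i => (Real.sqrt (Λ i i))⁻¹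
  let D' : Matrix (Fin d) (Fin d) ℝ := Matrix.diagonal fun i => Real.sqrt (Λ i i)
  have hsq : ∀ i, Real.sqrt (Λ i i) ≠ 0 := fun i => (Real.sqrt_pos.2 (hl i)).ne'
  have hDD' : D * D' = 1 := by
    simp only [D, D', Matrix.diagonal_mul_diagonal]
    rw [← Matrix.diagonal_one]
    congr 1
    ext i
    exact inv_mul_cancel₀ (hsq i)
  have hD'D : D' * D = 1 := by
    simp only [D, D', Matrix.diagonal_mul_diagonal]
    rw [← Matrix.diagonal_one]
    congr 1
    ext i
    exact mul_inv_cancel₀ (hsq i)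
  have hΛD : Λ * D = D' := by
    have hΛe : Λ = Matrix.diagonal fun i => Λ i i := hd.diagonal_diag.symm
    rw [hΛe]
    simp only [D, D', Matrix.diagonal_mul_diagonal]
    congr 1
    ext i
    nth_rewrite 1 [← Real.mul_self_sqrt (hl i).le]
    rw [mul_assoc, mul_inv_cancel₀ (hsq i), mul_one]
  have hDt : D.conjTranspose = D := by
    simp [D]
  have hH : (D * S * D).PosDef := by
    have h := hS.conjTranspose_mul_mul_same (B := D) (by
      refine Matrix.mulVec_injective_of_isUnit ?_
      exact IsUnit.of_mul_eq_one _ hDD')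
    rwa [hDt] at h
  have hspec := hH.1.spectral_theorem
  set U : Matrix (Fin d) (Fin d) ℝ := (hH.1.eigenvectorUnitary : Matrix (Fin d) (Fin d) ℝ)
  have hUU : U * star U = 1 := Unitary.coe_mul_star_self hH.1.eigenvectorUnitary
  have hUU' : star U * U = 1 := Unitary.coe_star_mul_self hH.1.eigenvectorUnitary
  refine ⟨D * U, star U * D', hH.1.eigenvalues, ?_, fun i => hH.eigenvalues_pos i, ?_⟩
  · calc D * U * (star U * D') = D * (U * star U) * D' := by simp only [mul_assoc]
      _ = 1 := by rw [hUU, mul_one, hDD']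
  · have hHU : D * S * D * U = U * Matrix.diagonal hH.1.eigenvalues := by
      nth_rewrite 1 [hspec]
      simp only [Unitary.conjStarAlgAut_apply]
      rw [mul_assoc, mul_assoc]
      change U * (Matrix.diagonal _ * (star U * U)) = _
      rw [hUU', mul_one]
      rfl
    calc S * (D * U) = (D' * D) * S * (D * U) := by rw [hD'D, one_mul]
      _ = D' * (D * S * D * U) := by simp only [mul_assoc]
      _ = Λ * D * (U * Matrix.diagonal hH.1.eigenvalues) := by rw [hHU, hΛD]
      _ = Λ * (D * U) * Matrix.diagonal hH.1.eigenvalues := by simp only [mul_assoc]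

end LinearSystem

end PriceImpact

end

/-! ### The vector-valued forward-backward equation. -/

noncomputable section

namespace PriceImpact

section LinearSystemVector

set_option linter.unusedSectionVars false

variable {Ω : Type*} {mΩ : MeasurableSpace Ω} {T : ℝ} {d : ℕ} {P : Measure Ω}
  [IsProbabilityMeasure P]

lemma act_add (A : Matrix (Fin d) (Fin d) ℝ) (x y : Vec d) : act A (x + y) = act A x + act A y :=
  map_add _ _ _

lemma act_sub (A : Matrix (Fin d) (Fin d) ℝ) (x y : Vec d) : act A (x - y) = act A x - act A y :=
  map_sub _ _ _

lemma act_smul (A : Matrix (Fin d) (Fin d) ℝ) (c : ℝ) (x : Vec d) : act A (c • x) = c • act A x :=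
  map_smul _ _ _

lemma act_mul (A B : Matrix (Fin d) (Fin d) ℝ) (x : Vec d) : act (A * B) x = act A (act B x) := by
  ext i
  simp [act, Matrix.toLpLin_apply, Matrix.mulVec_mulVec]

lemma act_one (x : Vec d) : act (1 : Matrix (Fin d) (Fin d) ℝ) x = x := by
  ext i
  simp [act]

lemma act_diagonal (b : Fin d → ℝ) (x : Vec d) (i : Fin d) :
    act (Matrix.diagonal b) x i = b i * x i := by
  simp [act, Matrix.toLpLin_apply, Matrix.mulVec_diagonal]

lemma act_smul_matrix (c : ℝ) (A : Matrix (Fin d) (Fin d) ℝ) (x : Vec d) :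
    act (c • A) x = c • act A x := by
  ext i
  simp [act]

lemma cumulative_act (A : Matrix (Fin d) (Fin d) ℝ) {X : Proc T Ω d} {ω : Ω}
    (hi : Integrable (fun t => X t ω) (leb T)) (t : Horizon T) :
    cumulative (fun t ω => act A (X t ω)) t ω = act A (cumulative X t ω) :=
  (LinearMap.toContinuousLinearMap (Matrix.toEuclideanLin A)).integral_comp_comm hi.integrableOn

lemma exists_norm_act_le (A : Matrix (Fin d) (Fin d) ℝ) :
    ∃ K, 0 ≤ K ∧ ∀ x : Vec d, ‖act A x‖ ≤ K * ‖x‖ :=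
  ⟨_, norm_nonneg _, (LinearMap.toContinuousLinearMap (Matrix.toEuclideanLin A)).le_opNorm⟩

/-- The diagonal linear forward-backward equation. -/
lemma exists_diagonal_forwardBackward (hT : 0 < T) {W : Proc T Ω d} (hB : IsBrownianMotion P W)
    (r : ℝ) {b : Fin d → ℝ} (hb : ∀ i, 0 < b i) {f : Proc T Ω d}
    (hf : IsOptional (augmentedFiltration P W hB.measurable) f) {C : ℝ}
    (hC : ∀ t ω, ‖f t ω‖ ≤ C) :
    ∃ θ a : Proc T Ω d, MemAWithDrift P (augmentedFiltration P W hB.measurable) θ a ∧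
      ∀ t ω, a t ω - r • θ t ω = act (Matrix.diagonal b) (cumulative θ t ω) + f t ω := by
  set F := augmentedFiltration P W hB.measurable
  have hex := fun i => exists_scalar_forwardBackward hT hB r (hb i) (f := fun t ω => f t ω i)
    ((measurable_coord i).comp hf) (fun t ω => (PiLp.norm_apply_le _ i).trans (hC t ω))
  choose y D hym hyc hyD hyT hyM using hex
  let θ : Proc T Ω d := fun t ω => WithLp.toLp 2 fun i => y i t ω
  have hθi : ∀ t ω i, θ t ω i = y i t ω := fun _ _ _ => rfl
  have hθc : ∀ ω, Continuous fun t => θ t ω := fun ω =>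
    (PiLp.continuous_toLp 2 _).comp (continuous_pi fun i => hyc i ω)
  have hθm : ∀ t, Measurable[F t] (θ t) := fun t => @measurable_toVec _ _ (F t) _ fun i => hym i t
  have hθb : ∀ t ω, ‖θ t ω‖ ≤ ∑ i, D i := fun t ω =>
    (norm_le_sum_coord _).trans (Finset.sum_le_sum fun i _ => hyD i t ω)
  have hθo : IsOptional F θ := isOptional_of_continuous hθm hθc
  have hθint : ∀ ω, Integrable (fun t => θ t ω) (leb T) := fun ω => integrable_of_continuous (hθc ω)
  obtain ⟨K, hK0, hK⟩ := exists_norm_act_le (Matrix.diagonal b)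
  let a : Proc T Ω d := fun t ω =>
    r • θ t ω + act (Matrix.diagonal b) (cumulative θ t ω) + f t ω
  have hao : IsOptional F a :=
    ((hθo.const_smul r).add ((isOptional_cumulative hT hθo hθint).act _)).add hf
  have hai : ∀ t ω i, a t ω i =
      r * y i t ω + b i * primitive (fun v => y i v ω) t + f t ω i := by
    intro t ω i
    simp only [a, PiLp.add_apply, PiLp.smul_apply, smul_eq_mul, act_diagonal, hθi,
      cumulative_coord (hθint ω)]
  have hab : ∀ t ω, ‖a t ω‖ ≤ ‖r‖ * (∑ i, D i) +
      K * ((∑ i, D i) * (leb T).real Set.univ) + C := by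
    intro t ω
    refine (norm_add_le _ _).trans (add_le_add ((norm_add_le _ _).trans (add_le_add ?_ ?_))
      (hC t ω))
    · rw [norm_smul]
      exact mul_le_mul_of_nonneg_left (hθb t ω) (norm_nonneg _)
    · exact (hK _).trans (mul_le_mul_of_nonneg_left
        (norm_primitive_le (fun s => hθb s ω) t) hK0)
  refine ⟨θ, a, ?_, fun t ω => by simp only [a]; abel⟩
  refine MemAWithDrift.of_martingale hT hθm hθc hθb ?_ hao hab fun i => ?_
  · filter_upwards [ae_all_iff.2 hyT] with ω hω
    ext i
    exact hω i
  · have haint := integrable_of_isOptional_bound hT hao hab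
    have e : (fun t ω => θ t ω i - cumulative a t ω i) = fun t ω => y i t ω -
        primitive (fun s => r * y i s ω + b i * primitive (fun v => y i v ω) s + f s ω i) t := by
      ext t ω
      rw [cumulative_coord (haint ω), hθi]
      simp only [hai]
    rw [e]
    exact hyM i

/-- The linear forward-backward equation `Λ (a - r θ) = S φ + f` for rates `θ` of class `𝒜` with
drift `a` and demand `φ`. -/
theorem exists_forwardBackward (hT : 0 < T) {W : Proc T Ω d} (hB : IsBrownianMotion P W) (r : ℝ)
    {Λ S : Matrix (Fin d) (Fin d) ℝ} (hd : Λ.IsDiag) (hΛ : Λ.PosDef) (hS : S.PosDef)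
    {f : Proc T Ω d} (hf : MemHInfty P (augmentedFiltration P W hB.measurable) f) :
    ∃ θ a : Proc T Ω d, MemAWithDrift P (augmentedFiltration P W hB.measurable) θ a ∧
      EqAE P (fun t ω => act Λ (a t ω - r • θ t ω))
        (fun t ω => act S (cumulative θ t ω) + f t ω) := by
  obtain ⟨g, C, hgo, hgC, hfg⟩ := hf.exists_bounded
  obtain ⟨G, H, b, hGH, hb, hSG⟩ := exists_simultaneous_diagonalization hd hΛ hS
  obtain ⟨K, hK0, hK⟩ := exists_norm_act_le (H * Λ⁻¹)
  -- Substitute θ = G y. Since S G = Λ G diag(b), multiplication by (ΛG)⁻¹ = HΛ⁻¹ decouples the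
  -- system.
  obtain ⟨y, c, hy, heq⟩ := exists_diagonal_forwardBackward hT hB r hb (hgo.act (H * Λ⁻¹))
    (C := K * C) (fun t ω => (hK _).trans (mul_le_mul_of_nonneg_left (hgC t ω) hK0))
  refine ⟨_, _, hy.act hT G, ?_⟩
  filter_upwards [hfg] with ω h1
  filter_upwards [h1] with t h2
  have hyint : Integrable (fun t => y t ω) (leb T) := integrable_of_continuous (hy.continuous_paths ω)
  have hΛinv : Λ * Λ⁻¹ = 1 := Matrix.mul_nonsing_inv _ ((Matrix.isUnit_iff_isUnit_det _).1 hΛ.isUnit)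
  have e1 : act G (c t ω) - r • act G (y t ω) = act G (c t ω - r • y t ω) := by
    simp only [map_sub, map_smul]
  rw [e1, heq, cumulative_act G hyint, h2, act_add, act_add, ← act_mul, ← act_mul, ← act_mul,
    ← act_mul, ← act_mul, ← hSG]
  congr 1
  rw [show Λ * G * (H * Λ⁻¹) = Λ * (G * H) * Λ⁻¹ by simp only [mul_assoc], hGH, mul_one, hΛinv,
    act_one]

end LinearSystemVector

/-! ### The mean-variance functional and its exact second-order expansion. -/

section Quadratic

set_option linter.unusedSectionVars false

variable {Ω : Type*} {mΩ : MeasurableSpace Ω} {T : ℝ} {d : ℕ} {P : Measure Ω}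
  [IsProbabilityMeasure P]

/-- Turns optimality along a line into stationarity without any differentiation; the sign of `Q` is
left open. -/
lemma eq_zero_of_forall_quadratic {D Q : ℝ} (h : ∀ ε : ℝ, ε * D + ε ^ 2 * Q ≤ 0) : D = 0 := by
  by_contra hD
  have hD2 : 0 < D ^ 2 := by positivity
  rcases le_or_gt 0 Q with hQ | hQ
  · have h1 := h D
    nlinarith [mul_nonneg hD2.le hQ]
  · have h1 := h (D / (-2 * Q))
    have h2 : D / (-2 * Q) * D + (D / (-2 * Q)) ^ 2 * Q = D ^ 2 / (-4 * Q) := by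
      field_simp
      ring
    rw [h2] at h1
    have : 0 < D ^ 2 / (-4 * Q) := div_pos hD2 (by linarith)
    linarith

lemma inner_act_comm {A : Matrix (Fin d) (Fin d) ℝ} (hA : A.IsHermitian) (x y : Vec d) :
    inner ℝ x (act A y) = inner ℝ y (act A x) := by
  have h := (Matrix.isSymmetric_toEuclideanLin_iff.2 hA) y x
  rw [← h, real_inner_comm]

lemma inner_act_nonneg {A : Matrix (Fin d) (Fin d) ℝ} (hA : A.PosDef) (x : Vec d) :
    0 ≤ inner ℝ x (act A x) := by
  have h := hA.posSemidef.dotProduct_mulVec_nonneg (x.ofLp)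
  simp only [act, EuclideanSpace.inner_eq_star_dotProduct, Matrix.toLpLin_apply]
  rw [dotProduct_comm]
  simpa using h

/-- The discounted mean-variance functional of the demand `φ` at trading rate `θ`. -/
def gain (P : Measure Ω) (r : ℝ) (S Λ : Matrix (Fin d) (Fin d) ℝ) (c : ℝ)
    (z ν φ θ : Proc T Ω d) : ℝ :=
  discounted P r fun t ω => inner ℝ (φ t ω) (ν t ω)
    - 1 / (2 * c) * inner ℝ (φ t ω + z t ω) (act S (φ t ω + z t ω))
    - inner ℝ (θ t ω) (act Λ (θ t ω))

/-- The first variation of `gain`. -/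
def gainDeriv (P : Measure Ω) (r : ℝ) (S Λ : Matrix (Fin d) (Fin d) ℝ) (c : ℝ)
    (z ν φ θ κ x η : Proc T Ω d) : ℝ :=
  discounted P r fun t ω => inner ℝ (x t ω) (ν t ω) + inner ℝ (φ t ω) (κ t ω)
    - 1 / c * inner ℝ (x t ω) (act S (φ t ω + z t ω)) - 2 * inner ℝ (η t ω) (act Λ (θ t ω))

/-- Half of the second variation of `gain`. -/
def gainHess (P : Measure Ω) (r : ℝ) (S Λ : Matrix (Fin d) (Fin d) ℝ) (c : ℝ)
    (κ x η : Proc T Ω d) : ℝ :=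
  discounted P r fun t ω => inner ℝ (x t ω) (κ t ω)
    - 1 / (2 * c) * inner ℝ (x t ω) (act S (x t ω)) - inner ℝ (η t ω) (act Λ (η t ω))

variable {S Λ : Matrix (Fin d) (Fin d) ℝ} {z ν φ θ κ x η : Proc T Ω d}

lemma jointInt_gain (c : ℝ) (hz : SqInt P z) (hν : SqInt P ν) (hφ : SqInt P φ) (hθ : SqInt P θ) :
    JointInt P fun t ω => inner ℝ (φ t ω) (ν t ω)
      - 1 / (2 * c) * inner ℝ (φ t ω + z t ω) (act S (φ t ω + z t ω))
      - inner ℝ (θ t ω) (act Λ (θ t ω)) :=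
  ((hφ.inner hν).sub (((hφ.add hz).inner ((hφ.add hz).act S)).const_mul _)).sub
    (hθ.inner (hθ.act Λ))

/-- The functional is quadratic, so the expansion has no remainder. The returns are varied too, in
direction `κ`, to accommodate price impact. -/
lemma gain_add_smul (hS : S.IsHermitian) (hΛ : Λ.IsHermitian) (r c ε : ℝ) (hz : SqInt P z)
    (hν : SqInt P ν) (hφ : SqInt P φ) (hθ : SqInt P θ) (hκ : SqInt P κ) (hx : SqInt P x)
    (hη : SqInt P η) :
    gain P r S Λ c z (fun t ω => ν t ω + ε • κ t ω) (fun t ω => φ t ω + ε • x t ω)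
      (fun t ω => θ t ω + ε • η t ω) =
    gain P r S Λ c z ν φ θ + ε * gainDeriv P r S Λ c z ν φ θ κ x η
      + ε ^ 2 * gainHess P r S Λ c κ x η := by
  have i1 := jointInt_gain (S := S) (Λ := Λ) c hz hν hφ hθ
  have i2 : JointInt P fun t ω => inner ℝ (x t ω) (ν t ω) + inner ℝ (φ t ω) (κ t ω)
      - 1 / c * inner ℝ (x t ω) (act S (φ t ω + z t ω)) - 2 * inner ℝ (η t ω) (act Λ (θ t ω)) :=
    (((hx.inner hν).add (hφ.inner hκ)).sub ((hx.inner ((hφ.add hz).act S)).const_mul _)).sub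
      ((hη.inner (hθ.act Λ)).const_mul _)
  have i3 : JointInt P fun t ω => inner ℝ (x t ω) (κ t ω)
      - 1 / (2 * c) * inner ℝ (x t ω) (act S (x t ω)) - inner ℝ (η t ω) (act Λ (η t ω)) :=
    ((hx.inner hκ).sub ((hx.inner (hx.act S)).const_mul _)).sub (hη.inner (hη.act Λ))
  unfold gain gainDeriv gainHess
  rw [← discounted_const_mul, ← discounted_const_mul, ← discounted_add i1 (i2.const_mul ε),
    ← discounted_add (i1.add (i2.const_mul ε)) (i3.const_mul (ε ^ 2))]
  congr 1
  ext t ω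
  have s1 := inner_act_comm hS (φ t ω) (x t ω)
  have s2 := inner_act_comm hS (z t ω) (x t ω)
  have s3 := inner_act_comm hΛ (θ t ω) (η t ω)
  simp only [map_add, map_smul, inner_add_left, inner_add_right, real_inner_smul_left,
    real_inner_smul_right, s1, s2, s3]
  -- For `c = 0` all reciprocals are zero by convention and the risk terms drop out on both sides.
  by_cases hc : c = 0
  · subst hc
    simp only [mul_zero, div_zero, zero_mul]
    ring
  · field_simp
    ring

lemma gain_congr (r c : ℝ) {ν' φ' θ' : Proc T Ω d} (hν : JointEq P ν ν') (hφ : JointEq P φ φ')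
    (hθ : JointEq P θ θ') : gain P r S Λ c z ν φ θ = gain P r S Λ c z ν' φ' θ' := by
  refine discounted_congr ?_ r
  filter_upwards [hν, hφ, hθ] with p h1 h2 h3
  rw [h1, h2, h3]

protected lemma JointEq.rfl {β : Type*} {f : Horizon T → Ω → β} : JointEq P f f :=
  Eventually.of_forall fun _ => rfl

end Quadratic

end PriceImpact

end

/-! ### First-order conditions and equilibrium without transaction costs. -/

noncomputable section

namespace PriceImpact

section FrictionlessStationarity

set_option linter.unusedSectionVars false

variable {Ω : Type*} {mΩ : MeasurableSpace Ω} {T : ℝ} {d : ℕ} {P : Measure Ω}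
  [IsProbabilityMeasure P] {F : Filtration (Horizon T) mΩ}

lemma sqInt_zero : SqInt (T := T) (d := d) P fun _ _ => 0 := MemLp.zero'

lemma inner_smul_act_nonneg {S : Matrix (Fin d) (Fin d) ℝ} (hS : S.PosDef) {c : ℝ} (hc : 0 ≤ c)
    (x : Vec d) : 0 ≤ inner ℝ x (act (c • S) x) := by
  rw [act_smul_matrix, real_inner_smul_right]
  exact mul_nonneg hc (inner_act_nonneg hS x)

lemma isHermitian_smul {S : Matrix (Fin d) (Fin d) ℝ} (hS : S.PosDef) (c : ℝ) :
    (c • S).IsHermitian := by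
  rw [Matrix.IsHermitian, Matrix.conjTranspose_smul, hS.isHermitian.eq]
  rfl

lemma discounted_inner_eq_zero {x G : Proc T Ω d} (h : JointEq P G fun _ _ => 0) {r : ℝ} :
    discounted P r (fun t ω => inner ℝ (x t ω) (G t ω)) = 0 := by
  refine integral_eq_zero_of_ae ?_
  filter_upwards [h] with p hp
  simp [hp]

/-- The first-order condition for the mean-variance functional when a change `x` of the demand
moves the returns by `-A x`. -/
theorem gain_le_iff (hT : 0 < T) {S A : Matrix (Fin d) (Fin d) ℝ} (hS : S.PosDef)
    (hA : A.IsHermitian) (hA0 : ∀ x, 0 ≤ inner ℝ x (act A x)) (r : ℝ) {c : ℝ} (hc : 0 < c)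
    {z ν φ : Proc T Ω d} (hz : MemH2 P F z) (hν : MemH2 P F ν) (hφ : MemH2 P F φ) :
    (∀ x, MemH2 P F x → gain P r S 0 c z (fun t ω => ν t ω - act A (x t ω))
      (fun t ω => φ t ω + x t ω) (fun _ _ => 0) ≤ gain P r S 0 c z ν φ fun _ _ => 0) ↔
    EqAE P ν fun t ω => act A (φ t ω) + c⁻¹ • act S (φ t ω + z t ω) := by
  -- The gradient at `φ`; the term in `A` is the effect of the demand on the returns at which it is
  -- held, moved onto `x` by symmetry.
  let G : Proc T Ω d := fun t ω => ν t ω - (act A (φ t ω) + c⁻¹ • act S (φ t ω + z t ω))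
  have hG : MemH2 P F G := hν.sub hT ((hφ.act hT A).add hT (((hφ.add hT hz).act hT S).const_smul hT _))
  have hexp : ∀ x, MemH2 P F x → ∀ ε : ℝ,
      gain P r S 0 c z (fun t ω => ν t ω - act A ((ε • x t ω)))
        (fun t ω => φ t ω + ε • x t ω) (fun _ _ => 0) = gain P r S 0 c z ν φ (fun _ _ => 0) +
        ε * discounted P r (fun t ω => inner ℝ (x t ω) (G t ω)) +
        ε ^ 2 * gainHess P r S 0 c (fun t ω => -act A (x t ω)) x fun _ _ => 0 := by
    intro x hx ε
    have hx2 := hx.sqInt hT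
    have hκ : SqInt P fun t ω => -act A (x t ω) := (hx2.act A).neg
    have h := gain_add_smul (Λ := 0) hS.isHermitian Matrix.isHermitian_zero r c ε (hz.sqInt hT)
      (hν.sqInt hT) (hφ.sqInt hT) sqInt_zero hκ hx2 sqInt_zero
    have hd : gainDeriv P r S 0 c z ν φ (fun _ _ => 0) (fun t ω => -act A (x t ω)) x
        (fun _ _ => 0) = discounted P r (fun t ω => inner ℝ (x t ω) (G t ω)) := by
      unfold gainDeriv
      congr 1
      ext t ω
      simp only [G, inner_neg_right, inner_sub_right, inner_add_right, real_inner_smul_right,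
        inner_act_comm hA (φ t ω) (x t ω), inner_zero_left]
      ring
    rw [hd] at h
    rw [← h]
    simp only [act_smul, smul_neg, sub_eq_add_neg, smul_zero, add_zero]
  have hneg : ∀ x : Proc T Ω d, gainHess P r S 0 c (fun t ω => -act A (x t ω)) x (fun _ _ => 0) ≤ 0 := by
    intro x
    refine integral_nonpos fun p => mul_nonpos_of_nonneg_of_nonpos (Real.exp_pos _).le ?_
    have h1 := hA0 (x p.2 p.1)
    have h2 := mul_nonneg (by positivity : 0 ≤ 1 / (2 * c)) (inner_act_nonneg hS (x p.2 p.1))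
    simp only [inner_neg_right, inner_zero_left]
    linarith
  constructor
  · intro h
    -- The gradient is itself an admissible direction, so stationarity along it gives a vanishing
    -- norm.
    have h0 : discounted P r (fun t ω => inner ℝ (G t ω) (G t ω)) = 0 := by
      refine eq_zero_of_forall_quadratic
        (Q := gainHess P r S 0 c (fun t ω => -act A (G t ω)) G fun _ _ => 0) fun ε => ?_
      have h1 := h _ (hG.const_smul hT ε)
      rw [hexp G hG ε] at h1
      linarith
    filter_upwards [((discounted_eq_zero_iff (hG.sqInt hT) r).1 h0).eqAE] with ω h1
    filter_upwards [h1] with t h2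
    exact sub_eq_zero.1 h2
  · intro h x hx
    have h1 := hexp x hx 1
    simp only [one_smul, one_mul, one_pow] at h1
    have h2 := h.jointEq hT hν.1
      ((hφ.act hT A).add hT (((hφ.add hT hz).act hT S).const_smul hT c⁻¹)).1
    have h3 : JointEq P G fun _ _ => 0 := by
      filter_upwards [h2] with p hp
      simp only [G, ← hp, sub_self]
    rw [h1, discounted_inner_eq_zero h3]
    linarith [hneg x]

end FrictionlessStationarity

namespace Market

section Frictionless

variable {Ω : Type*} [MeasurableSpace Ω] {d : ℕ} {P : Measure Ω} [IsProbabilityMeasure P]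

lemma objective_eq_gain {N : ℕ} (K : Market Ω d N) (m : Fin N) {z ν φ : Proc K.T Ω d}
    (hz : SqInt P z) (hν : SqInt P ν) (hφ : SqInt P φ) :
    K.objective P m z ν φ = gain P K.r K.cov 0 (K.δ m) z ν φ fun _ _ => 0 := by
  rw [gain, discounted_eq_integral (jointInt_gain _ hz hν hφ sqInt_zero), objective]
  simp only [inner_zero_left, sub_zero]

lemma isPriceTakerDemand_iff {N : ℕ} (K : Market Ω d N) (hT : 0 < K.T) (hcov : K.cov.PosDef)
    {m : Fin N} (hδ : 0 < K.δ m) {z ν φ : Proc K.T Ω d} (hz : MemH2 P (K.filtration P) z)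
    (hν : MemH2 P (K.filtration P) ν) :
    K.IsPriceTakerDemand P m z ν φ ↔ MemH2 P (K.filtration P) φ ∧
      EqAE P ν fun t ω => (K.δ m)⁻¹ • act K.cov (φ t ω + z t ω) := by
  refine and_congr_right fun hφ => ?_
  have h := gain_le_iff hT hcov (A := 0) Matrix.isHermitian_zero
    (fun x => by simp [act]) K.r hδ hz hν hφ
  have h0 : ∀ x : Vec d, act (0 : Matrix (Fin d) (Fin d) ℝ) x = 0 := fun x => by simp [act]
  simp only [h0, sub_zero, zero_add] at h
  rw [← h]
  have hz2 := hz.sqInt hT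
  have hν2 := hν.sqInt hT
  rw [K.objective_eq_gain m hz2 hν2 (hφ.sqInt hT)]
  constructor
  · intro H x hx
    have := H _ (hφ.add hT hx)
    rwa [K.objective_eq_gain m hz2 hν2 ((hφ.add hT hx).sqInt hT)] at this
  · intro H η hη
    have := H _ (hη.sub hT hφ)
    rw [K.objective_eq_gain m hz2 hν2 (hη.sqInt hT)]
    simpa only [add_sub_cancel] using this

variable (K : Market Ω d 2)

lemma sum_two {β : Type*} [AddCommMonoid β] (f : Fin 2 → β) {n j : Fin 2} (h : n ≠ j) :
    ∑ m, f m = f n + f j := by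
  rw [Fin.sum_univ_two]
  fin_cases n <;> fin_cases j <;> simp_all [add_comm]

lemma eq_of_ne_of_ne {m n j : Fin 2} (h : n ≠ j) (hm : m ≠ n) : m = j := by omega

variable {K}

/-- Clearing leaves the other investor the demand -φ - ψ, and her first-order condition then gives
the returns. So the price impact exists and is unique up to null sets. -/
lemma isPriceImpact_iff (hT : 0 < K.T) (hcov : K.cov.PosDef) (hδ : ∀ m, 0 < K.δ m)
    (hψ : MemH2 P (K.filtration P) K.ψ) {n j : Fin 2} (hnj : n ≠ j) {z : Fin 2 → Proc K.T Ω d}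
    (hz : MemH2 P (K.filtration P) (z j)) {φ ν : Proc K.T Ω d}
    (hφ : MemH2 P (K.filtration P) φ) :
    K.IsPriceImpact P n z φ ν ↔ MemH2 P (K.filtration P) ν ∧
      EqAE P ν fun t ω => (K.δ j)⁻¹ • act K.cov (z j t ω - φ t ω - K.ψ t ω) := by
  refine and_congr_right fun hν => ?_
  constructor
  · rintro ⟨Φ, hΦn, hΦ, hcl⟩
    obtain ⟨-, h⟩ := (K.isPriceTakerDemand_iff hT hcov (hδ j) hz hν).1 (hΦ j hnj.symm)
    filter_upwards [h, hcl] with ω h1 h2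
    filter_upwards [h1, h2] with t h3 h4
    rw [sum_two _ hnj, hΦn] at h4
    have h5 : Φ j t ω = -(φ t ω + K.ψ t ω) := by
      rw [eq_neg_iff_add_eq_zero, ← add_assoc, add_comm (Φ j t ω)]
      exact h4
    rw [h3, h5]
    congr 2
    abel
  · intro h
    let Φ : Fin 2 → Proc K.T Ω d := fun m => if m = n then φ else fun t ω => (-1 : ℝ) • (φ t ω + K.ψ t ω)
    have hΦn : Φ n = φ := if_pos rfl
    have hΦj : Φ j = fun t ω => (-1 : ℝ) • (φ t ω + K.ψ t ω) := if_neg hnj.symm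
    refine ⟨Φ, hΦn, fun m hm => ?_, ?_⟩
    · obtain rfl := eq_of_ne_of_ne hnj hm
      rw [K.isPriceTakerDemand_iff hT hcov (hδ m) hz hν, hΦj]
      refine ⟨(hφ.add hT hψ).const_smul hT _, ?_⟩
      filter_upwards [h] with ω h1
      filter_upwards [h1] with t h2
      rw [h2]
      congr 2
      rw [neg_one_smul]
      abel
    · refine eqAE_of_forall (Eventually.of_forall fun ω t => ?_)
      rw [sum_two _ hnj, hΦn, hΦj]
      simp

/-- The impact is affine in the demand with slope -δ_j⁻¹Σ, so this is `gain_le_iff` with A = δ_j⁻¹Σ.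
-/
lemma isBestResponse_iff (hT : 0 < K.T) (hcov : K.cov.PosDef) (hδ : ∀ m, 0 < K.δ m)
    (hψ : MemH2 P (K.filtration P) K.ψ) {n j : Fin 2} (hnj : n ≠ j)
    (hζ : MemH2 P (K.filtration P) (K.ζ n)) {z : Fin 2 → Proc K.T Ω d}
    (hz : MemH2 P (K.filtration P) (z j)) {φ : Proc K.T Ω d} :
    K.IsBestResponse P n z φ ↔ MemH2 P (K.filtration P) φ ∧
      EqAE P (fun t ω => (K.δ j)⁻¹ • act K.cov (z j t ω - φ t ω - K.ψ t ω))
        fun t ω => (K.δ j)⁻¹ • act K.cov (φ t ω) + (K.δ n)⁻¹ • act K.cov (φ t ω + K.ζ n t ω) := by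
  refine and_congr_right fun hφ => ?_
  let impact : Proc K.T Ω d → Proc K.T Ω d := fun φ t ω =>
    (K.δ j)⁻¹ • act K.cov (z j t ω - φ t ω - K.ψ t ω)
  have himp : ∀ φ, MemH2 P (K.filtration P) φ → MemH2 P (K.filtration P) (impact φ) := fun φ hφ =>
    (((hz.sub hT hφ).sub hT hψ).act hT K.cov).const_smul hT _
  have hval : ∀ φ ν, MemH2 P (K.filtration P) φ → K.IsPriceImpact P n z φ ν →
      K.objective P n (K.ζ n) ν φ =
        gain P K.r K.cov 0 (K.δ n) (K.ζ n) (impact φ) φ fun _ _ => 0 := by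
    intro φ ν hφ hν
    obtain ⟨hν2, he⟩ := (isPriceImpact_iff hT hcov hδ hψ hnj hz hφ).1 hν
    rw [K.objective_eq_gain n (hζ.sqInt hT) (hν2.sqInt hT) (hφ.sqInt hT)]
    exact gain_congr _ _ (he.jointEq hT hν2.1 (himp φ hφ).1) .rfl .rfl
  have hex : ∀ φ, MemH2 P (K.filtration P) φ → K.IsPriceImpact P n z φ (impact φ) := fun φ hφ =>
    (isPriceImpact_iff hT hcov hδ hψ hnj hz hφ).2 ⟨himp φ hφ, eqAE_of_forall (by simp [impact])⟩
  have hFOC := gain_le_iff hT hcov (A := (K.δ j)⁻¹ • K.cov) (isHermitian_smul hcov _)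
    (inner_smul_act_nonneg hcov (inv_pos.2 (hδ j)).le) K.r (hδ n) hζ (himp φ hφ) hφ
  simp only [act_smul_matrix] at hFOC
  rw [← hFOC]
  have hshift : ∀ x : Proc K.T Ω d, (fun t ω => impact φ t ω - (K.δ j)⁻¹ • act K.cov (x t ω)) =
      impact fun t ω => φ t ω + x t ω := by
    intro x
    ext1 t
    ext1 ω
    simp only [impact]
    rw [← smul_sub, ← act_sub]
    congr 2
    abel
  simp only [hshift]
  constructor
  · rintro ⟨ν, hν, h⟩ x hx
    have h1 := h _ _ (hφ.add hT hx) (hex _ (hφ.add hT hx))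
    rwa [hval _ _ (hφ.add hT hx) (hex _ (hφ.add hT hx)), hval _ _ hφ hν] at h1
  · intro h
    refine ⟨_, hex φ hφ, fun φ' ν' hφ' hν' => ?_⟩
    rw [hval _ _ hφ' hν', hval _ _ hφ (hex φ hφ)]
    simpa only [add_sub_cancel] using h _ (hφ'.sub hT hφ)

/-- Consistency of the revealed exposures: under clearing, the costless price impact at the revealed
exposure returns the given `ν`. The equilibrium conditions thereby become equations in `ν` and the
demands only. -/
lemma act_cov_revealedExposure (hcov : K.cov.PosDef) {n j : Fin 2} (hnj : n ≠ j)
    (hδ : 0 < K.δ j) {ν : Proc K.T Ω d} {φ : Fin 2 → Proc K.T Ω d} {t : Horizon K.T} {ω : Ω}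
    (h : (∑ m, φ m t ω) + K.ψ t ω = 0) :
    (K.δ j)⁻¹ • act K.cov (K.revealedExposure ν φ j t ω - φ n t ω - K.ψ t ω) = ν t ω := by
  have e : K.revealedExposure ν φ j t ω - φ n t ω - K.ψ t ω = K.δ j • act K.cov⁻¹ (ν t ω) := by
    rw [sum_two _ hnj] at h
    rw [revealedExposure, ← sub_eq_zero, ← neg_eq_zero, ← h]
    abel
  rw [e, act_smul, inv_smul_smul₀ hδ.ne', ← act_mul,
    Matrix.mul_nonsing_inv _ ((Matrix.isUnit_iff_isUnit_det _).1 hcov.isUnit), act_one]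

/-- The frictionless equilibrium returns in terms of the individual risk tolerances. -/
lemma frictionlessReturns_eq (hδ : ∀ m, 0 < K.δ m) (t : Horizon K.T) (ω : Ω) :
    K.frictionlessReturns t ω = (1 / 2 : ℝ) • ((K.δ 0)⁻¹ • act K.cov (K.ζ 0 t ω) +
      (K.δ 1)⁻¹ • act K.cov (K.ζ 1 t ω) - ((K.δ 0)⁻¹ + (K.δ 1)⁻¹) • act K.cov (K.ψ t ω)) := by
  have h0 := hδ 0
  have h1 := hδ 1
  have hne : K.δ 0 + K.δ 1 ≠ 0 := by positivity
  -- For two investors λ₀ + λ₁ = 1, so 1 - ∑ λ_m² = 2λ₀λ₁.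
  have hc : K.totalTolerance * (1 - ∑ m, K.relTolerance m ^ 2) =
      2 * K.δ 0 * K.δ 1 / (K.δ 0 + K.δ 1) := by
    simp only [relTolerance, totalTolerance, Fin.sum_univ_two]
    field_simp
    ring
  rw [frictionlessReturns, hc]
  simp only [relTolerance, totalTolerance, Fin.sum_univ_two, act_sub, act_add, act_smul]
  set x := act K.cov (K.ζ 0 t ω)
  set y := act K.cov (K.ζ 1 t ω)
  set w := act K.cov (K.ψ t ω)
  match_scalars <;> field_simp <;> ring

lemma memHInfty_frictionlessReturns (hδ : ∀ m, 0 < K.δ m)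
    (hζ : ∀ m, MemHInfty P (K.filtration P) (K.ζ m)) (hψ : MemHInfty P (K.filtration P) K.ψ) :
    MemHInfty P (K.filtration P) K.frictionlessReturns := by
  rw [show K.frictionlessReturns = _ from funext fun t => funext fun ω =>
    frictionlessReturns_eq hδ t ω]
  exact (((((hζ 0).act _).const_smul _).add (((hζ 1).act _).const_smul _)).sub
    ((hψ.act _).const_smul _)).const_smul _

lemma memH2_revealedExposure (hT : 0 < K.T) {ν : Proc K.T Ω d} {φ : Fin 2 → Proc K.T Ω d}
    (hν : MemH2 P (K.filtration P) ν) {m : Fin 2} (hφ : MemH2 P (K.filtration P) (φ m)) :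
    MemH2 P (K.filtration P) (K.revealedExposure ν φ m) :=
  ((hν.act hT _).const_smul hT _).sub hT hφ

theorem frictionlessReturns_isNash (hT : 0 < K.T) (hcov : K.cov.PosDef) (hδ : ∀ m, 0 < K.δ m)
    (hζ : ∀ m, MemHInfty P (K.filtration P) (K.ζ m)) (hψ : MemHInfty P (K.filtration P) K.ψ) :
    K.IsFrictionlessNashReturns P K.frictionlessReturns := by
  have hζ2 := fun m => (hζ m).memH2 hT
  have hψ2 := hψ.memH2 hT
  have hν := (memHInfty_frictionlessReturns hδ hζ hψ).memH2 hT
  have h0 := hδ 0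
  have h1 := hδ 1
  set ν := K.frictionlessReturns
  let c := (K.δ 0)⁻¹ + (K.δ 1)⁻¹
  have hc : c ≠ 0 := by positivity
  -- The first-order condition ν = cΣφ_m + δ_m⁻¹Σζ_m solved for φ_m; the formula for `ν` is exactly
  -- what makes these demands clear.
  let φ : Fin 2 → Proc K.T Ω d := fun m t ω =>
    c⁻¹ • (act K.cov⁻¹ (ν t ω) - (K.δ m)⁻¹ • K.ζ m t ω)
  have hφ : ∀ m, MemH2 P (K.filtration P) (φ m) := fun m =>
    ((hν.act hT _).sub hT ((hζ2 m).const_smul hT _)).const_smul hT _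
  have hdet := (Matrix.isUnit_iff_isUnit_det _).1 hcov.isUnit
  have hinv : ∀ x : Vec d, act K.cov⁻¹ (act K.cov x) = x := fun x => by
    rw [← act_mul, Matrix.nonsing_inv_mul _ hdet, act_one]
  have hinv' : ∀ x : Vec d, act K.cov (act K.cov⁻¹ x) = x := fun x => by
    rw [← act_mul, Matrix.mul_nonsing_inv _ hdet, act_one]
  have hcl : ∀ t ω, (∑ m, φ m t ω) + K.ψ t ω = 0 := by
    intro t ω
    simp only [Fin.sum_univ_two, φ, ν, frictionlessReturns_eq hδ, act_sub, act_add, act_smul, hinv]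
    match_scalars <;> simp only [c] <;> field_simp <;> ring
  refine ⟨hν, φ, fun n => ?_, eqAE_of_forall (Eventually.of_forall fun ω t => hcl t ω)⟩
  obtain ⟨j, hnj⟩ := exists_ne n
  rw [isBestResponse_iff hT hcov hδ hψ2 hnj.symm (hζ2 n) (memH2_revealedExposure hT hν (hφ j))]
  refine ⟨hφ n, eqAE_of_forall (Eventually.of_forall fun ω t => ?_)⟩
  rw [act_cov_revealedExposure hcov hnj.symm (hδ j) (hcl t ω)]
  have hsum : (K.δ n)⁻¹ + (K.δ j)⁻¹ = c := (sum_two (fun m => (K.δ m)⁻¹) hnj.symm).symm.trans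
    (Fin.sum_univ_two _)
  rw [act_add, smul_add, ← add_assoc, ← add_smul, add_comm _ (K.δ n)⁻¹, hsum]
  simp only [φ, act_smul, act_sub, hinv', smul_inv_smul₀ hc]
  abel

/-- In both first-order conditions the demand has the coefficient (δ₀⁻¹ + δ₁⁻¹)Σ, so their average
involves only the aggregate demand -ψ. -/
theorem IsFrictionlessNashReturns.eqAE (hT : 0 < K.T) (hcov : K.cov.PosDef)
    (hδ : ∀ m, 0 < K.δ m) (hζ : ∀ m, MemHInfty P (K.filtration P) (K.ζ m))
    (hψ : MemHInfty P (K.filtration P) K.ψ) {ν : Proc K.T Ω d}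
    (h : K.IsFrictionlessNashReturns P ν) : EqAE P ν K.frictionlessReturns := by
  obtain ⟨hν, φ, hbr, hcl⟩ := h
  have hφ := fun n => (hbr n).1
  have hfoc : ∀ n j : Fin 2, n ≠ j → EqAE P ν fun t ω =>
      (K.δ j)⁻¹ • act K.cov (φ n t ω) + (K.δ n)⁻¹ • act K.cov (φ n t ω + K.ζ n t ω) := by
    intro n j hnj
    refine EqAE.trans ?_ ((isBestResponse_iff hT hcov hδ (hψ.memH2 hT) hnj ((hζ n).memH2 hT)
      (memH2_revealedExposure hT hν (hφ j))).1 (hbr n)).2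
    filter_upwards [hcl] with ω h1
    filter_upwards [h1] with t h2
    exact (act_cov_revealedExposure hcov hnj (hδ j) h2).symm
  filter_upwards [hfoc 0 1 zero_ne_one, hfoc 1 0 one_ne_zero, hcl] with ω h1 h2 h3
  filter_upwards [h1, h2, h3] with t e0 e1 e2
  have e3 : φ 1 t ω = -φ 0 t ω - K.ψ t ω := by
    rw [Fin.sum_univ_two] at e2
    rw [← sub_eq_zero]
    refine Eq.trans ?_ e2
    abel
  have e4 : ν t ω = (1 / 2 : ℝ) • (ν t ω + ν t ω) := by module
  rw [frictionlessReturns_eq hδ, e4]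
  nth_rw 1 [e0]
  rw [e1, e3]
  have hneg : act K.cov (-φ 0 t ω) = -act K.cov (φ 0 t ω) := map_neg _ _
  simp only [act_add, act_sub, hneg]
  module

end Frictionless

end Market

end PriceImpact

end

/-! ### First-order conditions with transaction costs. -/

noncomputable section

namespace PriceImpact

section CostStationarity

set_option linter.unusedSectionVars false

variable {Ω : Type*} {mΩ : MeasurableSpace Ω} {T : ℝ} {d : ℕ} {P : Measure Ω}
  [IsProbabilityMeasure P] {F : Filtration (Horizon T) mΩ}

lemma isOptional_zero : IsOptional (d := d) F fun _ _ => 0 :=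
  @measurable_const _ _ _ (optionalSigma F) _

lemma jointEq_of_forall {X Y : Proc T Ω d} (h : ∀ᵐ ω ∂P, ∀ t, X t ω = Y t ω) : JointEq P X Y :=
  (Measure.quasiMeasurePreserving_fst.ae h).mono fun p hp => hp p.2

lemma MemAWithDrift.integrable_path {X a : Proc T Ω d} (hX : MemAWithDrift P F X a) (ω : Ω) :
    Integrable (fun t => X t ω) (leb T) :=
  integrable_of_continuous (hX.continuous_paths ω)

lemma MemAWithDrift.memHInfty_cumulative (hT : 0 < T) {X a : Proc T Ω d}
    (hX : MemAWithDrift P F X a) : MemHInfty P F (cumulative X) := by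
  obtain ⟨C, hC⟩ := hX.ae_bounded hT
  refine ⟨isOptional_cumulative hT hX.bounded.1 hX.integrable_path,
    C * (leb T).real Set.univ, ?_⟩
  filter_upwards [hC] with ω hω
  exact Eventually.of_forall fun t => norm_primitive_le hω t

lemma MemAWithDrift.sub (hT : 0 < T) {X Y a b : Proc T Ω d} (hX : MemAWithDrift P F X a)
    (hY : MemAWithDrift P F Y b) :
    MemAWithDrift P F (fun t ω => X t ω - Y t ω) (fun t ω => a t ω - b t ω) := by
  simpa [sub_eq_add_neg] using hX.add hT (hY.const_smul hT (-1))

lemma cumulative_add {X Y : Proc T Ω d} {ω : Ω} (hX : Integrable (fun t => X t ω) (leb T))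
    (hY : Integrable (fun t => Y t ω) (leb T)) (t : Horizon T) :
    cumulative (fun t ω => X t ω + Y t ω) t ω = cumulative X t ω + cumulative Y t ω :=
  primitive_add hX hY t

lemma cumulative_neg {X : Proc T Ω d} (t : Horizon T) (ω : Ω) :
    cumulative (fun t ω => -X t ω) t ω = -cumulative X t ω :=
  integral_neg _

lemma discounted_inner_act_drift (hT : 0 < T) {θ a η : Proc T Ω d} (hθ : MemAWithDrift P F θ a)
    (hη : MemH2 P F η) (r : ℝ) (Λ : Matrix (Fin d) (Fin d) ℝ) :
    discounted P r (fun t ω => inner ℝ (cumulative η t ω) (act Λ (a t ω - r • θ t ω))) =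
      -discounted P r (fun t ω => inner ℝ (η t ω) (act Λ (θ t ω))) := by
  simpa only [act_sub, act_smul] using discounted_cumulative_drift hT (hθ.act hT Λ) hη r

/-- The drift of a process of class `𝒜` is unique. -/
lemma MemAWithDrift.drift_eq_zero (hT : 0 < T) {W : Proc T Ω d} (hB : IsBrownianMotion P W)
    {X a : Proc T Ω d} (h : MemAWithDrift P (augmentedFiltration P W hB.measurable) X a)
    (h0 : ∀ᵐ ω ∂P, ∀ t, X t ω = 0) : EqAE P a fun _ _ => 0 := by
  have hX0 : JointEq P X fun _ _ => 0 := jointEq_of_forall h0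
  -- Integration by parts with the zero process and rate `r = 0` shows that the drift is orthogonal
  -- to all demands of class `𝒜`.
  refine eqAE_zero_of_orthogonal hT hB h.drift_bounded 0 fun η e hη => ?_
  have h1 := discounted_cumulative_drift hT h (hη.memH2 hT) 0
  rw [discounted_inner_eq_zero hX0, neg_zero] at h1
  simpa only [zero_smul, sub_zero] using h1

section Gain

variable {S Λ : Matrix (Fin d) (Fin d) ℝ} {z ν θ a η κ : Proc T Ω d}

/-- Integration by parts turns the cost variation -2⟨η, Λθ⟩ into 2⟨∫η, Λ(a - rθ)⟩, so that, apart
from the response `κ` of the returns, the first variation sees the change of the rate only through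
the change of the demand. -/
lemma gain_add_rate (hT : 0 < T) (hS : S.PosDef) (hΛ : Λ.PosDef) (r c ε : ℝ) (hz : MemH2 P F z)
    (hν : MemH2 P F ν) (hθ : MemAWithDrift P F θ a) (hη : MemH2 P F η) (hκ : SqInt P κ) :
    gain P r S Λ c z (fun t ω => ν t ω + ε • κ t ω)
      (fun t ω => cumulative θ t ω + ε • cumulative η t ω) (fun t ω => θ t ω + ε • η t ω) =
    gain P r S Λ c z ν (cumulative θ) θ +
      ε * (discounted P r (fun t ω => inner ℝ (cumulative η t ω) (ν t ω
        - c⁻¹ • act S (cumulative θ t ω + z t ω) + (2 : ℝ) • act Λ (a t ω - r • θ t ω))) +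
        discounted P r (fun t ω => inner ℝ (cumulative θ t ω) (κ t ω))) +
      ε ^ 2 * gainHess P r S Λ c κ (cumulative η) η := by
  have hz2 := hz.sqInt hT
  have hν2 := hν.sqInt hT
  have hθ2 := (hθ.memH2 hT).sqInt hT
  have hη2 := hη.sqInt hT
  have ha2 := (hθ.drift_bounded.memH2 hT).sqInt hT
  have hφ2 := hθ2.cumulative hT hθ.bounded.1
  have hx2 := hη2.cumulative hT hη.1
  rw [gain_add_smul hS.isHermitian hΛ.isHermitian r c ε hz2 hν2 hφ2 hθ2 hκ hx2 hη2]
  congr 3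
  have i1 : JointInt P fun t ω => inner ℝ (cumulative η t ω) (ν t ω) :=
    hx2.inner hν2
  have i2 : JointInt P fun t ω => inner ℝ (cumulative θ t ω) (κ t ω) := hφ2.inner hκ
  have i3 : JointInt P fun t ω =>
      inner ℝ (cumulative η t ω) (act S (cumulative θ t ω + z t ω)) :=
    hx2.inner ((hφ2.add hz2).act S)
  have i4 : JointInt P fun t ω => inner ℝ (η t ω) (act Λ (θ t ω)) := hη2.inner (hθ2.act Λ)
  have i5 : JointInt P fun t ω => inner ℝ (cumulative η t ω) (act Λ (a t ω - r • θ t ω)) :=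
    hx2.inner ((ha2.sub (hθ2.const_smul r)).act Λ)
  have h := discounted_inner_act_drift hT hθ hη r Λ
  simp only [gainDeriv, inner_add_right (cumulative η _ _), inner_sub_right,
    real_inner_smul_right, one_div]
  rw [discounted_sub ((i1.add i2).sub (i3.const_mul c⁻¹)) (i4.const_mul 2),
    discounted_sub (i1.add i2) (i3.const_mul c⁻¹), discounted_add i1 i2,
    discounted_add (i1.sub (i3.const_mul c⁻¹)) (i5.const_mul 2),
    discounted_sub i1 (i3.const_mul c⁻¹)]
  simp only [discounted_const_mul, h]
  ring

/-- The first-order condition for the mean-variance functional with transaction costs at fixed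
returns. -/
theorem gain_le_iff_of_cost (hT : 0 < T) {W : Proc T Ω d} (hB : IsBrownianMotion P W)
    (hF : F = augmentedFiltration P W hB.measurable) (hS : S.PosDef) (hΛ : Λ.PosDef) (r : ℝ)
    {c : ℝ} (hc : 0 < c) (hz : MemHInfty P F z) (hν : MemHInfty P F ν)
    (hθ : MemAWithDrift P F θ a) :
    (∀ η, MemH2 P F η → gain P r S Λ c z ν
      (fun t ω => cumulative θ t ω + cumulative η t ω) (fun t ω => θ t ω + η t ω) ≤
        gain P r S Λ c z ν (cumulative θ) θ) ↔
    EqAE P (fun t ω => ν t ω + (2 : ℝ) • act Λ (a t ω - r • θ t ω))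
      fun t ω => c⁻¹ • act S (cumulative θ t ω + z t ω) := by
  subst hF
  set F := augmentedFiltration P W hB.measurable
  let G : Proc T Ω d := fun t ω => ν t ω - c⁻¹ • act S (cumulative θ t ω + z t ω)
    + (2 : ℝ) • act Λ (a t ω - r • θ t ω)
  have hG : MemHInfty P F G := (hν.sub ((((hθ.memHInfty_cumulative hT).add hz).act S).const_smul
    c⁻¹)).add (((hθ.drift_bounded.sub (hθ.bounded.const_smul r)).act Λ).const_smul 2)
  have hexp : ∀ η, MemH2 P F η → ∀ ε : ℝ, gain P r S Λ c z ν
      (fun t ω => cumulative θ t ω + ε • cumulative η t ω) (fun t ω => θ t ω + ε • η t ω) =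
      gain P r S Λ c z ν (cumulative θ) θ +
        ε * discounted P r (fun t ω => inner ℝ (cumulative η t ω) (G t ω)) +
        ε ^ 2 * gainHess P r S Λ c (fun _ _ => 0) (cumulative η) η := by
    intro η hη ε
    have h := gain_add_rate hT hS hΛ r c ε (hz.memH2 hT) (hν.memH2 hT) hθ hη sqInt_zero
    have h0 : discounted P r (fun t ω => inner ℝ (cumulative θ t ω) (0 : Vec d)) = 0 := by
      simp [discounted]
    rw [h0, add_zero] at h
    simpa only [smul_zero, add_zero] using h
  have hneg : ∀ η : Proc T Ω d,
      gainHess P r S Λ c (fun _ _ => 0) (cumulative η) η ≤ 0 := by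
    intro η
    refine integral_nonpos fun p => mul_nonpos_of_nonneg_of_nonpos (Real.exp_pos _).le ?_
    have h1 := inner_act_nonneg hΛ (η p.2 p.1)
    have h2 := mul_nonneg (by positivity : 0 ≤ 1 / (2 * c))
      (inner_act_nonneg hS (cumulative η p.2 p.1))
    simp only [inner_zero_right]
    linarith
  have hiff : EqAE P (fun t ω => ν t ω + (2 : ℝ) • act Λ (a t ω - r • θ t ω))
      (fun t ω => c⁻¹ • act S (cumulative θ t ω + z t ω)) ↔ EqAE P G fun _ _ => 0 := by
    refine eventually_congr (Eventually.of_forall fun ω => eventually_congr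
      (Eventually.of_forall fun t => ?_))
    rw [← sub_eq_zero]
    simp only [G]
    rw [sub_add_eq_add_sub]
  rw [hiff]
  constructor
  · intro h
    -- Rates of class `𝒜` already force the gradient to vanish; the converse direction covers all of
    -- `H²` by concavity.
    refine eqAE_zero_of_orthogonal hT hB hG r fun η e hη => ?_
    refine eq_zero_of_forall_quadratic
      (Q := gainHess P r S Λ c (fun _ _ => 0) (cumulative η) η) fun ε => ?_
    have h1 := h _ ((hη.memH2 hT).const_smul hT ε)
    have hcum : ∀ t ω, cumulative (fun t ω => ε • η t ω) t ω = ε • cumulative η t ω :=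
      fun t ω => integral_smul _ _
    simp only [hcum] at h1
    rw [hexp η (hη.memH2 hT) ε] at h1
    linarith
  · intro h η hη
    have h1 := hexp η hη 1
    simp only [one_smul, one_mul, one_pow] at h1
    rw [h1, discounted_inner_eq_zero (h.jointEq hT hG.1 isOptional_zero)]
    linarith [hneg η]

/-- The first-order condition for the mean-variance functional with transaction costs when a
change `η` of the rate, with drift `e`, moves the returns by `-A ∫ η + 2 Λ (e - r η)`. -/
theorem gain_le_iff_of_cost_impact (hT : 0 < T) {W : Proc T Ω d} (hB : IsBrownianMotion P W)
    (hF : F = augmentedFiltration P W hB.measurable) {A : Matrix (Fin d) (Fin d) ℝ}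
    (hS : S.PosDef) (hΛ : Λ.PosDef) (hA : A.IsHermitian) (hA0 : ∀ x, 0 ≤ inner ℝ x (act A x))
    (r : ℝ) {c : ℝ} (hc : 0 < c) (hz : MemHInfty P F z) (hν : MemHInfty P F ν)
    (hθ : MemAWithDrift P F θ a) :
    (∀ η e, MemAWithDrift P F η e → gain P r S Λ c z
      (fun t ω => ν t ω + ((2 : ℝ) • act Λ (e t ω - r • η t ω) - act A (cumulative η t ω)))
      (fun t ω => cumulative θ t ω + cumulative η t ω) (fun t ω => θ t ω + η t ω) ≤
        gain P r S Λ c z ν (cumulative θ) θ) ↔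
    EqAE P (fun t ω => ν t ω + (4 : ℝ) • act Λ (a t ω - r • θ t ω))
      fun t ω => act A (cumulative θ t ω) + c⁻¹ • act S (cumulative θ t ω + z t ω) := by
  subst hF
  set F := augmentedFiltration P W hB.measurable
  have hφ := hθ.memHInfty_cumulative hT
  have hu : MemHInfty P F fun t ω => act Λ (a t ω - r • θ t ω) :=
    (hθ.drift_bounded.sub (hθ.bounded.const_smul r)).act Λ
  have hν0 : MemHInfty P F fun t ω => ν t ω - c⁻¹ • act S (cumulative θ t ω + z t ω)
      + (2 : ℝ) • act Λ (a t ω - r • θ t ω) :=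
    (hν.sub (((hφ.add hz).act S).const_smul c⁻¹)).add (hu.const_smul 2)
  have hκ0 : MemHInfty P F fun t ω => (2 : ℝ) • act Λ (a t ω - r • θ t ω)
      - act A (cumulative θ t ω) := (hu.const_smul 2).sub (hφ.act A)
  let G : Proc T Ω d := fun t ω => (ν t ω - c⁻¹ • act S (cumulative θ t ω + z t ω)
    + (2 : ℝ) • act Λ (a t ω - r • θ t ω)) +
    ((2 : ℝ) • act Λ (a t ω - r • θ t ω) - act A (cumulative θ t ω))
  have hG : MemHInfty P F G := hν0.add hκ0
  let κ : Proc T Ω d → Proc T Ω d → Proc T Ω d := fun η e t ω =>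
    (2 : ℝ) • act Λ (e t ω - r • η t ω) - act A (cumulative η t ω)
  have hκ : ∀ {η e : Proc T Ω d}, MemAWithDrift P F η e → SqInt P (κ η e) := fun {η e} hη =>
    (((((hη.drift_bounded.sub (hη.bounded.const_smul r)).act Λ).const_smul 2).sub
      ((hη.memHInfty_cumulative hT).act A)).memH2 hT).sqInt hT
  -- After integration by parts the pairing with the returns response is the form -2⟨x, Λη⟩ - ⟨∫x,
  -- A∫η⟩, free of drifts, symmetric and negative semidefinite.
  have hcross : ∀ {η e x : Proc T Ω d}, MemAWithDrift P F η e → MemH2 P F x →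
      discounted P r (fun t ω => inner ℝ (cumulative x t ω) (κ η e t ω)) =
        -2 * discounted P r (fun t ω => inner ℝ (x t ω) (act Λ (η t ω))) -
          discounted P r fun t ω => inner ℝ (cumulative x t ω) (act A (cumulative η t ω)) := by
    intro η e x hη hx
    have hx2 := (hx.sqInt hT).cumulative hT hx.1
    have i1 : JointInt P fun t ω => inner ℝ (cumulative x t ω) (act Λ (e t ω - r • η t ω)) :=
      hx2.inner ((((hη.drift_bounded.sub (hη.bounded.const_smul r)).act Λ).memH2 hT).sqInt hT)
    have i2 : JointInt P fun t ω =>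
        inner ℝ (cumulative x t ω) (act A (cumulative η t ω)) :=
      hx2.inner ((((hη.memHInfty_cumulative hT).act A).memH2 hT).sqInt hT)
    simp only [κ, inner_sub_right, real_inner_smul_right]
    rw [discounted_sub (i1.const_mul 2) i2, discounted_const_mul,
      discounted_inner_act_drift hT hη hx]
    ring
  have hexp : ∀ η e, MemAWithDrift P F η e → ∀ ε : ℝ,
      gain P r S Λ c z (fun t ω => ν t ω + ε • κ η e t ω)
      (fun t ω => cumulative θ t ω + ε • cumulative η t ω) (fun t ω => θ t ω + ε • η t ω) =
      gain P r S Λ c z ν (cumulative θ) θ +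
        ε * discounted P r (fun t ω => inner ℝ (cumulative η t ω) (G t ω)) +
        ε ^ 2 * gainHess P r S Λ c (κ η e) (cumulative η) η := by
    intro η e hη ε
    have hη2 := hη.memH2 hT
    have hx2 := (hη2.sqInt hT).cumulative hT hη2.1
    rw [gain_add_rate hT hS hΛ r c ε (hz.memH2 hT) (hν.memH2 hT) hθ hη2 (hκ hη)]
    congr 3
    -- By symmetry the response to `η` can be exchanged for the response to `θ`. This adds another
    -- 2Λ(a - rθ) to the gradient, whence the factor 4.
    have h1 : discounted P r (fun t ω => inner ℝ (cumulative θ t ω) (κ η e t ω)) =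
        discounted P r (fun t ω => inner ℝ (cumulative η t ω) (κ θ a t ω)) := by
      rw [hcross hη (hθ.memH2 hT), hcross hθ hη2]
      simp only [inner_act_comm hΛ.isHermitian (θ _ _), inner_act_comm hA (cumulative θ _ _)]
    rw [h1, ← discounted_add (hx2.inner ((hν0.memH2 hT).sqInt hT)) (hx2.inner (hκ hθ))]
    simp only [G, κ, ← inner_add_right]
  -- The response of the returns only adds to the concavity of risk and costs.
  have hneg : ∀ η e, MemAWithDrift P F η e →
      gainHess P r S Λ c (κ η e) (cumulative η) η ≤ 0 := by
    intro η e hη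
    have hη2 := (hη.memH2 hT).sqInt hT
    have hx2 := hη2.cumulative hT hη.bounded.1
    have i1 := hx2.inner (hκ hη)
    have i2 := (hx2.inner (hx2.act S)).const_mul (1 / (2 * c))
    have i3 := hη2.inner (hη2.act Λ)
    rw [gainHess, discounted_sub (i1.sub i2) i3, discounted_sub i1 i2, discounted_const_mul,
      hcross hη (hη.memH2 hT)]
    have n1 := discounted_nonneg (P := P) (fun t ω => inner_act_nonneg hΛ (η t ω)) r
    have n2 := discounted_nonneg (P := P) (fun t ω => inner_act_nonneg hS (cumulative η t ω)) r
    have n3 := discounted_nonneg (P := P) (fun t ω => hA0 (cumulative η t ω)) r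
    have n4 := mul_nonneg (by positivity : 0 ≤ 1 / (2 * c)) n2
    linarith
  have hiff : EqAE P (fun t ω => ν t ω + (4 : ℝ) • act Λ (a t ω - r • θ t ω))
      (fun t ω => act A (cumulative θ t ω) + c⁻¹ • act S (cumulative θ t ω + z t ω)) ↔
      EqAE P G fun _ _ => 0 := by
    refine eventually_congr (Eventually.of_forall fun ω => eventually_congr
      (Eventually.of_forall fun t => ?_))
    rw [← sub_eq_zero, show G t ω = (ν t ω + (4 : ℝ) • act Λ (a t ω - r • θ t ω)) -
      (act A (cumulative θ t ω) + c⁻¹ • act S (cumulative θ t ω + z t ω)) by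
        simp only [G]; module]
  rw [hiff]
  constructor
  · intro h
    refine eqAE_zero_of_orthogonal hT hB hG r fun η e hη => ?_
    refine eq_zero_of_forall_quadratic
      (Q := gainHess P r S Λ c (κ η e) (cumulative η) η) fun ε => ?_
    have h1 := h _ _ (hη.const_smul hT ε)
    have hcum : ∀ t ω, cumulative (fun t ω => ε • η t ω) t ω = ε • cumulative η t ω :=
      fun t ω => integral_smul _ _
    have hκε : ∀ t ω, (2 : ℝ) • act Λ (ε • e t ω - r • ε • η t ω) - act A (ε • cumulative η t ω) =
        ε • κ η e t ω := fun t ω => by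
      simp only [κ, act_sub, act_smul]
      module
    simp only [hcum, hκε] at h1
    rw [hexp η e hη ε] at h1
    linarith
  · intro h η e hη
    have h1 := hexp η e hη 1
    simp only [one_smul, one_mul, one_pow] at h1
    rw [h1, discounted_inner_eq_zero (h.jointEq hT hG.1 isOptional_zero)]
    linarith [hneg η e hη]

end Gain

end CostStationarity

end PriceImpact

end

/-! ### Equilibrium with transaction costs. -/

noncomputable section

namespace PriceImpact

namespace Market

section Cost

variable {Ω : Type*} [MeasurableSpace Ω] {d : ℕ} {P : Measure Ω} [IsProbabilityMeasure P]

lemma costObjective_eq_gain {N : ℕ} (K : Market Ω d N) (hT : 0 < K.T) (m : Fin N)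
    {z ν θ : Proc K.T Ω d} (hz : SqInt P z) (hν : SqInt P ν)
    (hθ : MemH2 P (K.filtration P) θ) :
    K.costObjective P m z ν θ = gain P K.r K.cov K.Λ (K.δ m) z ν (cumulative θ) θ :=
  (discounted_eq_integral (jointInt_gain _ hz hν ((hθ.sqInt hT).cumulative hT hθ.1)
    (hθ.sqInt hT)) _).symm

/-- A price-taking rate is only known to lie in `H²`. Clearing equates it almost surely with a
process of class `𝒜`, to which the first-order condition applies. -/
lemma IsCostPriceTakerRate.congr {N : ℕ} {K : Market Ω d N} (hT : 0 < K.T) {m : Fin N}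
    {z ν θ θ' : Proc K.T Ω d} (h : K.IsCostPriceTakerRate P m z ν θ)
    (hz : SqInt P z) (hν : SqInt P ν) (hθ' : MemH2 P (K.filtration P) θ') (he : EqAE P θ θ') :
    K.IsCostPriceTakerRate P m z ν θ' := by
  refine ⟨hθ', fun η hη => (h.2 η hη).trans_eq ?_⟩
  rw [K.costObjective_eq_gain hT m hz hν h.1, K.costObjective_eq_gain hT m hz hν hθ']
  exact gain_congr _ _ .rfl (jointEq_of_forall he.cumulative_eq) (he.jointEq hT h.1.1 hθ'.1)

lemma isCostPriceTakerRate_iff {N : ℕ} {K : Market Ω d N} (hT : 0 < K.T)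
    (hW : IsBrownianMotion P K.W) (hcov : K.cov.PosDef) (hΛ : K.Λ.PosDef) {m : Fin N}
    (hδ : 0 < K.δ m) {z ν θ a : Proc K.T Ω d} (hz : MemHInfty P (K.filtration P) z)
    (hν : MemHInfty P (K.filtration P) ν) (hθ : MemAWithDrift P (K.filtration P) θ a) :
    K.IsCostPriceTakerRate P m z ν θ ↔
      EqAE P (fun t ω => ν t ω + (2 : ℝ) • act K.Λ (a t ω - K.r • θ t ω))
        fun t ω => (K.δ m)⁻¹ • act K.cov (cumulative θ t ω + z t ω) := by
  rw [← gain_le_iff_of_cost hT hW rfl hcov hΛ K.r hδ hz hν hθ]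
  have hz2 := (hz.memH2 hT).sqInt hT
  have hν2 := (hν.memH2 hT).sqInt hT
  have hθ2 := hθ.memH2 hT
  have hval : ∀ η, MemH2 P (K.filtration P) η →
      K.costObjective P m z ν (fun t ω => θ t ω + η t ω) = gain P K.r K.cov K.Λ (K.δ m) z ν
        (fun t ω => cumulative θ t ω + cumulative η t ω) (fun t ω => θ t ω + η t ω) := by
    intro η hη
    rw [K.costObjective_eq_gain hT m hz2 hν2 (hθ2.add hT hη)]
    refine gain_congr _ _ .rfl (jointEq_of_forall ?_) .rfl
    filter_upwards [(hη.sqInt hT).ae_integrable] with ω hω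
    exact cumulative_add (hθ.integrable_path ω) hω
  rw [IsCostPriceTakerRate, and_iff_right hθ2, K.costObjective_eq_gain hT m hz2 hν2 hθ2]
  constructor
  · intro h η hη
    rw [← hval η hη]
    exact h _ (hθ2.add hT hη)
  · intro h η hη
    have h1 := h _ (hη.sub hT hθ2)
    rw [← hval _ (hη.sub hT hθ2)] at h1
    simpa only [add_sub_cancel] using h1

variable {K : Market Ω d 2} {aψ : Proc K.T Ω d}

/-- The returns at which an investor `j` with exposure `z` absorbs the rate `θ` with drift `a` of
the other investor and the rate of the noise traders with drift `aψ`. -/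
def costImpact (K : Market Ω d 2) (aψ : Proc K.T Ω d) (j : Fin 2) (z θ a : Proc K.T Ω d) :
    Proc K.T Ω d := fun t ω =>
  (K.δ j)⁻¹ • act K.cov (z t ω - cumulative θ t ω - K.ψ t ω) +
    (2 : ℝ) • act K.Λ (a t ω + aψ t ω - K.r • (θ t ω + K.ψdot t ω))

lemma memHInfty_costImpact (hT : 0 < K.T) (hψ : MemAWithDrift P (K.filtration P) K.ψdot aψ)
    {j : Fin 2} {z θ a : Proc K.T Ω d} (hz : MemHInfty P (K.filtration P) z)
    (hθ : MemAWithDrift P (K.filtration P) θ a) :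
    MemHInfty P (K.filtration P) (K.costImpact aψ j z θ a) :=
  ((((hz.sub (hθ.memHInfty_cumulative hT)).sub (hψ.memHInfty_cumulative hT)).act _).const_smul
    _).add ((((hθ.add hT hψ).drift_bounded.sub
      ((hθ.add hT hψ).bounded.const_smul _)).act _).const_smul _)

/-- The other investor must trade at the rate `χ = -(θ + ψdot)`, which is again of class `𝒜`; her
first-order condition is solved for the returns. -/
lemma isCostPriceImpact_iff (hT : 0 < K.T) (hW : IsBrownianMotion P K.W) (hcov : K.cov.PosDef)
    (hΛ : K.Λ.PosDef) (hδ : ∀ m, 0 < K.δ m)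
    (hψ : MemAWithDrift P (K.filtration P) K.ψdot aψ) {n j : Fin 2} (hnj : n ≠ j)
    {z : Fin 2 → Proc K.T Ω d} (hz : MemHInfty P (K.filtration P) (z j))
    {θ a ν : Proc K.T Ω d} (hθ : MemAWithDrift P (K.filtration P) θ a) :
    K.IsCostPriceImpact P n z θ ν ↔ MemHInfty P (K.filtration P) ν ∧
      EqAE P ν (K.costImpact aψ j (z j) θ a) := by
  refine and_congr_right fun hν => ?_
  let χ : Proc K.T Ω d := fun t ω => (-1 : ℝ) • (θ t ω + K.ψdot t ω)
  have hχ : MemAWithDrift P (K.filtration P) χ fun t ω => (-1 : ℝ) • (a t ω + aψ t ω) :=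
    (hθ.add hT hψ).const_smul hT (-1)
  have hcum : ∀ t ω, cumulative χ t ω = -(cumulative θ t ω + K.ψ t ω) := by
    intro t ω
    simp only [χ, neg_one_smul]
    rw [cumulative_neg, cumulative_add (hθ.integrable_path ω) (hψ.integrable_path ω)]
    rfl
  have hiff : K.IsCostPriceTakerRate P j (z j) ν χ ↔
      EqAE P ν (K.costImpact aψ j (z j) θ a) := by
    rw [isCostPriceTakerRate_iff hT hW hcov hΛ (hδ j) hz hν hχ]
    refine eventually_congr (Eventually.of_forall fun ω => eventually_congr
      (Eventually.of_forall fun t => ?_))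
    simp only [hcum, costImpact, χ]
    rw [← sub_eq_zero, ← sub_eq_zero (a := ν t ω)]
    refine Eq.congr ?_ rfl
    have hneg : ∀ x : Vec d, act K.cov (-x) = -act K.cov x := map_neg _
    simp only [act_add, act_sub, act_smul, hneg]
    module
  rw [← hiff]
  constructor
  · rintro ⟨Θ, hΘn, hΘ, hcl⟩
    refine (hΘ j hnj.symm).congr hT ((hz.memH2 hT).sqInt hT) ((hν.memH2 hT).sqInt hT)
      (hχ.memH2 hT) (eqAE_of_forall ?_)
    filter_upwards [hcl] with ω h1 t
    have h2 := (h1 t).2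
    rw [sum_two _ hnj, hΘn] at h2
    rw [← sub_eq_zero, ← h2]
    simp only [χ]
    module
  · intro h
    let Θ : Fin 2 → Proc K.T Ω d := fun m => if m = n then θ else χ
    have hΘn : Θ n = θ := if_pos rfl
    have hΘj : Θ j = χ := if_neg hnj.symm
    refine ⟨Θ, hΘn, fun m hm => ?_, Eventually.of_forall fun ω t => ?_⟩
    · obtain rfl := eq_of_ne_of_ne hnj hm
      rwa [hΘj]
    · rw [sum_two _ hnj, sum_two _ hnj, hΘn, hΘj, hcum]
      simp only [χ]
      constructor <;> module

/-- A change of the rate by η with drift e moves the impact by 2Λ(e - rη) - δ_j⁻¹Σ∫η, the situation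
of `gain_le_iff_of_cost_impact`. -/
lemma isCostBestResponse_iff (hT : 0 < K.T) (hW : IsBrownianMotion P K.W) (hcov : K.cov.PosDef)
    (hΛ : K.Λ.PosDef) (hδ : ∀ m, 0 < K.δ m)
    (hψ : MemAWithDrift P (K.filtration P) K.ψdot aψ) {n j : Fin 2} (hnj : n ≠ j)
    (hζ : MemHInfty P (K.filtration P) (K.ζ n)) {z : Fin 2 → Proc K.T Ω d}
    (hz : MemHInfty P (K.filtration P) (z j)) {θ a : Proc K.T Ω d}
    (hθ : MemAWithDrift P (K.filtration P) θ a) :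
    K.IsCostBestResponse P n z θ ↔
      EqAE P (fun t ω => K.costImpact aψ j (z j) θ a t ω +
        (4 : ℝ) • act K.Λ (a t ω - K.r • θ t ω))
        fun t ω => (K.δ j)⁻¹ • act K.cov (cumulative θ t ω) +
          (K.δ n)⁻¹ • act K.cov (cumulative θ t ω + K.ζ n t ω) := by
  have himp := fun {θ a : Proc K.T Ω d} (hθ : MemAWithDrift P (K.filtration P) θ a) =>
    memHInfty_costImpact (j := j) hT hψ hz hθ
  have hval : ∀ {θ a ν}, MemAWithDrift P (K.filtration P) θ a → K.IsCostPriceImpact P n z θ ν →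
      K.costObjective P n (K.ζ n) ν θ = gain P K.r K.cov K.Λ (K.δ n) (K.ζ n)
        (K.costImpact aψ j (z j) θ a) (cumulative θ) θ := by
    intro θ a ν hθ hν
    obtain ⟨hν', he⟩ := (isCostPriceImpact_iff hT hW hcov hΛ hδ hψ hnj hz hθ).1 hν
    rw [K.costObjective_eq_gain hT n ((hζ.memH2 hT).sqInt hT) ((hν'.memH2 hT).sqInt hT)
      (hθ.memH2 hT)]
    exact gain_congr _ _ (he.jointEq hT hν'.1 (himp hθ).1) .rfl .rfl
  have hex := fun {θ a : Proc K.T Ω d} (hθ : MemAWithDrift P (K.filtration P) θ a) =>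
    (isCostPriceImpact_iff hT hW hcov hΛ hδ hψ hnj hz hθ).2
      ⟨himp hθ, eqAE_of_forall (by simp)⟩
  have hFOC := gain_le_iff_of_cost_impact hT hW rfl (A := (K.δ j)⁻¹ • K.cov) hcov hΛ
    (isHermitian_smul hcov _) (inner_smul_act_nonneg hcov (inv_pos.2 (hδ j)).le) K.r (hδ n) hζ
    (himp hθ) hθ
  simp only [act_smul_matrix] at hFOC
  rw [← hFOC]
  have hcum : ∀ {η e : Proc K.T Ω d}, MemAWithDrift P (K.filtration P) η e →
      cumulative (fun t ω => θ t ω + η t ω) =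
        fun t ω => cumulative θ t ω + cumulative η t ω := fun hη =>
    funext fun t => funext fun ω =>
      cumulative_add (hθ.integrable_path ω) (hη.integrable_path ω) t
  have hshift : ∀ {η e : Proc K.T Ω d}, MemAWithDrift P (K.filtration P) η e →
      (fun t ω => K.costImpact aψ j (z j) θ a t ω +
        ((2 : ℝ) • act K.Λ (e t ω - K.r • η t ω) - (K.δ j)⁻¹ • act K.cov (cumulative η t ω))) =
      K.costImpact aψ j (z j) (fun t ω => θ t ω + η t ω) fun t ω => a t ω + e t ω := by
    intro η e hη
    ext1 t
    ext1 ω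
    simp only [costImpact, hcum hη, act_sub, act_add, act_smul]
    module
  constructor
  · rintro ⟨-, ν, hν, h⟩ η e hη
    have hθη := hθ.add hT hη
    rw [hshift hη, ← hcum hη, ← hval hθη (hex hθη), ← hval hθ hν]
    exact h _ _ ⟨_, hθη⟩ (hex hθη)
  · intro h
    refine ⟨⟨a, hθ⟩, _, hex hθ, fun θ' ν' ⟨a', hθ'⟩ hν' => ?_⟩
    have hη := hθ'.sub hT hθ
    have h1 := h _ _ hη
    rw [hshift hη, ← hcum hη] at h1
    simp only [add_sub_cancel] at h1
    rwa [hval hθ' hν', hval hθ (hex hθ)]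

lemma memHInfty_revealedExposure {ν : Proc K.T Ω d} {φ : Fin 2 → Proc K.T Ω d}
    (hν : MemHInfty P (K.filtration P) ν) {m : Fin 2} (hφ : MemHInfty P (K.filtration P) (φ m)) :
    MemHInfty P (K.filtration P) (K.revealedExposure ν φ m) :=
  ((hν.act _).const_smul _).sub hφ

/-- Revealed exposures disregard costs, so the impact of investor `n` is not `ν` but `ν` plus twice
a cost term. Adding the two first-order conditions and using clearing, the cost terms amount to
-2Λ(a^ψ - rψ̇) beside 2ν, and the rest is as without costs. -/
theorem IsCostNashReturns.eqAE (hT : 0 < K.T) (hW : IsBrownianMotion P K.W)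
    (hcov : K.cov.PosDef) (hΛ : K.Λ.PosDef) (hδ : ∀ m, 0 < K.δ m)
    (hζ : ∀ m, MemHInfty P (K.filtration P) (K.ζ m))
    (hψ : MemAWithDrift P (K.filtration P) K.ψdot aψ) {ν : Proc K.T Ω d}
    (h : K.IsCostNashReturns P ν) : EqAE P ν fun t ω =>
      K.frictionlessReturns t ω + act K.Λ (aψ t ω - K.r • K.ψdot t ω) := by
  obtain ⟨hν, θ, hbr, hcl⟩ := h
  choose a hθ using fun n => (hbr n).1
  have hfoc : ∀ n j : Fin 2, n ≠ j → EqAE P (fun t ω => ν t ω +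
      (2 : ℝ) • act K.Λ (a n t ω + aψ t ω - K.r • (θ n t ω + K.ψdot t ω)) +
      (4 : ℝ) • act K.Λ (a n t ω - K.r • θ n t ω))
      fun t ω => (K.δ j)⁻¹ • act K.cov (cumulative (θ n) t ω) +
        (K.δ n)⁻¹ • act K.cov (cumulative (θ n) t ω + K.ζ n t ω) := by
    intro n j hnj
    refine EqAE.trans (eqAE_of_forall ?_) ((isCostBestResponse_iff hT hW hcov hΛ hδ hψ hnj (hζ n)
      (memHInfty_revealedExposure hν ((hθ j).memHInfty_cumulative hT)) (hθ n)).1 (hbr n))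
    filter_upwards [hcl] with ω h1 t
    rw [costImpact, act_cov_revealedExposure (φ := fun m => cumulative (θ m)) hcov hnj (hδ j)
      (h1 t).1]
  -- Clearing makes the total rate vanish, and so does its drift by uniqueness.
  have hdrift : EqAE P (fun t ω => a 0 t ω + a 1 t ω + aψ t ω) fun _ _ => 0 := by
    refine (((hθ 0).add hT (hθ 1)).add hT hψ).drift_eq_zero hT hW ?_
    filter_upwards [hcl] with ω h1 t
    rw [← Fin.sum_univ_two fun m => θ m t ω]
    exact (h1 t).2
  filter_upwards [hfoc 0 1 zero_ne_one, hfoc 1 0 one_ne_zero, hdrift, hcl] with ω h1 h2 h3 h4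
  filter_upwards [h1, h2, h3] with t e0 e1 e2
  obtain ⟨e3, e4⟩ := h4 t
  rw [Fin.sum_univ_two] at e3 e4
  have c1 : cumulative (θ 1) t ω = -cumulative (θ 0) t ω - K.ψ t ω := by
    rw [← sub_eq_zero, ← e3]
    abel
  have c2 : θ 1 t ω = -θ 0 t ω - K.ψdot t ω := by
    rw [← sub_eq_zero, ← e4]
    abel
  have c3 : a 1 t ω = -a 0 t ω - aψ t ω := by
    rw [← sub_eq_zero, ← e2]
    abel
  have hneg : ∀ (A : Matrix (Fin d) (Fin d) ℝ) (x : Vec d), act A (-x) = -act A x :=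
    fun A => map_neg _
  rw [frictionlessReturns_eq hδ]
  rw [← sub_eq_zero] at e0 e1 ⊢
  rw [c1, c2, c3] at e1
  refine Eq.trans ?_ (show (1 / 2 : ℝ) • ((0 : Vec d) + 0) = 0 by simp)
  nth_rw 1 [← e0]
  rw [← e1]
  simp only [act_add, act_sub, act_smul, hneg]
  module

theorem isCostNashReturns (hT : 0 < K.T) (hW : IsBrownianMotion P K.W)
    (hcov : K.cov.PosDef) (hd : K.Λ.IsDiag) (hΛ : K.Λ.PosDef) (hδ : ∀ m, 0 < K.δ m)
    (hζ : ∀ m, MemHInfty P (K.filtration P) (K.ζ m))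
    (hψ : MemAWithDrift P (K.filtration P) K.ψdot aψ) {ν : Proc K.T Ω d}
    (hν : MemHInfty P (K.filtration P) ν) (hνeq : ν = fun t ω =>
      K.frictionlessReturns t ω + act K.Λ (aψ t ω - K.r • K.ψdot t ω)) :
    K.IsCostNashReturns P ν := by
  have h0 := hδ 0
  have h1 := hδ 1
  have hc : 0 < ((K.δ 0)⁻¹ + (K.δ 1)⁻¹) / 6 := by positivity
  have hu : MemHInfty P (K.filtration P) fun t ω => act K.Λ (aψ t ω - K.r • K.ψdot t ω) :=
    (hψ.drift_bounded.sub (hψ.bounded.const_smul _)).act _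
  -- The first-order condition of investor `0`: the own cost terms are 2 + 4 = 6 copies of Λ(b -
  -- rχ), and the equation is divided by 6.
  obtain ⟨χ, b, hχ, he⟩ := exists_forwardBackward hT hW K.r hd hΛ (hcov.smul hc)
    ((((((hζ 0).act K.cov).const_smul (K.δ 0)⁻¹).sub hν).sub (hu.const_smul 2)).const_smul (1 / 6))
  let θ : Fin 2 → Proc K.T Ω d := ![χ, fun t ω => (-1 : ℝ) • (χ t ω + K.ψdot t ω)]
  let a : Fin 2 → Proc K.T Ω d := ![b, fun t ω => (-1 : ℝ) • (b t ω + aψ t ω)]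
  have hθ : ∀ n, MemAWithDrift P (K.filtration P) (θ n) (a n) :=
    Fin.forall_fin_two.2 ⟨hχ, (hχ.add hT hψ).const_smul hT (-1)⟩
  have hcum : ∀ t ω, cumulative (θ 1) t ω = -(cumulative χ t ω + K.ψ t ω) := by
    intro t ω
    simp only [θ, neg_one_smul, Matrix.cons_val_one, Matrix.cons_val_fin_one]
    rw [cumulative_neg, cumulative_add (hχ.integrable_path ω) (hψ.integrable_path ω)]
    rfl
  have hcl : ∀ t ω, (∑ m, cumulative (θ m) t ω) + K.ψ t ω = 0 := by
    intro t ω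
    rw [Fin.sum_univ_two, hcum]
    simp only [θ, Matrix.cons_val_zero]
    abel
  have hneg : ∀ (A : Matrix (Fin d) (Fin d) ℝ) (x : Vec d), act A (-x) = -act A x :=
    fun A => map_neg _
  have hfoc : ∀ n j : Fin 2, n ≠ j → EqAE P (fun t ω => ν t ω +
      (2 : ℝ) • act K.Λ (a n t ω + aψ t ω - K.r • (θ n t ω + K.ψdot t ω)) +
      (4 : ℝ) • act K.Λ (a n t ω - K.r • θ n t ω))
      fun t ω => (K.δ j)⁻¹ • act K.cov (cumulative (θ n) t ω) +
        (K.δ n)⁻¹ • act K.cov (cumulative (θ n) t ω + K.ζ n t ω) := by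
    intro n j hnj
    filter_upwards [he] with ω h2
    filter_upwards [h2] with t h3
    rw [← sub_eq_zero] at h3 ⊢
    obtain ⟨rfl, rfl⟩ | ⟨rfl, rfl⟩ : n = 0 ∧ j = 1 ∨ n = 1 ∧ j = 0 := by omega
    · refine Eq.trans ?_ (show (6 : ℝ) • (0 : Vec d) = 0 by simp)
      rw [← h3]
      simp only [θ, a, Matrix.cons_val_zero, act_add, act_sub, act_smul, act_smul_matrix]
      module
    -- The condition of investor `1` is that of investor `0` with opposite sign plus twice the
    -- formula for `ν`; only here is the form of `ν` used.
    · have h4 : (2 : ℝ) • (ν t ω - (K.frictionlessReturns t ω +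
          act K.Λ (aψ t ω - K.r • K.ψdot t ω))) = 0 := by
        rw [hνeq, sub_self, smul_zero]
      refine Eq.trans ?_ (show (-6 : ℝ) • (0 : Vec d) + 0 = 0 by simp)
      nth_rw 1 [← h3]
      rw [← h4, hcum, frictionlessReturns_eq hδ]
      simp only [θ, a, Matrix.cons_val_one, Matrix.cons_val_fin_one, act_add, act_sub, act_smul,
        act_smul_matrix, hneg]
      module
  refine ⟨hν, θ, fun n => ?_, Eventually.of_forall fun ω t => ⟨hcl t ω, ?_⟩⟩
  · obtain ⟨j, hnj⟩ := exists_ne n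
    rw [isCostBestResponse_iff hT hW hcov hΛ hδ hψ hnj.symm (hζ n)
      (memHInfty_revealedExposure hν ((hθ j).memHInfty_cumulative hT)) (hθ n)]
    refine EqAE.trans (eqAE_of_forall (Eventually.of_forall fun ω t => ?_)) (hfoc n j hnj.symm)
    rw [costImpact, act_cov_revealedExposure (φ := fun m => cumulative (θ m)) hcov hnj.symm (hδ j)
      (hcl t ω)]
  · rw [Fin.sum_univ_two]
    simp only [θ, Matrix.cons_val_zero, Matrix.cons_val_one, Matrix.cons_val_fin_one]
    module

end Cost

end Market

end PriceImpact

end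

theorem theorem4p7 {Ω : Type*} [MeasurableSpace Ω] (P : Measure Ω) [IsProbabilityMeasure P]
    {d : ℕ} (K : PriceImpact.Market Ω d 2)
    (hT : 0 < K.T) (hr : 0 ≤ K.r)
    (hW : PriceImpact.IsBrownianMotion P K.W)
    (hcov : K.cov.PosDef)
    (hΛdiag : K.Λ.IsDiag) (hΛ : K.Λ.PosDef)
    (hδ : ∀ m, 0 < K.δ m)
    (hζ : ∀ m, PriceImpact.MemHInfty P (K.filtration P) (K.ζ m))
    (aψdot : PriceImpact.Proc K.T Ω d)
    (hψ : PriceImpact.MemAWithDrift P (K.filtration P) K.ψdot aψdot)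
    (νcost : PriceImpact.Proc K.T Ω d)
    (hνcost : νcost = fun t ω =>
      K.frictionlessReturns t ω + PriceImpact.act K.Λ (aψdot t ω - K.r • K.ψdot t ω)) :
    (K.IsFrictionlessNashReturns P K.frictionlessReturns ∧
      ∀ ν, K.IsFrictionlessNashReturns P ν → PriceImpact.EqAE P ν K.frictionlessReturns) ∧
    (PriceImpact.MemHInfty P (K.filtration P) νcost ∧
      K.IsCostNashReturns P νcost ∧
      ∀ ν, K.IsCostNashReturns P ν → PriceImpact.EqAE P ν νcost) := by
  have hψ' : PriceImpact.MemHInfty P (K.filtration P) K.ψ := hψ.memHInfty_cumulative hT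
  have hν : PriceImpact.MemHInfty P (K.filtration P) νcost := by
    rw [hνcost]
    exact (PriceImpact.Market.memHInfty_frictionlessReturns hδ hζ hψ').add
      ((hψ.drift_bounded.sub (hψ.bounded.const_smul _)).act _)
  refine ⟨⟨PriceImpact.Market.frictionlessReturns_isNash hT hcov hδ hζ hψ',
    fun ν h => h.eqAE hT hcov hδ hζ hψ'⟩, hν,
    PriceImpact.Market.isCostNashReturns hT hW hcov hΛdiag hΛ hδ hζ hψ hν hνcost, fun ν h => ?_⟩
  rw [hνcost]
  exact h.eqAE hT hW hcov hΛ hδ hζ hψ
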